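/- **Setting.** Let $k$ be an algebraically closed field of characteristic $p>0$. Let $\sigma\subset\mathbb R^d$ ($d\ge 0$) be a strongly convex rational polyhedral cone of dimension $d$ with minimal generators $v_1,\dots,v_n\in\mathbb Z^d$ (each $v_i$ being the shortest lattice vector on its ray), and let $$A=k[\sigma^\vee\cap\mathbb Z^d],\qquad \sigma^\vee\cap\mathbb Z^d=\{m\in\mathbb Z^d:\langle m,v_i\rangle\ge 0\text{ for all }i\},$$ be the corresponding ($d$-dimensional, pointed, normal, affine) toric ring, with irrelevant maximal ideal $\mathfrak m=(t^m: m\ne 0)$. The F-signature of $A$ is that of the local ring $R=A_{\mathfrak m}$, $$s(A)=\lim_{e\to\infty}\frac{\max\{r: F^e_*R\cong R^{r}\oplus M\text{ for some }R\text{-module }M\}}{\operatorname{rank}_R F^e_*R}.$$ Let $\mathfrak p_i\subset A$ be the height one prime generated by the monomials $t^m$ with $\langle m,v_i\rangle\ge1$. Put $S_1=k[x_iy_j: 0\le i,j\le 1]$ and $S_2=k[x_iy_j: 0\le i,j\le 2]$, the coordinate rings of the Segre products $\mathbb P^1\#\mathbb P^1$ and $\mathbb P^2\#\mathbb P^2$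 (the cones over $\mathbb P^1\times\mathbb P^1$ and $\mathbb P^2\times\mathbb P^2$). Isomorphisms are isomorphisms of $k$-algebras. **Theorem.** The limit $s(A)$ exists for every toric ring $A$, and the following hold. 1. Suppose that $A$ is a polynomial ring over $k$ or that no polynomial variable splits off from $A$, that is, none of the ideals $\mathfrak p_i$ is principal ($[\mathfrak p_i]\ne0$ in $\operatorname{Cl}(A)$ for all $i$). Then $s(A)>\frac12$ if and only if $A$ is isomorphic to one of the following: - the polynomial ring $k[x_1,\dots,x_d]$, and then $s(A)=1$; - $S_1$, and then $s(A)=\frac23$; - $S_2$, and then $s(A)=\frac{11}{20}$. 2. For an arbitrary toric ring $A$, $s(A)>\frac12$ if and only if $A$ is isomorphic to a polynomial ring $k[x_1,\dots,x_d]$, to $S_1[t_1,\dots,t_r]$ for some $r\ge0$, or to $S_2[t_1,\dots,t_r]$ for some $r\ge 0$; in these cases $s(A)=1$, $\frac23$, $\frac{11}{20}$, respectively. 3. All rings listed occur: for every $d\ge0$ the polynomial ring in $d$ variables is isomorphic to a toric ring of dimension $d$; $S_1$ and $S_2$ are isomorphic to toric rings of dimension $3$ and $5$ for which no $\mathfrak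 p_i$ is principal; and, for every $r\ge0$, $S_1[t_1,\dots,t_r]$ and $S_2[t_1,\dots,t_r]$ are isomorphic to toric rings of dimension $3+r$ and $5+r$. -/

import Mathlib

open Filter Topology

noncomputable section

/-! ### F-signature -/

/-- `F^e_* R`: the additive group of `R` with the module structure `a • F^e_* x = F^e_* (a ^ p ^ e * x)`.
When `R` is reduced this is the `R`-module `R^{1/p^e}`. -/
def FrobeniusPushforward (_p _e : ℕ) (R : Type*) : Type _ := R

namespace FrobeniusPushforward

variable (p e : ℕ) (R : Type*) [CommRing R]

instance : AddCommGroup (FrobeniusPushforward p e R) := inferInstanceAs (AddCommGroup R)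

instance [ExpChar R p] : Module R (FrobeniusPushforward p e R) :=
  Module.compHom R (iterateFrobenius R p e)

/-- The identity map of `R`, seen as a map `x ↦ F^e_* x`. -/
def of (x : R) : FrobeniusPushforward p e R := x

theorem smul_of [ExpChar R p] (a x : R) : a • of p e R x = of p e R (a ^ p ^ e * x) := by
  change iterateFrobenius R p e a * x = a ^ p ^ e * x
  rw [iterateFrobenius_def]

end FrobeniusPushforward

universe u

/-- The largest `n` for which there is a decomposition `F^e_* R ≅ R^n ⊕ M`. -/
def frobeniusFreeRank (p e : ℕ) (R : Type u) [CommRing R] [ExpChar R p] : ℕ :=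
  sSup {n : ℕ | ∃ (M : Type u) (_ : AddCommGroup M) (_ : Module R M),
    Nonempty (FrobeniusPushforward p e R ≃ₗ[R] (Fin n → R) × M)}

/-- `s` is the F-signature of the (F-finite local) domain `R` of characteristic `p`:
the sequence `frobeniusFreeRank p e R / rank (F^e_* R)` converges to `s`. -/
def HasFSignature (p : ℕ) (R : Type u) [CommRing R] [ExpChar R p] (s : ℝ) : Prop :=
  Tendsto (fun e : ℕ => (frobeniusFreeRank p e R : ℝ) /
    (Module.finrank R (FrobeniusPushforward p e R) : ℝ)) atTop (𝓝 s)

/-! ### Toric rings -/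

/-- The image in `ℝ^d` of a lattice vector. -/
def latticeVec {d : ℕ} (w : Fin d → ℤ) : Fin d → ℝ := fun j => (w j : ℝ)

/-- A full-dimensional strongly convex rational polyhedral cone in `ℝ^d`, given by the family
`v` of its minimal generators. -/
structure ToricCone (d : ℕ) where
  /-- the number of minimal generators -/
  n : ℕ
  /-- the minimal generators -/
  v : Fin n → Fin d → ℤ
  span_eq_top : Submodule.span ℝ (Set.range fun i => latticeVec (v i)) = ⊤
  stronglyConvex : ∀ x ∈ PointedCone.hull ℝ (Set.range fun i => latticeVec (v i)),
    -x ∈ PointedCone.hull ℝ (Set.range fun i => latticeVec (v i)) → x = 0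
  minimal : ∀ S : Set (Fin n), S ≠ Set.univ →
    PointedCone.hull ℝ ((fun i => latticeVec (v i)) '' S) ≠
      PointedCone.hull ℝ (Set.range fun i => latticeVec (v i))
  primitive : ∀ (i : Fin n) (w : Fin d → ℤ) (c : ℝ), 0 < c →
    latticeVec w = c • latticeVec (v i) → 1 ≤ c

namespace ToricCone

variable {d : ℕ} (σ : ToricCone d)

/-- The monoid `σ^∨ ∩ ℤ^d` of lattice points of the dual cone. -/
def dualMonoid : AddSubmonoid (Fin d → ℤ) where
  carrier := {m | ∀ i, 0 ≤ m ⬝ᵥ σ.v i}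
  zero_mem' := fun i => by simp
  add_mem' := fun {a b} ha hb i => by
    rw [add_dotProduct]; exact add_nonneg (ha i) (hb i)

theorem eq_zero_of_dotProduct_eq_zero {m : Fin d → ℤ} (h : ∀ i, m ⬝ᵥ σ.v i = 0) : m = 0 := by
  have key : ∀ x ∈ Submodule.span ℝ (Set.range fun i => latticeVec (σ.v i)),
      latticeVec m ⬝ᵥ x = 0 := by
    intro x hx
    induction hx using Submodule.span_induction with
    | mem x hx =>
      obtain ⟨i, rfl⟩ := hx
      have h1 : ((m ⬝ᵥ σ.v i : ℤ) : ℝ) = 0 := by rw [h i]; simp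
      simpa [dotProduct, latticeVec] using h1
    | zero => simp
    | add x y _ _ hx hy => rw [dotProduct_add, hx, hy, add_zero]
    | smul a x _ hx => rw [dotProduct_smul, hx, smul_zero]
  have h0 : latticeVec m ⬝ᵥ latticeVec m = 0 :=
    key _ (by rw [σ.span_eq_top]; exact Submodule.mem_top)
  have h1 := dotProduct_self_eq_zero.mp h0
  funext j
  have := congrFun h1 j
  simpa [latticeVec] using this

theorem add_eq_zero_iff (m m' : σ.dualMonoid) : m + m' = 0 ↔ m = 0 ∧ m' = 0 := by
  refine ⟨fun h => ?_, fun h => by rw [h.1, h.2, add_zero]⟩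
  have hc : (m : Fin d → ℤ) + m' = 0 := by
    have := congrArg Subtype.val h
    simpa using this
  have hm : m = 0 := by
    apply Subtype.ext
    apply σ.eq_zero_of_dotProduct_eq_zero
    intro i
    have h1 := m.2 i
    have h2 := m'.2 i
    have h3 : (m : Fin d → ℤ) ⬝ᵥ σ.v i + (m' : Fin d → ℤ) ⬝ᵥ σ.v i = 0 := by
      rw [← add_dotProduct, hc, zero_dotProduct]
    linarith
  exact ⟨hm, by rw [hm, zero_add] at h; exact h⟩

variable (k : Type u) [Field k]

/-- The toric ring `k[σ^∨ ∩ ℤ^d]`. -/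
abbrev Ring : Type u := AddMonoidAlgebra k σ.dualMonoid

/-- The `k`-algebra map `k[σ^∨ ∩ ℤ^d] → k` with `t^m ↦ 0` for all `m ≠ 0`. -/
def constantTerm : σ.Ring k →ₐ[k] k := by
  classical
  exact AddMonoidAlgebra.lift k k σ.dualMonoid
    { toFun := fun m => if m.toAdd = 0 then 1 else 0
      map_one' := by simp
      map_mul' := fun a b => by
        simp only [toAdd_mul, σ.add_eq_zero_iff]
        by_cases ha : a.toAdd = 0 <;> by_cases hb : b.toAdd = 0 <;> simp [ha, hb] }

/-- The irrelevant ideal, which consists of the elements with constant term `0`. -/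
def irrelevantIdeal : Ideal (σ.Ring k) := RingHom.ker (σ.constantTerm k)

instance : (σ.irrelevantIdeal k).IsPrime := RingHom.ker_isPrime _

/-- The irrelevant ideal is the one generated by the monomials `t^m`, `m ≠ 0`. -/
theorem irrelevantIdeal_eq_span : σ.irrelevantIdeal k =
    Ideal.span {f | ∃ m : σ.dualMonoid, m ≠ 0 ∧ f = AddMonoidAlgebra.single m 1} := by
  classical
  have hs : ∀ (m : σ.dualMonoid) (a : k),
      σ.constantTerm k (AddMonoidAlgebra.single m a) = if m = 0 then a else 0 := by
    intro m a
    simp [constantTerm, AddMonoidAlgebra.lift_single]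
  apply le_antisymm
  · intro f hf
    have hall : ∀ f : σ.Ring k, f - algebraMap k _ (σ.constantTerm k f) ∈
        Ideal.span {f : σ.Ring k | ∃ m : σ.dualMonoid, m ≠ 0 ∧
          f = AddMonoidAlgebra.single m 1} := by
      intro f
      induction f using AddMonoidAlgebra.induction_linear with
      | zero => simp
      | add f g hf hg =>
        have := add_mem hf hg
        rw [map_add, map_add]
        convert this using 1
        ring
      | single m a =>
        rw [hs]
        by_cases hm : m = 0
        · subst hm
          simp
        · have h1 : (AddMonoidAlgebra.single m a : σ.Ring k) =
              algebraMap k _ a * AddMonoidAlgebra.single m 1 := by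
            simp [AddMonoidAlgebra.single_mul_single]
          simp only [hm, if_false, map_zero, sub_zero]
          rw [h1]
          exact Ideal.mul_mem_left _ _ (Ideal.subset_span ⟨m, hm, rfl⟩)
    have h0 : σ.constantTerm k f = 0 := hf
    have := hall f
    rwa [h0, map_zero, sub_zero] at this
  · rw [Ideal.span_le]
    rintro _ ⟨m, hm, rfl⟩
    change σ.constantTerm k _ = 0
    rw [hs, if_neg hm]

/-- The localization of the toric ring at its irrelevant ideal. -/
abbrev LocalRing : Type u := Localization.AtPrime (σ.irrelevantIdeal k)

instance (p : ℕ) [ExpChar k p] : ExpChar (σ.LocalRing k) p :=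
  expChar_of_injective_algebraMap (algebraMap k (σ.LocalRing k)).injective p

/-- The height one monomial prime `𝔭_i`, generated by the monomials `t^m` with `⟨m, v_i⟩ ≥ 1`. -/
def facetPrime (i : Fin σ.n) : Ideal (σ.Ring k) :=
  Ideal.span {f | ∃ m : σ.dualMonoid, 1 ≤ (m : Fin d → ℤ) ⬝ᵥ σ.v i ∧
    f = AddMonoidAlgebra.single m 1}

end ToricCone

/-! ### Segre products -/

/-- The coordinate ring `k[x_i y_j | 0 ≤ i ≤ a, 0 ≤ j ≤ b]` of the Segre product `ℙ^a # ℙ^b`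
(the affine cone over `ℙ^a × ℙ^b` in its Segre embedding). -/
def segreRing (k : Type*) [Field k] (a b : ℕ) :
    Subalgebra k (MvPolynomial (Fin (a + 1) ⊕ Fin (b + 1)) k) :=
  Algebra.adjoin k {f | ∃ (i : Fin (a + 1)) (j : Fin (b + 1)),
    f = MvPolynomial.X (Sum.inl i) * MvPolynomial.X (Sum.inr j)}

end

noncomputable section

universe u

/-! The F-signature of a toric ring is the volume of the region `0 ≤ ⟨x, v_i⟩ < 1` (`box`), and the
theorem is a classification of the cones for which this volume exceeds `1 / 2`.

For `q = p ^ e`, the monomials `t^m` with `0 ≤ ⟨m, v_i⟩ < q` span a free summand of `F^e_* R`. Every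
other monomial of the ring is sent into the maximal ideal by every map `F^e_* R → R`. So the free
rank is the number of these lattice points (`isGreatest_frobeniusSplits`), the rank is `q ^ d`
(`finrank_frobeniusPushforward`), and the quotient converges to the volume
(`hasFSignature_boxVolume`).

Let the volume exceed `1 / 2`. Any `d` independent generators put the box inside a parallelepiped of
volume `1 / |det|`, so all maximal minors of the generators are `0` or `±1`
(`abs_det_rowMatrix_le`). Some generators therefore form a lattice basis, and in its coordinates
every other generator is a vector `w` with entries `0, ±1`. The box is the unit cube cut by the
slabs `0 ≤ ⟨y, w⟩ < 1`.

One slab fills a part of the cube equal to the probability that a sum of independent uniform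
variables lies in a unit interval, which is a value of a central B-spline. This exceeds `1 / 2` only
if the entries of `w` sum to `1` and `1`, `3` or `5` of them are nonzero, the values being `1`, `2 /
3`, `11 / 20` (`of_half_lt_spline`). The case of one nonzero entry is a basis vector again.

Two different slabs of this kind never suffice. If the supports are incomparable, or strictly
nested, their intersection has measure at most `1 / 2`. If the supports are equal, then the two
vectors agree at one index and are opposite at another, which produces a minor `±2`
(`eq_of_notMem_range`).

So there is at most one further generator `w`, with `a + 1` entries `1`, `a` entries `-1` and `r`
entries `0`, where `a` is `1` or `2`. A slack variable for `⟨y, w⟩ ≥ 0` identifies the monoid with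
`ℕ^r` times the exponent monoid of the Segre ring (`halfMonoidEquiv`). The value for a ring given
only up to isomorphism comes from an explicit cone, because the box volume is an isomorphism
invariant (`boxVolume_eq_of_ringEquiv`). -/

theorem latticeVec_dotProduct {d : ℕ} (m w : Fin d → ℤ) :
    latticeVec m ⬝ᵥ latticeVec w = ((m ⬝ᵥ w : ℤ) : ℝ) := by
  simp [dotProduct, latticeVec]

/-- A finite family of vectors whose convex hull avoids the line through `z` lies strictly on one
side of a hyperplane through `z`. -/
theorem exists_dotProduct_pos_of_disjoint {d : ℕ} {ι : Type*} [Finite ι] (x : ι → Fin d → ℝ)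
    (z : Fin d → ℝ)
    (h : Disjoint (convexHull ℝ (Set.range x)) (Submodule.span ℝ {z} : Set (Fin d → ℝ))) :
    ∃ y : Fin d → ℝ, y ⬝ᵥ z = 0 ∧ ∀ j, 0 < y ⬝ᵥ x j := by
  obtain ⟨f, u, v, hu, huv, hv⟩ := geometric_hahn_banach_compact_closed (convex_convexHull ℝ _)
    ((Set.finite_range x).isCompact_convexHull (𝕜 := ℝ)) (Submodule.convex (Submodule.span ℝ {z}))
    (Submodule.closed_of_finiteDimensional (Submodule.span ℝ {z})) h
  have hf : ∀ w, f w = (fun j => f (Pi.single j 1)) ⬝ᵥ w := by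
    intro w
    have h1 := LinearMap.pi_apply_eq_sum_univ f.toLinearMap w
    simp only [ContinuousLinearMap.coe_coe, smul_eq_mul] at h1
    rw [h1, dotProduct_comm, dotProduct]
    refine Finset.sum_congr rfl fun i _ => ?_
    congr 2
    funext j
    simp [Pi.single_apply, eq_comm]
  have hv0 : v < 0 := by simpa using hv 0 (Submodule.zero_mem _)
  -- A functional that is bounded below on a line through the origin vanishes on it; the multiple of
  -- `z` used here would have value `v - 1 < v`.
  have hz : f z = 0 := by
    by_contra hne
    have h1 := hv (((v - 1) / f z) • z) (Submodule.smul_mem (Submodule.span ℝ {z}) _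
      (Submodule.mem_span_singleton_self z))
    rw [map_smul, smul_eq_mul, div_mul_cancel₀ _ hne] at h1
    linarith
  refine ⟨-fun j => f (Pi.single j 1), ?_, fun j => ?_⟩
  · rw [neg_dotProduct, ← hf, hz, neg_zero]
  · rw [neg_dotProduct, ← hf]
    have := hu (x j) (subset_convexHull ℝ _ ⟨j, rfl⟩)
    linarith

/-! ### Convex geometry of the cone: supporting vectors and prescribed pairings. -/

namespace ToricCone

variable {d : ℕ} (σ : ToricCone d)

theorem v_ne_zero (i : Fin σ.n) : σ.v i ≠ 0 := by
  intro h
  have := σ.primitive i 0 (1 / 2) (by norm_num) (by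
    rw [h]; funext j; simp [latticeVec])
  norm_num at this

theorem latticeVec_v_ne_zero (i : Fin σ.n) : latticeVec (σ.v i) ≠ 0 := by
  intro h
  apply σ.v_ne_zero i
  funext j
  simpa [latticeVec] using congrFun h j

theorem sum_smul_mem_hull {S : Set (Fin σ.n)} (c : Fin σ.n → ℝ) (hc : ∀ j, 0 ≤ c j)
    (hS : ∀ j, j ∉ S → c j = 0) :
    ∑ j, c j • latticeVec (σ.v j) ∈
      PointedCone.hull ℝ ((fun i => latticeVec (σ.v i)) '' S) := by
  refine Submodule.sum_mem _ fun j _ => ?_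
  by_cases hj : j ∈ S
  · exact PointedCone.smul_mem _ (hc j) (PointedCone.subset_hull ⟨j, hj, rfl⟩)
  · rw [hS j hj, zero_smul]
    exact Submodule.zero_mem _

theorem notMem_hull (i : Fin σ.n) :
    latticeVec (σ.v i) ∉ PointedCone.hull ℝ ((fun i => latticeVec (σ.v i)) '' {i}ᶜ) := by
  intro h
  apply σ.minimal {i}ᶜ
  · intro h
    have : i ∈ ({i}ᶜ : Set (Fin σ.n)) := by rw [h]; trivial
    exact this rfl
  · apply le_antisymm
    · exact Submodule.span_mono (Set.image_subset_range _ _)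
    · refine Submodule.span_le.2 ?_
      rintro _ ⟨j, rfl⟩
      by_cases hj : j = i
      · subst hj; exact h
      · exact PointedCone.subset_hull ⟨j, hj, rfl⟩

theorem eq_zero_of_sum_smul_eq_zero (c : Fin σ.n → ℝ) (hc : ∀ j, 0 ≤ c j)
    (h : ∑ j, c j • latticeVec (σ.v j) = 0) : c = 0 := by
  funext i
  have hi : ∀ a : Fin σ.n → ℝ, (∀ j, 0 ≤ a j) → ∑ j, a j • latticeVec (σ.v j) ∈
      PointedCone.hull ℝ (Set.range fun i => latticeVec (σ.v i)) := by
    intro a ha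
    have := σ.sum_smul_mem_hull (S := Set.univ) a ha (by simp)
    rwa [Set.image_univ] at this
  have h1 := σ.stronglyConvex (c i • latticeVec (σ.v i))
    (PointedCone.smul_mem _ (hc i) (PointedCone.subset_hull ⟨i, rfl⟩)) (by
      have h2 := hi (Function.update c i 0) (fun j => by
        by_cases hj : j = i
        · subst hj; simp
        · simpa [hj] using hc j)
      convert h2 using 1
      rw [← Finset.add_sum_erase _ _ (Finset.mem_univ i)] at h ⊢
      rw [Function.update_self, zero_smul, zero_add, neg_eq_of_add_eq_zero_right h]
      refine Finset.sum_congr rfl fun j hj => ?_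
      rw [Function.update_of_ne (Finset.ne_of_mem_erase hj)])
  exact (smul_eq_zero.1 h1).resolve_right (σ.latticeVec_v_ne_zero i)

/-- Each generator spans an extreme ray, so some hyperplane meets the cone in that ray only. The
convex hull of the other generators misses the line through `v i`: a point `c • v i` with `c > 0`
would contradict minimality, and one with `c ≤ 0` would be a nontrivial nonnegative relation,
against strong convexity. -/
theorem exists_real_facet (i : Fin σ.n) : ∃ y : Fin d → ℝ, y ⬝ᵥ latticeVec (σ.v i) = 0 ∧
    ∀ j, j ≠ i → 0 < y ⬝ᵥ latticeVec (σ.v j) := by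
  obtain ⟨y, hy, hy'⟩ := exists_dotProduct_pos_of_disjoint
    (fun j : {j // j ≠ i} => latticeVec (σ.v j)) (latticeVec (σ.v i)) (by
    rw [Set.disjoint_left]
    intro x hx hx'
    obtain ⟨c, rfl⟩ := Submodule.mem_span_singleton.1 hx'
    have hsub : convexHull ℝ (Set.range fun j : {j // j ≠ i} => latticeVec (σ.v j)) ⊆
        {x | ∃ a : Fin σ.n → ℝ, (∀ j, 0 ≤ a j) ∧ a i = 0 ∧ ∑ j, a j = 1 ∧
          x = ∑ j, a j • latticeVec (σ.v j)} := by
      refine convexHull_min ?_ ?_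
      · rintro _ ⟨j, rfl⟩
        refine ⟨Pi.single j 1, fun l => ?_, ?_, by simp, by simp [Pi.single_apply]⟩
        · by_cases h : l = (j : Fin σ.n)
          · subst h; simp
          · simp [h]
        · exact Pi.single_eq_of_ne (fun h => j.2 h.symm) _
      · rintro _ ⟨a, ha, hai, ha1, rfl⟩ _ ⟨b, hb, hbi, hb1, rfl⟩ s t hs ht hst
        refine ⟨s • a + t • b, fun j => ?_, by simp [hai, hbi], ?_, ?_⟩
        · have := mul_nonneg hs (ha j)
          have := mul_nonneg ht (hb j)
          simp only [Pi.add_apply, Pi.smul_apply, smul_eq_mul]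
          positivity
        · simp [Finset.sum_add_distrib, ← Finset.mul_sum, ha1, hb1, hst]
        · simp [Finset.smul_sum, add_smul, mul_smul, Finset.sum_add_distrib]
    obtain ⟨a, ha, hai, ha1, hax⟩ := hsub hx
    have hne : a ≠ 0 := by
      rintro rfl
      simp at ha1
    rcases lt_or_ge 0 c with hc | hc
    · apply σ.notMem_hull i
      have h1 := σ.sum_smul_mem_hull (S := {i}ᶜ) a ha (by simpa using hai)
      rw [← hax] at h1
      have h2 := PointedCone.smul_mem _ (inv_nonneg.2 hc.le) h1
      rwa [inv_smul_smul₀ hc.ne'] at h2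
    · apply hne
      have h1 := σ.eq_zero_of_sum_smul_eq_zero (a + Pi.single i (-c)) (fun j => by
        by_cases h : j = i
        · subst h; simp [hai, hc]
        · simp [h, ha j]) (by
        simp only [Pi.add_apply, add_smul, Finset.sum_add_distrib, ← hax]
        simp [Pi.single_apply])
      funext j
      by_cases h : j = i
      · subst h; simpa using hai
      · simpa [h] using congrFun h1 j)
  exact ⟨y, hy, fun j hj => hy' ⟨j, hj⟩⟩

/-- The values of `u ↦ u ⬝ᵥ v i` form an ideal generated by some `g` dividing all entries of `v i`.
Then `v i / |g|` is a lattice vector on the same ray, and primitivity forces `|g| = 1`. -/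
theorem exists_dotProduct_eq_one (i : Fin σ.n) : ∃ u : Fin d → ℤ, u ⬝ᵥ σ.v i = 1 := by
  set f : (Fin d → ℤ) →ₗ[ℤ] ℤ := (LinearMap.mk₂ ℤ (fun u w : Fin d → ℤ => u ⬝ᵥ w)
    (by intros; exact add_dotProduct _ _ _) (by intros; exact smul_dotProduct _ _ _)
    (by intros; exact dotProduct_add _ _ _) (by intros; exact dotProduct_smul _ _ _)).flip (σ.v i)
    with hf
  have hfa : ∀ u, f u = u ⬝ᵥ σ.v i := fun u => rfl
  obtain ⟨g, hg⟩ := (IsPrincipalIdealRing.principal (LinearMap.range f)).principal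
  have hdvd : ∀ j, g ∣ σ.v i j := by
    intro j
    have : f (Pi.single j 1) ∈ LinearMap.range f := ⟨_, rfl⟩
    rw [hg, Submodule.mem_span_singleton] at this
    obtain ⟨a, ha⟩ := this
    rw [hfa, single_one_dotProduct] at ha
    exact ⟨a, by rw [← ha, smul_eq_mul, mul_comm]⟩
  obtain ⟨u, hu⟩ : g ∈ LinearMap.range f := by rw [hg]; exact Submodule.mem_span_singleton_self g
  choose w hw using hdvd
  have hg0 : g ≠ 0 := by
    rintro rfl
    exact σ.v_ne_zero i (by funext j; rw [hw j]; simp)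
  have h1 := σ.primitive i (fun j => if 0 < g then w j else -w j) (1 / |(g : ℝ)|)
    (by positivity) (by
    funext j
    have hg1 : (g : ℝ) ≠ 0 := by exact_mod_cast hg0
    simp only [latticeVec, Pi.smul_apply, smul_eq_mul, hw j]
    rcases lt_or_gt_of_ne hg0 with h | h
    · have h' : (g : ℝ) < 0 := by exact_mod_cast h
      rw [if_neg h.le.not_gt, abs_of_neg h']
      push_cast
      field_simp
    · have h' : (0 : ℝ) < g := by exact_mod_cast h
      rw [if_pos h, abs_of_pos h']
      push_cast
      field_simp)
  have h2 : |(g : ℝ)| ≤ 1 := by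
    rw [le_div_iff₀ (by positivity)] at h1
    linarith
  have h3 : |g| ≤ 1 := by exact_mod_cast h2
  have h4 : |g| = 1 := le_antisymm h3 (Int.one_le_abs hg0)
  rcases abs_eq (by norm_num : (0 : ℤ) ≤ 1) |>.1 h4 with h | h
  · exact ⟨u, by rw [← hfa, hu, h]⟩
  · exact ⟨-u, by rw [neg_dotProduct, ← hfa, hu, h]; rfl⟩

/-- A supporting lattice vector of the ray of `v i`. -/
theorem exists_facet (i : Fin σ.n) : ∃ m : Fin d → ℤ, m ⬝ᵥ σ.v i = 0 ∧
    ∀ j, j ≠ i → 0 < m ⬝ᵥ σ.v j := by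
  obtain ⟨y, hy, hy'⟩ := σ.exists_real_facet i
  obtain ⟨u, hu⟩ := σ.exists_dotProduct_eq_one i
  have hu' : latticeVec u ⬝ᵥ latticeVec (σ.v i) = 1 := by
    rw [latticeVec_dotProduct, hu]; simp
  -- `F` projects onto the hyperplane orthogonal to `v i` along `u`, and maps lattice vectors to
  -- lattice vectors since `⟨u, v i⟩ = 1`. So `y` can be moved to a rational point without losing
  -- orthogonality, the remaining conditions being open.
  set F : (Fin d → ℝ) → (Fin d → ℝ) :=
    fun z => z - (z ⬝ᵥ latticeVec (σ.v i)) • latticeVec u with hF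
  have hFc : Continuous F := by
    unfold F dotProduct
    fun_prop
  have hopen : IsOpen {z | ∀ j, j ≠ i → 0 < F z ⬝ᵥ latticeVec (σ.v j)} := by
    simp only [Set.ofPred_forall]
    refine isOpen_iInter_of_finite fun j => isOpen_iInter_of_finite fun _ => ?_
    refine isOpen_lt continuous_const ?_
    unfold dotProduct
    fun_prop
  have hdense : DenseRange (fun r : Fin d → ℚ => fun j => (r j : ℝ)) :=
    DenseRange.piMap fun _ => Rat.denseRange_cast
  obtain ⟨r, hr⟩ := hdense.exists_mem_open hopen ⟨y, fun j hj => by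
    simpa [F, hy] using hy' j hj⟩
  obtain ⟨b, hb⟩ := IsLocalization.exist_integer_multiples_of_finite (nonZeroDivisors ℤ) r
  choose z hz using hb
  set N : ℤ := |(b : ℤ)| with hN
  have hb0 : (b : ℤ) ≠ 0 := nonZeroDivisors.coe_ne_zero b
  have hNpos : 0 < N := abs_pos.2 hb0
  -- The common denominator `b` may be negative; the sign makes the scaling factor `N` positive, so
  -- that strict inequalities survive.
  set s : ℤ := if 0 < (b : ℤ) then 1 else -1 with hs
  have hsb : s * b = N := by
    rw [hs, hN]
    split_ifs with h
    · rw [abs_of_pos h, one_mul]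
    · rw [abs_of_neg (lt_of_le_of_ne (not_lt.1 h) hb0), neg_one_mul]
  have hzr : latticeVec (s • z) = (N : ℝ) • (fun j => (r j : ℝ)) := by
    funext j
    have h1 : (z j : ℚ) = (b : ℤ) * r j := by
      have := hz j
      simpa [Algebra.smul_def] using this
    have h2 : ((s * z j : ℤ) : ℚ) = (N : ℤ) * r j := by
      rw [← hsb]
      push_cast
      rw [h1, mul_assoc]
    have h3 : (((s * z j : ℤ) : ℚ) : ℝ) = (((N : ℤ) * r j : ℚ) : ℝ) := by rw [h2]
    simp only [latticeVec, Pi.smul_apply, smul_eq_mul]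
    push_cast at h3 ⊢
    exact h3
  have hm : latticeVec (s • z - ((s • z) ⬝ᵥ σ.v i) • u) = (N : ℝ) • F (fun j => (r j : ℝ)) := by
    have h1 : latticeVec (s • z - ((s • z) ⬝ᵥ σ.v i) • u) = latticeVec (s • z) -
        (latticeVec (s • z) ⬝ᵥ latticeVec (σ.v i)) • latticeVec u := by
      rw [latticeVec_dotProduct]
      funext j
      simp [latticeVec]
    rw [h1, hzr]
    simp only [F, smul_dotProduct, smul_sub, smul_smul, smul_eq_mul]
  refine ⟨s • z - ((s • z) ⬝ᵥ σ.v i) • u, ?_, fun j hj => ?_⟩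
  · rw [sub_dotProduct, smul_dotProduct _ u, hu]
    simp
  · have h1 : (0 : ℝ) < ((s • z - ((s • z) ⬝ᵥ σ.v i) • u) ⬝ᵥ σ.v j : ℤ) := by
      rw [← latticeVec_dotProduct, hm, smul_dotProduct, smul_eq_mul]
      exact mul_pos (by exact_mod_cast hNpos) (hr j hj)
    exact_mod_cast h1

/-- Every integer is the value at `v i` of a lattice vector that is as positive as desired on the
other generators. -/
theorem exists_dotProduct_eq_of_ne (i : Fin σ.n) (a b : ℤ) : ∃ w : Fin d → ℤ, w ⬝ᵥ σ.v i = a ∧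
    ∀ j, j ≠ i → b ≤ w ⬝ᵥ σ.v j := by
  obtain ⟨m, hm, hm'⟩ := σ.exists_facet i
  obtain ⟨u, hu⟩ := σ.exists_dotProduct_eq_one i
  set K : ℤ := ∑ j, |b - a * (u ⬝ᵥ σ.v j)| with hK
  refine ⟨a • u + K • m, by
    rw [add_dotProduct, smul_dotProduct, smul_dotProduct, hu, hm]; simp, fun j hj => ?_⟩
  have h1 : |b - a * (u ⬝ᵥ σ.v j)| ≤ K :=
    Finset.single_le_sum (f := fun j => |b - a * (u ⬝ᵥ σ.v j)|) (fun _ _ => abs_nonneg _)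
      (Finset.mem_univ j)
  have h2 := le_abs_self (b - a * (u ⬝ᵥ σ.v j))
  have h3 : 0 ≤ K := Finset.sum_nonneg fun _ _ => abs_nonneg _
  have h4 := hm' j hj
  simp only [add_dotProduct, smul_dotProduct, smul_eq_mul]
  nlinarith

theorem exists_interior (b : ℤ) : ∃ u : Fin d → ℤ, ∀ i, b ≤ u ⬝ᵥ σ.v i := by
  choose w hw hw' using fun i => σ.exists_dotProduct_eq_of_ne i |b| 0
  refine ⟨∑ i, w i, fun i => ?_⟩
  rw [sum_dotProduct, ← Finset.add_sum_erase _ _ (Finset.mem_univ i), hw]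
  have : 0 ≤ ∑ j ∈ Finset.univ.erase i, w j ⬝ᵥ σ.v i :=
    Finset.sum_nonneg fun j hj => hw' j i (Finset.ne_of_mem_erase hj).symm
  linarith [le_abs_self b]

end ToricCone

/-! ### Free summands of the Frobenius pushforward as dual systems in the ring. -/

/-- An additive map `φ : R → R` with `φ (a ^ q * y) = a * φ y`; for `q = p ^ e` this is the same as
an `R`-linear map `F^e_* R → R`. -/
def IsRootLinear (q : ℕ) {R : Type*} [CommRing R] (φ : R →+ R) : Prop :=
  ∀ a y, φ (a ^ q * y) = a * φ y

/-- For `q = p ^ e` this says that `F^e_* R` has a free summand of rank `n`. -/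
def FrobeniusSplits (q n : ℕ) (R : Type*) [CommRing R] : Prop :=
  ∃ (φ : Fin n → R →+ R) (x : Fin n → R), (∀ j, IsRootLinear q (φ j)) ∧
    ∀ i j, φ j (x i) = if i = j then 1 else 0

theorem FrobeniusSplits.of_ringEquiv {q n : ℕ} {R S : Type*} [CommRing R] [CommRing S]
    (f : R ≃+* S) (h : FrobeniusSplits q n R) : FrobeniusSplits q n S := by
  obtain ⟨φ, x, hφ, hx⟩ := h
  refine ⟨fun j => (f : R →+ S).comp ((φ j).comp (f.symm : S →+ R)), fun i => f (x i),
    fun j a y => ?_, fun i j => ?_⟩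
  · simp [map_mul, map_pow, hφ j (f.symm a) (f.symm y)]
  · simp only [AddMonoidHom.coe_comp, Function.comp_apply, AddMonoidHom.coe_coe,
      RingEquiv.symm_apply_apply, hx]
    split_ifs <;> simp

/-- The `φ j` form a map onto `R^n` with section `e_i ↦ F^e_* (x i)`, so its kernel is a complement.
This trades modules for data inside the ring that pass easily to localizations and isomorphic rings.
-/
theorem exists_equiv_prod_iff_frobeniusSplits (p e n : ℕ) (R : Type u) [CommRing R] [ExpChar R p] :
    (∃ (M : Type u) (_ : AddCommGroup M) (_ : Module R M),
      Nonempty (FrobeniusPushforward p e R ≃ₗ[R] (Fin n → R) × M)) ↔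
      FrobeniusSplits (p ^ e) n R := by
  have hof : ∀ a y : R, (FrobeniusPushforward.of p e R (a ^ p ^ e * y)) =
      a • FrobeniusPushforward.of p e R y := fun a y => (FrobeniusPushforward.smul_of p e R a y).symm
  constructor
  · rintro ⟨M, _, _, ⟨E⟩⟩
    refine ⟨fun j => ⟨⟨fun y => (E (FrobeniusPushforward.of p e R y)).1 j, ?_⟩, ?_⟩,
      fun i => E.symm (Pi.single i 1, 0), fun j a y => ?_, fun i j => ?_⟩
    · change (E 0).1 j = 0
      rw [map_zero]; rfl
    · intro x y
      change (E (FrobeniusPushforward.of p e R x + FrobeniusPushforward.of p e R y)).1 j = _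
      rw [map_add]; rfl
    · change (E (FrobeniusPushforward.of p e R (a ^ p ^ e * y))).1 j =
        a * (E (FrobeniusPushforward.of p e R y)).1 j
      rw [hof, map_smul]; rfl
    · change (E (E.symm (Pi.single i 1, 0))).1 j = _
      rw [E.apply_symm_apply]
      simp [Pi.single_apply, eq_comm]
  · rintro ⟨φ, x, hφ, hx⟩
    let Φ : FrobeniusPushforward p e R →ₗ[R] (Fin n → R) :=
      { toFun := fun y j => φ j y
        map_add' := fun y z => by funext j; exact map_add (φ j) _ _
        map_smul' := fun a y => by
          funext j
          exact (congrArg (φ j) (hof a y).symm).trans (hφ j a y) }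
    let g : (Fin n → R) →ₗ[R] FrobeniusPushforward p e R :=
      Fintype.linearCombination R fun i => FrobeniusPushforward.of p e R (x i)
    have hg : ∀ r, Φ (g r) = r := by
      intro r
      have hΦ : ∀ i, Φ (FrobeniusPushforward.of p e R (x i)) = Pi.single i 1 := by
        intro i
        funext j
        change φ j (x i) = _
        rw [hx, Pi.single_apply]
        simp [eq_comm]
      simp only [g, Fintype.linearCombination_apply, map_sum, map_smul, hΦ]
      funext j
      simp [Pi.single_apply]
    refine ⟨LinearMap.ker Φ, inferInstance, inferInstance, ⟨?_⟩⟩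
    exact
      { toFun := fun y => (Φ y, ⟨y - g (Φ y), by
          rw [LinearMap.mem_ker, map_sub, hg, sub_self]⟩)
        map_add' := fun y z => by
          ext
          · simp
          · simp only [map_add, Prod.snd_add, Submodule.coe_add]
            abel
        map_smul' := fun a y => by
          ext
          · simp
          · simp [smul_sub]
        invFun := fun z => g z.1 + z.2
        left_inv := fun y => by simp
        right_inv := fun z => by
          have h0 : Φ z.2 = 0 := z.2.2
          ext
          · simp [hg, h0]
          · simp [hg, h0] }

theorem frobeniusFreeRank_eq_of_isGreatest {p e N : ℕ} {R : Type u} [CommRing R] [ExpChar R p]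
    (h : IsGreatest {n | FrobeniusSplits (p ^ e) n R} N) : frobeniusFreeRank p e R = N := by
  unfold frobeniusFreeRank
  simp_rw [exists_equiv_prod_iff_frobeniusSplits]
  exact h.csSup_eq

/-- Root-linear maps extend to localizations. -/
theorem IsRootLinear.exists_extension {q : ℕ} (hq : 0 < q) {A R : Type*} [CommRing A] [CommRing R]
    [Algebra A R] (S : Submonoid A) [IsLocalization S R]
    (hinj : Function.Injective (algebraMap A R)) {φ : A →+ A} (hφ : IsRootLinear q φ) :
    ∃ ψ : R →+ R, IsRootLinear q ψ ∧ ∀ y, ψ (algebraMap A R y) = algebraMap A R (φ y) := by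
  -- Since `y / s = y s^{q-1} / s^q`, the only possible value at `y / s` is `φ (y s^{q-1}) / s`. The
  -- statement `key` shows that it does not depend on the fraction chosen.
  set ψ : R → R := fun x => IsLocalization.mk' R
    (φ ((IsLocalization.sec S x).1 * ((IsLocalization.sec S x).2 : A) ^ (q - 1)))
    (IsLocalization.sec S x).2 with hψ
  obtain ⟨t, rfl⟩ : ∃ t, q = t + 1 := ⟨q - 1, by omega⟩
  have key : ∀ (x : R) (y : A) (s : S), x * algebraMap A R s = algebraMap A R y →
      ψ x * algebraMap A R s = algebraMap A R (φ (y * (s : A) ^ t)) := by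
    intro x y s hx
    have h1 := IsLocalization.sec_spec S x
    set y' := (IsLocalization.sec S x).1 with hy'
    set s' := (IsLocalization.sec S x).2 with hs'
    have h2 : y * (s' : A) = y' * s := by
      apply hinj
      rw [map_mul, map_mul, ← hx, ← h1]
      ring
    have hu : IsUnit (algebraMap A R s') := IsLocalization.map_units R s'
    apply hu.mul_right_cancel
    have h3 : ψ x * algebraMap A R s' = algebraMap A R (φ (y' * (s' : A) ^ t)) :=
      IsLocalization.mk'_spec _ _ _
    calc ψ x * algebraMap A R s * algebraMap A R s' =
        algebraMap A R (s * φ (y' * (s' : A) ^ t)) := by rw [map_mul, ← h3]; ring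
      _ = algebraMap A R (s' * φ (y * (s : A) ^ t)) := by
        rw [← hφ, ← hφ]
        congr 2
        calc (s : A) ^ (t + 1) * (y' * (s' : A) ^ t) = (y' * s) * s ^ t * s' ^ t := by ring
          _ = (s' : A) ^ (t + 1) * (y * (s : A) ^ t) := by rw [← h2]; ring
      _ = _ := by rw [map_mul]; ring
  refine ⟨⟨⟨ψ, ?_⟩, ?_⟩, ?_, ?_⟩
  · have := key 0 0 1 (by simp)
    simpa using this
  · intro x x'
    obtain ⟨y, s, rfl⟩ := IsLocalization.exists_mk'_eq S x
    obtain ⟨y', s', rfl⟩ := IsLocalization.exists_mk'_eq S x'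
    have hu : IsUnit (algebraMap A R ((s * s' : S) : A)) := IsLocalization.map_units R (s * s')
    apply hu.mul_right_cancel
    have h1 := IsLocalization.mk'_spec R y s
    have h2 := IsLocalization.mk'_spec R y' s'
    have e1 : IsLocalization.mk' R y s * algebraMap A R ((s * s' : S) : A) =
        algebraMap A R (y * s') := by
      rw [Submonoid.coe_mul, map_mul, map_mul, ← h1]; ring
    have e2 : IsLocalization.mk' R y' s' * algebraMap A R ((s * s' : S) : A) =
        algebraMap A R (y' * s) := by
      rw [Submonoid.coe_mul, map_mul, map_mul, ← h2]; ring
    simp only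
    rw [add_mul, key _ _ _ e1, key _ _ _ e2, key _ (y * s' + y' * s) (s * s') (by
      rw [add_mul, e1, e2, map_add]), ← map_add, ← map_add, add_mul]
  · intro a x
    obtain ⟨y, s, rfl⟩ := IsLocalization.exists_mk'_eq S x
    obtain ⟨b, r, rfl⟩ := IsLocalization.exists_mk'_eq S a
    have h1 := IsLocalization.mk'_spec R y s
    have h2 := IsLocalization.mk'_spec R b r
    have hu : IsUnit (algebraMap A R ((r ^ (t + 1) * s : S) : A)) := IsLocalization.map_units R _
    apply hu.mul_right_cancel
    have e1 := key (IsLocalization.mk' R b r ^ (t + 1) * IsLocalization.mk' R y s)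
      (b ^ (t + 1) * y) (r ^ (t + 1) * s) (by
        rw [Submonoid.coe_mul, SubmonoidClass.coe_pow, map_mul, map_mul, map_pow, map_pow, ← h1, ← h2]
        ring)
    change ψ _ * _ = _ * ψ _ * _
    rw [e1]
    have e2 := key _ _ _ h1
    calc algebraMap A R (φ (b ^ (t + 1) * y * ((r ^ (t + 1) * s : S) : A) ^ t))
        = algebraMap A R (φ ((b * r ^ t) ^ (t + 1) * (y * (s : A) ^ t))) := by
          rw [Submonoid.coe_mul, SubmonoidClass.coe_pow]; congr 2; ring
      _ = algebraMap A R b * algebraMap A R (r ^ t) * algebraMap A R (φ (y * (s : A) ^ t)) := by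
          rw [hφ, map_mul, map_mul]
      _ = _ := by
          rw [← e2, ← h2]
          rw [Submonoid.coe_mul, SubmonoidClass.coe_pow, map_mul, map_pow, map_pow]
          ring
  · intro y
    have := key (algebraMap A R y) y 1 (by simp)
    simpa using this

/-! ### Root-linear maps of the monomial algebra. -/

namespace ToricCone

variable {d : ℕ} (σ : ToricCone d)

/-- Inherited from `ℤ^d`; this is what makes the toric ring a domain. -/
instance : TwoUniqueSums σ.dualMonoid :=
  TwoUniqueSums.of_injective_addHom (σ.dualMonoid.subtype : σ.dualMonoid →ₙ+ (Fin d → ℤ))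
    Subtype.val_injective inferInstance

/-- The lattice points `m` with `0 ≤ ⟨m, v_i⟩ < q` for all `i`. -/
def latticePoints (q : ℕ) : Set (Fin d → ℤ) := {m | ∀ i, 0 ≤ m ⬝ᵥ σ.v i ∧ m ⬝ᵥ σ.v i < q}

theorem finite_latticePoints (q : ℕ) : (σ.latticePoints q).Finite := by
  have h1 : (Set.pi Set.univ fun _ : Fin σ.n => Set.Ico (0 : ℤ) q).Finite :=
    Set.Finite.pi fun _ => Set.finite_Ico _ _
  refine Set.Finite.subset (h1.preimage (f := fun m i => m ⬝ᵥ σ.v i) ?_) ?_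
  · intro m _ m' _ h
    refine sub_eq_zero.1 (σ.eq_zero_of_dotProduct_eq_zero fun i => ?_)
    have := congrFun h i
    rw [sub_dotProduct, sub_eq_zero]
    exact this
  · intro m hm i _
    exact hm i

instance (q : ℕ) : Finite (σ.latticePoints q) := σ.finite_latticePoints q

theorem exists_sub_eq (z : Fin d → ℤ) : ∃ w w' : σ.dualMonoid, (w : Fin d → ℤ) - w' = z := by
  obtain ⟨u, hu⟩ := σ.exists_interior (∑ i, |z ⬝ᵥ σ.v i|)
  have h : ∀ i, |z ⬝ᵥ σ.v i| ≤ u ⬝ᵥ σ.v i := fun i =>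
    (Finset.single_le_sum (f := fun i => |z ⬝ᵥ σ.v i|) (fun _ _ => abs_nonneg _)
      (Finset.mem_univ i)).trans (hu i)
  refine ⟨⟨z + u, fun i => ?_⟩, ⟨u, fun i => (abs_nonneg _).trans (h i)⟩, by simp⟩
  rw [add_dotProduct]
  linarith [h i, neg_abs_le (z ⬝ᵥ σ.v i)]

section rings

variable (k : Type u) [Field k]

theorem constantTerm_apply (f : σ.Ring k) : σ.constantTerm k f = f.coeff 0 := by
  classical
  induction f using AddMonoidAlgebra.induction_linear with
  | zero => simp
  | add f g hf hg => simp [hf, hg]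
  | single m a => simp [constantTerm, AddMonoidAlgebra.lift_single, Finsupp.single_apply]

variable (p e : ℕ) [ExpChar k p] [PerfectRing k p]

instance : ExpChar (σ.Ring k) p :=
  expChar_of_injective_algebraMap (algebraMap k (σ.Ring k)).injective p

open Classical in
/-- The additive map `k[σ^∨ ∩ ℤ^d] → k[σ^∨ ∩ ℤ^d]` that extracts the monomials with exponent in
`m + p ^ e ℤ^d`: it maps `c t^{m + p ^ e u}` to `c^{1/p^e} t^u` and the other monomials to `0`. -/
def rootMap (m : Fin d → ℤ) : σ.Ring k →+ σ.Ring k :=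
  (Finsupp.liftAddHom fun x : σ.dualMonoid =>
    if h : ∃ u : σ.dualMonoid, (x : Fin d → ℤ) = m + p ^ e • (u : Fin d → ℤ) then
      (AddMonoidAlgebra.singleAddHom h.choose).comp
        ((iterateFrobeniusEquiv k p e).symm : k →+ k)
    else 0).comp (AddMonoidAlgebra.coeffAddEquiv : σ.Ring k ≃+ _).toAddMonoidHom

variable {m : Fin d → ℤ}

theorem rootMap_single_of_ne {x : σ.dualMonoid} (c : k)
    (h : ∀ u : σ.dualMonoid, (x : Fin d → ℤ) ≠ m + p ^ e • (u : Fin d → ℤ)) :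
    σ.rootMap k p e m (AddMonoidAlgebra.single x c) = 0 := by
  have h' : ¬ ∃ u : σ.dualMonoid, (x : Fin d → ℤ) = m + p ^ e • (u : Fin d → ℤ) := by
    push Not; exact h
  simp only [rootMap, AddMonoidHom.comp_apply]
  simp [-not_exists, dif_neg h']

theorem rootMap_single_of_eq {x u : σ.dualMonoid} (c : k)
    (h : (x : Fin d → ℤ) = m + p ^ e • (u : Fin d → ℤ)) :
    σ.rootMap k p e m (AddMonoidAlgebra.single x c) =
      AddMonoidAlgebra.single u ((iterateFrobeniusEquiv k p e).symm c) := by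
  have h' : ∃ u : σ.dualMonoid, (x : Fin d → ℤ) = m + p ^ e • (u : Fin d → ℤ) := ⟨u, h⟩
  have hu : h'.choose = u := by
    have h1 := h'.choose_spec.symm.trans h
    have h2 := nsmul_right_injective (M := Fin d → ℤ) (expChar_pow_pos k p e).ne'
      (add_left_cancel h1)
    exact Subtype.ext h2
  simp only [rootMap, AddMonoidHom.comp_apply]
  simp [dif_pos h', hu]

/-- If `x` lies in the monoid and `x = m + q z`, then `q ⟨z, v_i⟩ ≥ -⟨m, v_i⟩ > -q`, so `z` lies in
the monoid as well: multiplying by a `q`-th power brings no new monomial into play. The vector `m`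
itself need not lie in the monoid, and the computation of the rank uses this freedom. -/
theorem isRootLinear_rootMap (hm : ∀ i, m ⬝ᵥ σ.v i < p ^ e) :
    IsRootLinear (p ^ e) (σ.rootMap k p e m) := by
  have hq := expChar_pow_pos k p e
  intro a y
  induction a using AddMonoidAlgebra.induction_linear with
  | zero => rw [zero_pow hq.ne', zero_mul, zero_mul, map_zero]
  | add f g hf hg => rw [add_pow_expChar_pow, add_mul, map_add, hf, hg, add_mul]
  | single u c =>
    induction y using AddMonoidAlgebra.induction_linear with
    | zero => simp
    | add f g hf hg => rw [mul_add, map_add, hf, hg, map_add, mul_add]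
    | single x b =>
      rw [AddMonoidAlgebra.single_pow, AddMonoidAlgebra.single_mul_single]
      by_cases h : ∃ w : σ.dualMonoid, (x : Fin d → ℤ) = m + p ^ e • (w : Fin d → ℤ)
      · obtain ⟨w, hw⟩ := h
        rw [σ.rootMap_single_of_eq k p e b hw,
          σ.rootMap_single_of_eq k p e (u := u + w) (c ^ p ^ e * b) (by
            push_cast
            rw [hw]
            module), AddMonoidAlgebra.single_mul_single, map_mul,
          ← iterateFrobeniusEquiv_def, RingEquiv.symm_apply_apply]
      · rw [σ.rootMap_single_of_ne k p e b (by push Not at h; exact h), mul_zero]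
        apply σ.rootMap_single_of_ne
        rintro ⟨w, hw⟩ h'
        apply h
        refine ⟨⟨w - u, fun i => ?_⟩, ?_⟩
        · have h1 : (x : Fin d → ℤ) ⬝ᵥ σ.v i =
              m ⬝ᵥ σ.v i + p ^ e * ((w - u : Fin d → ℤ) ⬝ᵥ σ.v i) := by
            have : (x : Fin d → ℤ) = m + p ^ e • (w - (u : Fin d → ℤ)) := by
              rw [smul_sub, ← add_sub_assoc, ← h']
              push_cast
              abel
            rw [this, add_dotProduct, smul_dotProduct]
            simp
          have h2 := x.2 i
          have h3 := hm i
          have h4 : (0 : ℤ) < p ^ e := by exact_mod_cast hq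
          by_contra hneg
          push Not at hneg
          nlinarith
        · simp only
          rw [smul_sub, ← add_sub_assoc, ← h']
          push_cast
          abel

/-- The monomials `t^m` at the lattice points and the maps `rootMap m` are dual to each other. If `m
= m' + q u` with `u` in the monoid and both sides pair with every `v_i` into `[0, q)`, then `u`
pairs to zero with every `v_i`, hence `u = 0`. -/
theorem frobeniusSplits_ring : FrobeniusSplits (p ^ e) (Nat.card (σ.latticePoints (p ^ e)))
    (σ.Ring k) := by
  classical
  set E := (Finite.equivFin (σ.latticePoints (p ^ e))).symm
  refine ⟨fun j => σ.rootMap k p e (E j), fun i => AddMonoidAlgebra.single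
    ⟨E i, fun l => ((E i).2 l).1⟩ 1, fun j => σ.isRootLinear_rootMap k p e fun i => ?_,
    fun i j => ?_⟩
  · exact_mod_cast ((E j).2 i).2
  · split_ifs with h
    · subst h
      rw [σ.rootMap_single_of_eq k p e (u := 0) 1 (by simp), map_one]
      rfl
    · apply σ.rootMap_single_of_ne
      intro u hu
      apply h
      apply E.injective
      apply Subtype.ext
      have hu0 : (u : Fin d → ℤ) = 0 := by
        apply σ.eq_zero_of_dotProduct_eq_zero
        intro l
        have h1 : ((E i : Fin d → ℤ)) ⬝ᵥ σ.v l = (E j : Fin d → ℤ) ⬝ᵥ σ.v l +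
            p ^ e * ((u : Fin d → ℤ) ⬝ᵥ σ.v l) := by
          simp only at hu
          rw [hu, add_dotProduct, smul_dotProduct]
          simp
        have h2 := (E i).2 l
        have h3 := (E j).2 l
        have h4 : (0 : ℤ) < p ^ e := by exact_mod_cast expChar_pow_pos k p e
        have h5 := u.2 l
        push_cast at h2 h3
        by_contra hne
        have : 1 ≤ (u : Fin d → ℤ) ⬝ᵥ σ.v l := by omega
        nlinarith
      simpa [hu0] using hu

end rings

end ToricCone

/-! ### Free rank and rank of the Frobenius pushforward of a localization. -/

namespace ToricCone

variable {d : ℕ} (σ : ToricCone d) (k : Type u) [Field k]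

instance : IsDomain (σ.Ring k) := NoZeroDivisors.to_isDomain _

variable {k} {R : Type*} [CommRing R] [Algebra (σ.Ring k) R] (S : Submonoid (σ.Ring k))
  [IsLocalization S R] (hS : ∀ s ∈ S, s.coeff 0 ≠ 0)

include hS in
theorem le_nonZeroDivisors_of_coeff_zero_ne_zero : S ≤ nonZeroDivisors (σ.Ring k) :=
  fun s hs => mem_nonZeroDivisors_of_ne_zero fun h => hS s hs (by rw [h]; rfl)

include hS in
theorem algebraMap_injective_of_isLocalization :
    Function.Injective (algebraMap (σ.Ring k) R) :=
  IsLocalization.injective R (σ.le_nonZeroDivisors_of_coeff_zero_ne_zero S hS)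

variable {σ} (p e : ℕ) [ExpChar k p] [PerfectRing k p]

include hS in
theorem frobeniusSplits_of_isLocalization :
    FrobeniusSplits (p ^ e) (Nat.card (σ.latticePoints (p ^ e))) R := by
  obtain ⟨φ, x, hφ, hx⟩ := σ.frobeniusSplits_ring k p e
  choose ψ hψ hψ' using fun j => (hφ j).exists_extension (expChar_pow_pos k p e) (R := R) S
    (σ.algebraMap_injective_of_isLocalization S hS)
  refine ⟨ψ, fun i => algebraMap (σ.Ring k) R (x i), hψ, fun i j => ?_⟩
  rw [hψ', hx]
  split_ifs <;> simp

omit [PerfectRing k p] in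
include hS in
/-- A monomial `t^m` with `⟨m, v_i⟩ ≥ p ^ e` is sent into the maximal ideal by every
`p^{-e}`-linear map. -/
theorem coeff_zero_eq_zero_of_isRootLinear {φ : R →+ R} (hφ : IsRootLinear (p ^ e) φ)
    {m : σ.dualMonoid} {i : Fin σ.n} (hi : (p : ℤ) ^ e ≤ (m : Fin d → ℤ) ⬝ᵥ σ.v i)
    {a s : σ.Ring k}
    (h : φ (algebraMap (σ.Ring k) R (AddMonoidAlgebra.single m 1)) * algebraMap (σ.Ring k) R s =
      algebraMap (σ.Ring k) R a) : a.coeff 0 = 0 := by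
  have hq : (0 : ℤ) < p ^ e := by exact_mod_cast expChar_pow_pos k p e
  -- As `m + q w` is still in the monoid, formally `φ(t^m) = t^{-w} φ(t^{m + q w})`. Multiplying by
  -- `t^{u + w}` clears the exponents. The constant term of `φ(t^m)` would then appear as the
  -- coefficient at `u + w` of a multiple of `t^u`, which is zero because `w` is not in the monoid.
  obtain ⟨w, hw, hw'⟩ := σ.exists_dotProduct_eq_of_ne i (-1) 0
  obtain ⟨u, hu, hu'⟩ := σ.exists_dotProduct_eq_of_ne i 1 0
  have hum : u ∈ σ.dualMonoid := fun j => by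
    by_cases hj : j = i
    · subst hj; rw [hu]; norm_num
    · exact hu' j hj
  have huw : u + w ∈ σ.dualMonoid := fun j => by
    rw [add_dotProduct]
    by_cases hj : j = i
    · subst hj; rw [hu, hw]; norm_num
    · exact add_nonneg (hu' j hj) (hw' j hj)
  have hm' : (m : Fin d → ℤ) + p ^ e • w ∈ σ.dualMonoid := fun j => by
    rw [add_dotProduct, smul_dotProduct, nsmul_eq_mul]
    push_cast
    by_cases hj : j = i
    · subst hj; rw [hw]; linarith
    · exact add_nonneg (m.2 j) (mul_nonneg hq.le (hw' j hj))
  have h1 : (AddMonoidAlgebra.single ⟨u + w, huw⟩ 1 : σ.Ring k) ^ p ^ e *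
      AddMonoidAlgebra.single m 1 = (AddMonoidAlgebra.single ⟨u, hum⟩ 1 : σ.Ring k) ^ p ^ e *
      AddMonoidAlgebra.single ⟨_, hm'⟩ 1 := by
    rw [AddMonoidAlgebra.single_pow, AddMonoidAlgebra.single_pow,
      AddMonoidAlgebra.single_mul_single, AddMonoidAlgebra.single_mul_single]
    congr 1
    apply Subtype.ext
    push_cast
    module
  have h2 := congrArg (fun y => φ (algebraMap (σ.Ring k) R y)) h1
  simp only [map_mul, map_pow] at h2
  rw [hφ, hφ] at h2
  obtain ⟨b, s', hb⟩ := IsLocalization.exists_mk'_eq S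
    (φ (algebraMap (σ.Ring k) R (AddMonoidAlgebra.single ⟨_, hm'⟩ 1)))
  have hb' := IsLocalization.mk'_spec R b s'
  rw [hb] at hb'
  have h3 : AddMonoidAlgebra.single ⟨u + w, huw⟩ 1 * (a * (s' : σ.Ring k)) =
      AddMonoidAlgebra.single ⟨u, hum⟩ 1 * (b * s) := by
    apply σ.algebraMap_injective_of_isLocalization (R := R) S hS
    simp only [map_mul]
    rw [← h, ← hb']
    linear_combination (algebraMap (σ.Ring k) R s * algebraMap (σ.Ring k) R (s' : σ.Ring k)) * h2
  have h4 := congrArg (fun y : σ.Ring k => y.coeff ⟨u + w, huw⟩) h3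
  have h0 : (AddMonoidAlgebra.single ⟨u, hum⟩ 1 * (b * s) : σ.Ring k).coeff ⟨u + w, huw⟩ = 0 := by
    refine AddMonoidAlgebra.coeff_single_mul_of_forall_add_ne _ _ fun x hx => ?_
    have h6 : (x : Fin d → ℤ) = w := by
      have := congrArg Subtype.val hx
      simpa using this
    have h7 := x.2 i
    rw [h6, hw] at h7
    norm_num at h7
  have h5 := AddMonoidAlgebra.coeff_single_mul_add (a * (s' : σ.Ring k)) 1 ⟨u + w, huw⟩ 0
  rw [add_zero, one_mul] at h5
  have h6 := h5.symm.trans (h4.trans h0)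
  rw [← σ.constantTerm_apply, map_mul, σ.constantTerm_apply, σ.constantTerm_apply] at h6
  exact (mul_eq_zero.1 h6).resolve_right (hS s' s'.2)

include hS in
-- Reduced modulo the maximal ideal, the `φ j` give a Frobenius-semilinear map `Φ` from `R` to `k^n`
-- whose values span `k^n`. Since `k` is perfect, all its values lie in the span of those at
-- monomials, and only the monomials at the lattice points contribute. So `n` is at most their
-- number.
theorem FrobeniusSplits.le_card {n : ℕ} (h : FrobeniusSplits (p ^ e) n R) :
    n ≤ Nat.card (σ.latticePoints (p ^ e)) := by
  classical
  obtain ⟨φ, x, hφ, hx⟩ := h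
  have hunit : ∀ s : S, IsUnit ((σ.constantTerm k : σ.Ring k →+* k) s) := fun s =>
    isUnit_iff_ne_zero.2 (by
      change σ.constantTerm k s ≠ 0
      rw [σ.constantTerm_apply]; exact hS s s.2)
  set ε : R →+* k := IsLocalization.lift hunit with hε
  have hεa : ∀ a : σ.Ring k, ε (algebraMap (σ.Ring k) R a) = a.coeff 0 := fun a => by
    rw [hε, IsLocalization.lift_eq]
    exact σ.constantTerm_apply k a
  set Φ : R → Fin n → k := fun y j => ε (φ j y) with hΦ
  have hΦadd : ∀ y z, Φ (y + z) = Φ y + Φ z := fun y z => by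
    funext j; simp [hΦ]
  have hΦmul : ∀ a y, Φ (a ^ p ^ e * y) = ε a • Φ y := fun a y => by
    funext j; simp [hΦ, hφ j a y]
  set b : σ.latticePoints (p ^ e) → Fin n → k := fun g =>
    Φ (algebraMap (σ.Ring k) R (AddMonoidAlgebra.single ⟨g, fun l => (g.2 l).1⟩ 1)) with hb
  set W := Submodule.span k (Set.range b) with hW
  have hmon : ∀ m : σ.dualMonoid, Φ (algebraMap (σ.Ring k) R (AddMonoidAlgebra.single m 1)) ∈ W := by
    intro m
    by_cases hm : (m : Fin d → ℤ) ∈ σ.latticePoints (p ^ e)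
    · exact Submodule.subset_span ⟨⟨m, hm⟩, rfl⟩
    · have : ∃ i, (p : ℤ) ^ e ≤ (m : Fin d → ℤ) ⬝ᵥ σ.v i := by
        by_contra hne
        push Not at hne
        exact hm fun i => ⟨m.2 i, by exact_mod_cast hne i⟩
      obtain ⟨i, hi⟩ := this
      have h0 : Φ (algebraMap (σ.Ring k) R (AddMonoidAlgebra.single m 1)) = 0 := by
        funext j
        obtain ⟨a, s, ha⟩ := IsLocalization.exists_mk'_eq S
          (φ j (algebraMap (σ.Ring k) R (AddMonoidAlgebra.single m 1)))
        have h1 := IsLocalization.mk'_spec R a s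
        rw [ha] at h1
        have h2 := coeff_zero_eq_zero_of_isRootLinear S hS p e (hφ j) hi h1
        have h3 := congrArg ε h1
        rw [map_mul, hεa, hεa, h2] at h3
        exact (mul_eq_zero.1 h3).resolve_right (hS s s.2)
      rw [h0]
      exact Submodule.zero_mem _
  have hA : ∀ y : σ.Ring k, Φ (algebraMap (σ.Ring k) R y) ∈ W := by
    intro y
    induction y using AddMonoidAlgebra.induction_linear with
    | zero =>
      rw [map_zero]
      convert Submodule.zero_mem W
      funext j; simp [hΦ]
    | add f g hf hg => rw [map_add, hΦadd]; exact Submodule.add_mem _ hf hg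
    | single m c =>
      have h1 : (AddMonoidAlgebra.single m c : σ.Ring k) =
          (AddMonoidAlgebra.single 0 ((iterateFrobeniusEquiv k p e).symm c)) ^ p ^ e *
            AddMonoidAlgebra.single m 1 := by
        rw [AddMonoidAlgebra.single_pow, AddMonoidAlgebra.single_mul_single,
          ← iterateFrobeniusEquiv_def, RingEquiv.apply_symm_apply]
        simp
      rw [h1, map_mul, map_pow, hΦmul]
      exact Submodule.smul_mem _ _ (hmon m)
  -- For `y = a / s` one has `s^q y = a s^{q-1}`, and `s` has nonzero constant term, so `Φ y` is a
  -- nonzero multiple of a vector already known to be in `W`.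
  have hR : ∀ y : R, Φ y ∈ W := by
    intro y
    obtain ⟨a, s, rfl⟩ := IsLocalization.exists_mk'_eq S y
    have h1 := IsLocalization.mk'_spec R a s
    have h2 := hΦmul (algebraMap (σ.Ring k) R (s : σ.Ring k)) (IsLocalization.mk' R a s)
    have h3 : (algebraMap (σ.Ring k) R (s : σ.Ring k)) ^ p ^ e * IsLocalization.mk' R a s =
        algebraMap (σ.Ring k) R (a * (s : σ.Ring k) ^ (p ^ e - 1)) := by
      rw [map_mul, map_pow, ← h1, ← Nat.sub_add_cancel (expChar_pow_pos k p e), pow_succ,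
        Nat.add_sub_cancel]
      ring
    rw [h3, hεa] at h2
    have h4 := hA (a * (s : σ.Ring k) ^ (p ^ e - 1))
    rw [h2] at h4
    exact (Submodule.smul_mem_iff _ (hS s s.2)).1 h4
  have htop : W = ⊤ := by
    rw [eq_top_iff, ← (Pi.basisFun k (Fin n)).span_eq, Submodule.span_le]
    rintro _ ⟨i, rfl⟩
    have h1 : Pi.basisFun k (Fin n) i = Φ (x i) := by
      funext j
      simp only [hΦ, hx, Pi.basisFun_apply, Pi.single_apply]
      rw [apply_ite ε, map_one, map_zero]
      simp [eq_comm]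
    rw [h1]
    exact hR (x i)
  have := Fintype.ofFinite (σ.latticePoints (p ^ e))
  have h5 := finrank_range_le_card (R := k) b
  rw [Set.finrank, ← hW, htop, finrank_top, Module.finrank_fin_fun] at h5
  rwa [Nat.card_eq_fintype_card]

include hS in
-- The submonoid may be the complement of the irrelevant ideal, which gives the F-signature, or `⊥`,
-- which gives the same number as an invariant of the ring itself.
theorem isGreatest_frobeniusSplits :
    IsGreatest {n | FrobeniusSplits (p ^ e) n R} (Nat.card (σ.latticePoints (p ^ e))) :=
  ⟨frobeniusSplits_of_isLocalization S hS p e, fun _ h => FrobeniusSplits.le_card S hS p e h⟩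


omit [PerfectRing k p] in
variable (σ) in
/-- Representatives of the classes modulo `q`, shifted in two opposite directions of the cone. -/
theorem exists_shifted_representatives (q : ℕ) (hq : 0 < q) (c : Fin d → ℤ) :
    ∃ (m U : Fin d → ℤ) (x u : σ.dualMonoid), (∀ i, m ⬝ᵥ σ.v i < q) ∧
      (x : Fin d → ℤ) = m + q • (u : Fin d → ℤ) ∧ (x : Fin d → ℤ) = c + q • U ∧
      m = c - q • U := by
  obtain ⟨U, hU⟩ := σ.exists_interior (∑ i, |c ⬝ᵥ σ.v i|)
  have h : ∀ i, |c ⬝ᵥ σ.v i| ≤ U ⬝ᵥ σ.v i := fun i =>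
    (Finset.single_le_sum (f := fun i => |c ⬝ᵥ σ.v i|) (fun _ _ => abs_nonneg _)
      (Finset.mem_univ i)).trans (hU i)
  have hq' : (1 : ℤ) ≤ q := by exact_mod_cast hq
  refine ⟨c - q • U, U, ⟨c + q • U, fun i => ?_⟩, ⟨2 • U, fun i => ?_⟩, fun i => ?_, ?_, rfl, rfl⟩
  · rw [add_dotProduct, smul_dotProduct, nsmul_eq_mul]
    nlinarith [h i, neg_abs_le (c ⬝ᵥ σ.v i), abs_nonneg (c ⬝ᵥ σ.v i)]
  · rw [smul_dotProduct, nsmul_eq_mul]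
    push_cast
    linarith [h i, abs_nonneg (c ⬝ᵥ σ.v i)]
  · rw [sub_dotProduct, smul_dotProduct, nsmul_eq_mul]
    nlinarith [h i, le_abs_self (c ⬝ᵥ σ.v i), abs_nonneg (c ⬝ᵥ σ.v i)]
  · simp only
    module

include hS in
-- One monomial `t^x` is taken from each class of exponents modulo `q`. They are independent because
-- the shifted root map of a class kills the monomials of the other classes, and their span `N` has
-- torsion quotient, so that `N` carries the whole rank. No basis of the pushforward is needed.
theorem finrank_frobeniusPushforward [ExpChar R p] :
    Module.finrank R (FrobeniusPushforward p e R) = (p ^ e) ^ d := by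
  classical
  set q := p ^ e with hqdef
  have hq : 0 < q := expChar_pow_pos k p e
  have hinj := σ.algebraMap_injective_of_isLocalization (R := R) S hS
  have : IsDomain R := IsLocalization.isDomain_of_le_nonZeroDivisors _
    (σ.le_nonZeroDivisors_of_coeff_zero_ne_zero S hS)
  choose m U x u hm hxm hxU hmU using fun c : Fin d → Fin q =>
    σ.exists_shifted_representatives q hq fun j => ((c j : ℕ) : ℤ)
  have hroot : ∀ c, IsRootLinear q (σ.rootMap k p e (m c)) := fun c =>
    σ.isRootLinear_rootMap k p e (by exact_mod_cast hm c)
  choose ψ hψ hψ' using fun c => (hroot c).exists_extension hq (R := R) S hinj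
  set mon : σ.dualMonoid → R := fun y => algebraMap (σ.Ring k) R (AddMonoidAlgebra.single y 1)
    with hmon
  have hmon0 : ∀ y, mon y ≠ 0 := fun y h => by
    have h1 := hinj (h.trans (map_zero _).symm)
    rw [AddMonoidAlgebra.single_eq_zero] at h1
    exact one_ne_zero h1
  set b : (Fin d → Fin q) → FrobeniusPushforward p e R := fun c =>
    FrobeniusPushforward.of p e R (mon (x c)) with hb
  have hψb : ∀ c c', ψ c (mon (x c')) = if c = c' then mon (u c) else 0 := by
    intro c c'
    rw [hmon, hψ']
    split_ifs with h
    · subst h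
      rw [σ.rootMap_single_of_eq k p e 1 (hxm c), map_one]
    · rw [σ.rootMap_single_of_ne k p e, map_zero]
      intro w hw
      apply h
      funext j
      have h1 := congrFun (hw.symm.trans (hxU c')) j
      rw [hmU] at h1
      simp only [Pi.add_apply, Pi.sub_apply, nsmul_eq_mul, Pi.mul_apply, Pi.natCast_apply,
        ← hqdef] at h1
      have h2 : ((c' j : ℕ) : ℤ) ≡ ((c j : ℕ) : ℤ) [ZMOD q] := by
        rw [Int.modEq_iff_dvd]
        exact ⟨U c' j + U c j - (w : Fin d → ℤ) j, by linear_combination h1⟩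
      have h3 := Int.natCast_modEq_iff.1 h2
      exact Fin.ext (Nat.ModEq.eq_of_lt_of_lt h3 (c' j).2 (c j).2).symm
  have hli : LinearIndependent R b := by
    rw [Fintype.linearIndependent_iff]
    intro r hr c
    have h1 : ∑ c', r c' ^ q * mon (x c') = (0 : R) := by
      have h2 : ∀ c', r c' • b c' = FrobeniusPushforward.of p e R (r c' ^ q * mon (x c')) :=
        fun c' => FrobeniusPushforward.smul_of p e R _ _
      simp_rw [h2] at hr
      exact hr
    have h2 := congrArg (ψ c) h1
    rw [map_sum, map_zero] at h2
    simp only [hψ c _ _, hψb, mul_ite, mul_zero, Finset.sum_ite_eq, Finset.mem_univ, if_true] at h2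
    exact (mul_eq_zero.1 h2).resolve_right (hmon0 _)
  set N := Submodule.span R (Set.range b) with hN
  have htors : ∀ y : FrobeniusPushforward p e R, ∃ a : R, a ≠ 0 ∧ a • y ∈ N := by
    have hof : ∀ a z : R, FrobeniusPushforward.of p e R (a ^ q * z) =
      a • FrobeniusPushforward.of p e R z := fun a z =>
        (FrobeniusPushforward.smul_of p e R a z).symm
    have hmono : ∀ y : σ.dualMonoid, ∃ a : R, a ≠ 0 ∧
        a • FrobeniusPushforward.of p e R (mon y) ∈ N := by
      intro y
      have hqz : (0 : ℤ) < q := by exact_mod_cast hq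
      set c : Fin d → Fin q := fun j => ⟨((y : Fin d → ℤ) j % q).toNat, by
        have := Int.emod_lt_of_pos ((y : Fin d → ℤ) j) hqz
        have := Int.emod_nonneg ((y : Fin d → ℤ) j) hqz.ne'
        omega⟩ with hc
      have hyc : (y : Fin d → ℤ) = (fun j => ((c j : ℕ) : ℤ)) +
          q • (fun j => (y : Fin d → ℤ) j / q) := by
        funext j
        have h1 := Int.emod_nonneg ((y : Fin d → ℤ) j) hqz.ne'
        have h2 := Int.emod_add_mul_ediv ((y : Fin d → ℤ) j) q
        simp only [hc, Pi.add_apply, nsmul_eq_mul, Pi.mul_apply, Pi.natCast_apply,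
          Int.toNat_of_nonneg h1]
        linarith
      -- The exponent `y` and the representative of its class differ by `q` times a lattice vector,
      -- which is a difference `w - w'` in the monoid; hence `t^w • F^e_* t^y = t^{w'} • b c`.
      obtain ⟨w, w', hw⟩ := σ.exists_sub_eq (U c - fun j => (y : Fin d → ℤ) j / q)
      refine ⟨mon w, hmon0 w, ?_⟩
      have h1 : mon w • FrobeniusPushforward.of p e R (mon y) = mon w' • b c := by
        rw [hb, ← hof, ← hof]
        congr 1
        simp only [hmon, ← map_pow, ← map_mul]
        rw [AddMonoidAlgebra.single_pow, AddMonoidAlgebra.single_pow,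
          AddMonoidAlgebra.single_mul_single, AddMonoidAlgebra.single_mul_single]
        congr 2
        apply Subtype.ext
        push_cast
        rw [hxU c, hyc, sub_eq_iff_eq_add.1 hw]
        module
      rw [h1]
      exact Submodule.smul_mem _ _ (Submodule.subset_span ⟨c, rfl⟩)
    have hring : ∀ y : σ.Ring k, ∃ a : R, a ≠ 0 ∧
        a • FrobeniusPushforward.of p e R (algebraMap (σ.Ring k) R y) ∈ N := by
      intro y
      induction y using AddMonoidAlgebra.induction_linear with
      | zero =>
        refine ⟨1, one_ne_zero, ?_⟩
        rw [map_zero, one_smul]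
        exact Submodule.zero_mem N
      | add f g hf hg =>
        obtain ⟨a, ha, ha'⟩ := hf
        obtain ⟨a', h0, h1⟩ := hg
        refine ⟨a' * a, mul_ne_zero h0 ha, ?_⟩
        have h2 : FrobeniusPushforward.of p e R (algebraMap (σ.Ring k) R (f + g)) =
          FrobeniusPushforward.of p e R (algebraMap (σ.Ring k) R f) +
            FrobeniusPushforward.of p e R (algebraMap (σ.Ring k) R g) := by
          rw [map_add]; rfl
        rw [h2, smul_add, mul_smul, mul_comm a' a, mul_smul]
        exact Submodule.add_mem _ (Submodule.smul_mem _ _ ha') (Submodule.smul_mem _ _ h1)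
      | single y c =>
        obtain ⟨a, ha, ha'⟩ := hmono y
        refine ⟨a, ha, ?_⟩
        have h1 : (AddMonoidAlgebra.single y c : σ.Ring k) =
            (AddMonoidAlgebra.single 0 ((iterateFrobeniusEquiv k p e).symm c)) ^ q *
              AddMonoidAlgebra.single y 1 := by
          rw [AddMonoidAlgebra.single_pow, AddMonoidAlgebra.single_mul_single,
            ← iterateFrobeniusEquiv_def, RingEquiv.apply_symm_apply]
          simp
        rw [h1, map_mul, map_pow, hof, smul_comm]
        exact Submodule.smul_mem _ _ ha'
    intro y
    obtain ⟨z, s, hz⟩ := IsLocalization.exists_mk'_eq S (show R from y)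
    have h1 := IsLocalization.mk'_spec R z s
    obtain ⟨a, ha, ha'⟩ := hring (z * (s : σ.Ring k) ^ (q - 1))
    refine ⟨a * algebraMap (σ.Ring k) R s, mul_ne_zero ha fun h => ?_, ?_⟩
    · apply hS s s.2
      rw [hinj (h.trans (map_zero _).symm)]
      rfl
    · rw [mul_smul]
      convert ha' using 2
      have h2 : y = FrobeniusPushforward.of p e R (IsLocalization.mk' R z s) := hz.symm
      rw [h2, ← hof]
      congr 1
      rw [map_mul, map_pow, ← h1]
      obtain ⟨t, ht⟩ : ∃ t, q = t + 1 := ⟨q - 1, by omega⟩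
      rw [ht, Nat.add_sub_cancel]
      ring
  have hquot : Module.rank R (FrobeniusPushforward p e R ⧸ N) = 0 := by
    rw [rank_eq_zero_iff]
    intro y
    obtain ⟨y, rfl⟩ := N.mkQ_surjective y
    obtain ⟨a, ha, ha'⟩ := htors y
    exact ⟨a, ha, by
      rw [← map_smul]
      exact (Submodule.Quotient.mk_eq_zero N).2 ha'⟩
  have h1 := rank_quotient_add_rank_of_isDomain N
  rw [hquot, zero_add] at h1
  have h2 := finrank_span_eq_card hli
  rw [Module.finrank, ← h1, ← Module.finrank, hN, h2]
  simp

end ToricCone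

/-! ### The F-signature as a volume, and its invariance. -/

section

open MeasureTheory Pointwise

theorem FrobeniusPushforward.finrank_eq_of_ringEquiv {p e : ℕ} {R S : Type u} [CommRing R]
    [CommRing S] [ExpChar R p] [ExpChar S p] (f : R ≃+* S) :
    Module.finrank R (FrobeniusPushforward p e R) =
      Module.finrank S (FrobeniusPushforward p e S) := by
  let j : FrobeniusPushforward p e R ≃+ FrobeniusPushforward p e S := f.toAddEquiv
  have hj : ∀ r x : R, f (r ^ p ^ e * x) = f r ^ p ^ e * f x := fun r x => by
    rw [map_mul, map_pow]
  have h := rank_eq_of_equiv_equiv (f : R → S) j f.bijective fun r x =>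
    ((congrArg j (FrobeniusPushforward.smul_of p e R r x)).trans (hj r x)).trans
      (FrobeniusPushforward.smul_of p e S (f r) (f x)).symm
  rw [Module.finrank, h, ← Module.finrank]

namespace ToricCone

variable {d : ℕ} (σ : ToricCone d)

/-- The region `0 ≤ ⟨x, v_i⟩ < 1` in `ℝ^d`. -/
def box : Set (Fin d → ℝ) :=
  {x | ∀ i, 0 ≤ x ⬝ᵥ latticeVec (σ.v i) ∧ x ⬝ᵥ latticeVec (σ.v i) < 1}

theorem measurableSet_box : MeasurableSet σ.box := by
  unfold box dotProduct
  measurability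

theorem convex_box : Convex ℝ σ.box := by
  have : σ.box = ⋂ i, (fun x => x ⬝ᵥ latticeVec (σ.v i)) ⁻¹' Set.Ico (0 : ℝ) 1 := by
    ext x
    simp [box]
  rw [this]
  refine convex_iInter fun i => ?_
  exact (convex_Ico (0 : ℝ) 1).is_linear_preimage
    ⟨fun x y => add_dotProduct x y _, fun c x => smul_dotProduct c x _⟩

theorem eq_zero_of_real_dotProduct_eq_zero {x : Fin d → ℝ}
    (h : ∀ i, x ⬝ᵥ latticeVec (σ.v i) = 0) : x = 0 := by
  have key : ∀ y ∈ Submodule.span ℝ (Set.range fun i => latticeVec (σ.v i)), x ⬝ᵥ y = 0 := by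
    intro y hy
    induction hy using Submodule.span_induction with
    | mem y hy =>
      obtain ⟨i, rfl⟩ := hy
      exact h i
    | zero => simp
    | add y z _ _ hy hz => rw [dotProduct_add, hy, hz, add_zero]
    | smul a y _ hy => rw [dotProduct_smul, hy, smul_zero]
  exact dotProduct_self_eq_zero.1 (key x (by rw [σ.span_eq_top]; exact Submodule.mem_top))

theorem isBounded_box : Bornology.IsBounded σ.box := by
  let f : (Fin d → ℝ) →ₗ[ℝ] (Fin σ.n → ℝ) :=
    { toFun := fun x i => x ⬝ᵥ latticeVec (σ.v i)
      map_add' := fun x y => by funext i; exact add_dotProduct x y _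
      map_smul' := fun c x => by funext i; exact smul_dotProduct c x _ }
  obtain ⟨K, -, hK⟩ := f.exists_antilipschitzWith (by
    rw [LinearMap.ker_eq_bot']
    intro x hx
    exact σ.eq_zero_of_real_dotProduct_eq_zero fun i => congrFun hx i)
  have h1 : Bornology.IsBounded (Set.pi Set.univ fun _ : Fin σ.n => Set.Icc (0 : ℝ) 1) :=
    Bornology.IsBounded.pi fun _ => Metric.isBounded_Icc 0 1
  refine (hK.isBounded_preimage h1).subset fun x hx i _ => ?_
  exact ⟨(hx i).1, (hx i).2.le⟩

/-- The volume of the region `0 ≤ ⟨x, v_i⟩ < 1`. -/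
def boxVolume : ℝ := volume.real σ.box

theorem card_latticePoints {q : ℕ} (hq : 0 < q) :
    Nat.card (σ.latticePoints q) = Nat.card ↑(σ.box ∩ (q : ℝ)⁻¹ •
      (Submodule.span ℤ (Set.range (Pi.basisFun ℝ (Fin d))) : Set (Fin d → ℝ))) := by
  have hq' : (0 : ℝ) < q := by exact_mod_cast hq
  have hdot : ∀ (m : Fin d → ℤ) i, ((q : ℝ)⁻¹ • latticeVec m) ⬝ᵥ latticeVec (σ.v i) =
      (m ⬝ᵥ σ.v i : ℤ) / q := fun m i => by
    rw [smul_dotProduct, latticeVec_dotProduct, smul_eq_mul, inv_mul_eq_div]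
  have hmem : ∀ m : Fin d → ℤ, (q : ℝ)⁻¹ • latticeVec m ∈ σ.box ↔ m ∈ σ.latticePoints q := by
    intro m
    refine forall_congr' fun i => ?_
    rw [hdot, div_lt_one hq', le_div_iff₀ hq', zero_mul]
    norm_cast
  refine Nat.card_congr (Equiv.ofBijective (fun m => ⟨(q : ℝ)⁻¹ • latticeVec m.1,
    (hmem _).2 m.2, Set.smul_mem_smul_set ?_⟩) ⟨fun m m' h => ?_, ?_⟩)
  · rw [SetLike.mem_coe, Module.Basis.mem_span_iff_repr_mem]
    intro j
    exact ⟨m.1 j, by simp [latticeVec]⟩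
  · have h1 := smul_right_injective _ (inv_ne_zero hq'.ne') (congrArg Subtype.val h)
    apply Subtype.ext
    funext j
    have := congrFun h1 j
    simpa [latticeVec] using this
  · rintro ⟨x, hx, y, hy, rfl⟩
    rw [SetLike.mem_coe, Module.Basis.mem_span_iff_repr_mem] at hy
    choose m hm using hy
    have hy' : y = latticeVec m := by
      funext j
      have := hm j
      simp only [Pi.basisFun_repr] at this
      rw [← this]
      rfl
    subst hy'
    exact ⟨⟨m, (hmem m).1 hx⟩, rfl⟩

/-- After scaling by `1 / q` this counts points of a fine lattice in a bounded set. The box is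
convex, so its frontier is a null set and the count is asymptotic to the volume. -/
theorem tendsto_card_latticePoints {p : ℕ} (hp : 1 < p) :
    Tendsto (fun e : ℕ => (Nat.card (σ.latticePoints (p ^ e)) : ℝ) / ((p ^ e) ^ d : ℕ)) atTop
      (𝓝 σ.boxVolume) := by
  have h1 := (tendsto_card_div_pow_atTop_volume σ.box σ.isBounded_box σ.measurableSet_box
    (σ.convex_box.addHaar_frontier volume)).comp (tendsto_pow_atTop_atTop_of_one_lt hp)
  refine h1.congr fun e => ?_
  simp only [Function.comp_apply]
  rw [σ.card_latticePoints (pow_pos (by omega) e)]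
  simp

variable (k : Type u) [Field k] (p : ℕ) [ExpChar k p] [PerfectRing k p]

theorem hasFSignature_boxVolume (hp : 1 < p) :
    HasFSignature p (σ.LocalRing k) σ.boxVolume := by
  unfold HasFSignature
  have hS : ∀ s ∈ (σ.irrelevantIdeal k).primeCompl, s.coeff 0 ≠ 0 := by
    intro s hs h
    apply hs
    change σ.constantTerm k s = 0
    rw [σ.constantTerm_apply, h]
  refine (σ.tendsto_card_latticePoints hp).congr fun e => ?_
  rw [frobeniusFreeRank_eq_of_isGreatest
    (isGreatest_frobeniusSplits (σ.irrelevantIdeal k).primeCompl hS p e),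
    finrank_frobeniusPushforward (σ.irrelevantIdeal k).primeCompl hS p e]

variable {k}

include p in
/-- The volume of the box is an invariant of the ring. -/
theorem boxVolume_eq_of_ringEquiv (hp : 1 < p) {d' : ℕ} {τ : ToricCone d'}
    (f : σ.Ring k ≃+* τ.Ring k) : σ.boxVolume = τ.boxVolume := by
  -- An isomorphism need not respect the irrelevant ideals, so the splittings are counted in the
  -- rings themselves, seen as their localizations at `⊥`.
  have hbot : ∀ {d : ℕ} (σ : ToricCone d), IsLocalization (⊥ : Submonoid (σ.Ring k)) (σ.Ring k) :=
    fun σ => IsLocalization.self bot_le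
  have h1 := hbot σ
  have h2 := hbot τ
  have hS : ∀ {d : ℕ} (σ : ToricCone d), ∀ s ∈ (⊥ : Submonoid (σ.Ring k)), s.coeff 0 ≠ 0 := by
    intro d σ s hs
    rw [Submonoid.mem_bot] at hs
    rw [← σ.constantTerm_apply, hs, map_one]
    exact one_ne_zero
  have hcard : ∀ e, Nat.card (σ.latticePoints (p ^ e)) = Nat.card (τ.latticePoints (p ^ e)) := by
    intro e
    refine (isGreatest_frobeniusSplits (R := σ.Ring k) ⊥ (hS σ) p e).unique ?_
    have h3 := isGreatest_frobeniusSplits (R := τ.Ring k) ⊥ (hS τ) p e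
    have h4 : {n | FrobeniusSplits (p ^ e) n (σ.Ring k)} =
        {n | FrobeniusSplits (p ^ e) n (τ.Ring k)} :=
      Set.ext fun n => ⟨fun h => h.of_ringEquiv f, fun h => h.of_ringEquiv f.symm⟩
    rwa [h4]
  -- The dimension is read off from the rank `p ^ d` of the first pushforward.
  have hd : d = d' := by
    have h3 := FrobeniusPushforward.finrank_eq_of_ringEquiv (p := p) (e := 1) f
    rw [finrank_frobeniusPushforward ⊥ (hS σ) p 1, finrank_frobeniusPushforward ⊥ (hS τ) p 1,
      pow_one] at h3
    exact Nat.pow_right_injective hp h3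
  subst hd
  refine tendsto_nhds_unique (σ.tendsto_card_latticePoints hp) ?_
  simp_rw [hcard]
  exact τ.tendsto_card_latticePoints hp

end ToricCone

end

section

open MeasureTheory

/-! ### Splines -/

/-- The average of `f` over the unit interval centred at `y`. -/
def unitAverage (f : ℝ → ℝ) (y : ℝ) : ℝ := ∫ u in (y - 1 / 2)..(y + 1 / 2), f u

theorem Continuous.unitAverage {f : ℝ → ℝ} (hf : Continuous f) : Continuous (unitAverage f) := by
  have h : _root_.unitAverage f = fun y => (∫ u in (0 : ℝ)..(y + 1 / 2), f u) -
      ∫ u in (0 : ℝ)..(y - 1 / 2), f u := by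
    funext y
    exact (intervalIntegral.integral_interval_sub_left (hf.intervalIntegrable _ _)
      (hf.intervalIntegrable _ _)).symm
  rw [h]
  have h1 := intervalIntegral.continuous_primitive (fun a b => hf.intervalIntegrable (μ := volume) a b) 0
  exact (h1.comp (by fun_prop)).sub (h1.comp (by fun_prop))

/-- `f` is even, and nonincreasing on `[0, ∞)`. -/
def IsAntitoneInAbs (f : ℝ → ℝ) : Prop := ∀ ⦃x y : ℝ⦄, |x| ≤ |y| → f y ≤ f x

theorem IsAntitoneInAbs.even {f : ℝ → ℝ} (hf : IsAntitoneInAbs f) (x : ℝ) : f (-x) = f x :=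
  le_antisymm (hf (by rw [abs_neg])) (hf (by rw [abs_neg]))

theorem IsAntitoneInAbs.le_zero {f : ℝ → ℝ} (hf : IsAntitoneInAbs f) (x : ℝ) : f x ≤ f 0 :=
  hf (by rw [abs_zero]; exact abs_nonneg x)

theorem unitAverage_neg {f : ℝ → ℝ} (hf : ∀ x, f (-x) = f x) (y : ℝ) :
    unitAverage f (-y) = unitAverage f y := by
  unfold unitAverage
  have h := intervalIntegral.integral_comp_neg (a := y - 1 / 2) (b := y + 1 / 2) f
  simp_rw [hf] at h
  rw [h]
  congr 1 <;> ring

/-- For `0 ≤ x ≤ y` the averages at `x` and `y` differ by the integral of `f (t - 1 / 2) - f (t + 1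
/ 2)` over `[x, y]`, which is nonnegative because `|t - 1 / 2| ≤ t + 1 / 2`. -/
theorem IsAntitoneInAbs.unitAverage {f : ℝ → ℝ} (hf : IsAntitoneInAbs f) (hc : Continuous f) :
    IsAntitoneInAbs (unitAverage f) := by
  have hi : ∀ a b, IntervalIntegrable f volume a b := fun a b => hc.intervalIntegrable a b
  have habs : ∀ y, _root_.unitAverage f |y| = _root_.unitAverage f y := by
    intro y
    rcases abs_choice y with h | h <;> rw [h]
    exact unitAverage_neg hf.even y
  have key : ∀ x y, 0 ≤ x → x ≤ y → _root_.unitAverage f y ≤ _root_.unitAverage f x := by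
    intro x y hx hxy
    unfold _root_.unitAverage
    have h1 : (∫ u in (x - 1 / 2)..(x + 1 / 2), f u) - ∫ u in (y - 1 / 2)..(y + 1 / 2), f u =
        ∫ t in x..y, (f (t - 1 / 2) - f (t + 1 / 2)) := by
      rw [intervalIntegral.integral_interval_sub_interval_comm (hi _ _) (hi _ _) (hi _ _),
        intervalIntegral.integral_sub, intervalIntegral.integral_comp_sub_right,
        intervalIntegral.integral_comp_add_right]
      · exact (hc.comp (by fun_prop)).intervalIntegrable _ _
      · exact (hc.comp (by fun_prop)).intervalIntegrable _ _
    have h2 : 0 ≤ ∫ t in x..y, (f (t - 1 / 2) - f (t + 1 / 2)) := by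
      refine intervalIntegral.integral_nonneg hxy fun t ht => sub_nonneg.2 (hf ?_)
      have : 0 ≤ t := hx.trans ht.1
      rw [abs_of_nonneg (by linarith : 0 ≤ t + 1 / 2), abs_le]
      constructor <;> linarith
    linarith
  intro x y hxy
  rw [← habs x, ← habs y]
  exact key _ _ (abs_nonneg x) hxy

theorem unitAverage_nonneg {f : ℝ → ℝ} (hf : ∀ x, 0 ≤ f x) (y : ℝ) : 0 ≤ unitAverage f y :=
  intervalIntegral.integral_nonneg (by linarith) fun u _ => hf u

theorem unitAverage_le {f : ℝ → ℝ} (hc : Continuous f) {c : ℝ} (hf : ∀ x, f x ≤ c) (y : ℝ) :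
    unitAverage f y ≤ c := by
  have h := intervalIntegral.integral_mono_on (μ := volume) (a := y - 1 / 2) (b := y + 1 / 2)
    (by linarith)
    (hc.intervalIntegrable _ _) (continuous_const (y := c) |>.intervalIntegrable _ _)
    fun u _ => hf u
  rw [intervalIntegral.integral_const] at h
  unfold unitAverage
  refine h.trans (le_of_eq ?_)
  rw [smul_eq_mul]; ring

/-- The tent function, the density of the sum of two independent uniform variables. -/
def tent (y : ℝ) : ℝ := max 0 (1 - |y|)

theorem continuous_tent : Continuous tent := by unfold tent; fun_prop

theorem tent_nonneg (y : ℝ) : 0 ≤ tent y := le_max_left _ _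

theorem isAntitoneInAbs_tent : IsAntitoneInAbs tent := fun x y h =>
  max_le_max le_rfl (by linarith)

/-- `spline n y` is the probability that `y + ∑ (U_i - 1 / 2)` lies in `[-1 / 2, 1 / 2)`, for
`n + 1` independent variables `U_i` uniformly distributed in `[0, 1)`. -/
def spline (n : ℕ) : ℝ → ℝ := unitAverage^[n] tent

theorem spline_succ (n : ℕ) : spline (n + 1) = unitAverage (spline n) :=
  Function.iterate_succ_apply' _ _ _

theorem continuous_spline (n : ℕ) : Continuous (spline n) := by
  induction n with
  | zero => exact continuous_tent
  | succ n ih => rw [spline_succ]; exact ih.unitAverage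

theorem isAntitoneInAbs_spline (n : ℕ) : IsAntitoneInAbs (spline n) := by
  induction n with
  | zero => exact isAntitoneInAbs_tent
  | succ n ih => rw [spline_succ]; exact ih.unitAverage (continuous_spline n)

theorem spline_nonneg (n : ℕ) (y : ℝ) : 0 ≤ spline n y := by
  induction n generalizing y with
  | zero => exact tent_nonneg y
  | succ n ih => rw [spline_succ]; exact unitAverage_nonneg ih y

/-- Averaging does not raise an upper bound, so one value at `0` controls every larger number of
variables. -/
theorem spline_le_of_le {m n : ℕ} (h : m ≤ n) (y : ℝ) : spline n y ≤ spline m 0 := by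
  induction n, h using Nat.le_induction generalizing y with
  | base => exact (isAntitoneInAbs_spline m).le_zero y
  | succ n _ ih => rw [spline_succ]; exact unitAverage_le (continuous_spline n) ih y

/-! ### Truncated powers -/

/-- The truncated power function `x_+^m / m!` (for `m ≥ 1`). -/
def truncPow (m : ℕ) (x : ℝ) : ℝ := max x 0 ^ m / m.factorial

theorem continuous_truncPow (m : ℕ) : Continuous (truncPow m) := by
  unfold truncPow; fun_prop

/-- For `m = 0` this would fail: `truncPow 0` is the constant `1`, not a step function. -/
theorem integral_truncPow {m : ℕ} (hm : m ≠ 0) (a b : ℝ) :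
    ∫ u in a..b, truncPow m u = truncPow (m + 1) b - truncPow (m + 1) a := by
  refine MeasureTheory.integral_eq_of_hasDerivAt_off_countable (truncPow (m + 1)) (truncPow m)
    (Set.countable_singleton (0 : ℝ)) (continuous_truncPow _).continuousOn ?_
    ((continuous_truncPow _).intervalIntegrable _ _)
  rintro x ⟨-, hx⟩
  rcases lt_or_gt_of_ne hx with h | h
  · have h1 : truncPow (m + 1) =ᶠ[𝓝 x] fun _ => 0 := by
      filter_upwards [Iio_mem_nhds h] with y hy
      have : y < 0 := hy
      simp [truncPow, max_eq_right this.le]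
    have h2 : truncPow m x = 0 := by simp [truncPow, max_eq_right h.le, hm]
    rw [h2]
    exact (hasDerivAt_const x (0 : ℝ)).congr_of_eventuallyEq h1
  · have h1 : truncPow (m + 1) =ᶠ[𝓝 x] fun y => y ^ (m + 1) / (m + 1).factorial := by
      filter_upwards [Ioi_mem_nhds h] with y hy
      have : 0 < y := hy
      simp [truncPow, max_eq_left this.le]
    refine HasDerivAt.congr_of_eventuallyEq ?_ h1
    have h2 := (hasDerivAt_pow (m + 1) x).div_const ((m + 1).factorial : ℝ)
    refine h2.congr_deriv ?_
    have h3 : truncPow m x = x ^ m / m.factorial := by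
      simp only [truncPow, max_eq_left (le_of_lt h)]
    rw [h3, Nat.factorial_succ, Nat.add_sub_cancel]
    push_cast
    have : (m : ℝ) + 1 ≠ 0 := by positivity
    field_simp

/-- Iterated central differences of truncated powers. -/
def truncPowDiff : ℕ → ℕ → ℝ → ℝ
  | 0, m => truncPow m
  | j + 1, m => fun y => truncPowDiff j m (y + 1 / 2) - truncPowDiff j m (y - 1 / 2)

theorem continuous_truncPowDiff (j m : ℕ) : Continuous (truncPowDiff j m) := by
  induction j with
  | zero => exact continuous_truncPow m
  | succ j ih => exact (ih.comp (by fun_prop)).sub (ih.comp (by fun_prop))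

theorem unitAverage_comp_add (f : ℝ → ℝ) (c y : ℝ) :
    unitAverage (fun u => f (u + c)) y = unitAverage f (y + c) := by
  unfold unitAverage
  rw [intervalIntegral.integral_comp_add_right]
  congr 1 <;> ring

theorem unitAverage_sub {f g : ℝ → ℝ} (hf : Continuous f) (hg : Continuous g) (y : ℝ) :
    unitAverage (fun u => f u - g u) y = unitAverage f y - unitAverage g y :=
  intervalIntegral.integral_sub (hf.intervalIntegrable _ _) (hg.intervalIntegrable _ _)

theorem unitAverage_const_mul (f : ℝ → ℝ) (c y : ℝ) :
    unitAverage (fun u => c * f u) y = c * unitAverage f y :=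
  intervalIntegral.integral_const_mul _ _

/-- Averaging is the central difference of an antiderivative, so it raises both indices by one.
Starting from the tent function, this puts the splines in closed form. -/
theorem unitAverage_truncPowDiff (j : ℕ) {m : ℕ} (hm : m ≠ 0) :
    unitAverage (truncPowDiff j m) = truncPowDiff (j + 1) (m + 1) := by
  induction j with
  | zero => funext y; exact integral_truncPow hm _ _
  | succ j ih =>
    funext y
    have hc := continuous_truncPowDiff j m
    have h1 : Continuous fun u => truncPowDiff j m (u + 1 / 2) := hc.comp (by fun_prop)
    have h2 : Continuous fun u => truncPowDiff j m (u + -(1 / 2)) := hc.comp (by fun_prop)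
    change unitAverage (fun u => truncPowDiff j m (u + 1 / 2) - truncPowDiff j m (u + -(1 / 2))) y
      = _
    rw [unitAverage_sub h1 h2,
      unitAverage_comp_add (truncPowDiff j m), unitAverage_comp_add (truncPowDiff j m), ih]
    rfl

theorem truncPowDiff_eq_sum (j m : ℕ) (y : ℝ) : truncPowDiff j m y =
    ∑ i ∈ Finset.range (j + 1), (-1) ^ (j - i) * j.choose i * truncPow m (y - j / 2 + i) := by
  have h : truncPowDiff j m y = (fwdDiff 1)^[j] (truncPow m) (y - j / 2) := by
    induction j generalizing y with
    | zero => simp [truncPowDiff]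
    | succ j ih =>
      rw [Function.iterate_succ_apply', fwdDiff]
      change truncPowDiff j m _ - truncPowDiff j m _ = _
      rw [ih, ih]
      push_cast
      congr 2 <;> ring_nf
  rw [h, fwdDiff_iter_eq_sum_shift]
  refine Finset.sum_congr rfl fun i _ => ?_
  simp

theorem tent_eq_truncPowDiff : tent = truncPowDiff 2 1 := by
  funext y
  simp only [truncPowDiff, truncPow, tent, Nat.factorial]
  rcases abs_cases y with ⟨h, h'⟩ | ⟨h, h'⟩ <;> rw [h] <;>
    simp only [max_def] <;> split_ifs <;> norm_num at * <;> linarith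

theorem spline_eq_truncPowDiff (n : ℕ) : spline n = truncPowDiff (n + 2) (n + 1) := by
  induction n with
  | zero => exact tent_eq_truncPowDiff
  | succ n ih => rw [spline_succ, ih, unitAverage_truncPowDiff _ (Nat.succ_ne_zero n)]

/-- The values from here to `spline_six_zero` decide which slabs fill more than half of the cube. At
the centre, indices `2` and `4` exceed `1 / 2`, while index `6` gives `151 / 315`. For odd index
parity forces a shift of at least `1 / 2`, and the values there are at most `1 / 2`. -/
theorem spline_one_zero : spline 1 0 = 3 / 4 := by
  rw [spline_eq_truncPowDiff, truncPowDiff_eq_sum]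
  norm_num [Finset.sum_range_succ, truncPow, Nat.choose, Nat.factorial]

theorem spline_one_half : spline 1 (1 / 2) = 1 / 2 := by
  rw [spline_eq_truncPowDiff, truncPowDiff_eq_sum]
  norm_num [Finset.sum_range_succ, truncPow, Nat.choose, Nat.factorial]

theorem spline_two_zero : spline 2 0 = 2 / 3 := by
  rw [spline_eq_truncPowDiff, truncPowDiff_eq_sum]
  norm_num [Finset.sum_range_succ, truncPow, Nat.choose, Nat.factorial]

theorem spline_two_one : spline 2 1 = 1 / 6 := by
  rw [spline_eq_truncPowDiff, truncPowDiff_eq_sum]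
  norm_num [Finset.sum_range_succ, truncPow, Nat.choose, Nat.factorial]

theorem spline_three_half : spline 3 (1 / 2) = 11 / 24 := by
  rw [spline_eq_truncPowDiff, truncPowDiff_eq_sum]
  norm_num [Finset.sum_range_succ, truncPow, Nat.choose, Nat.factorial]

theorem spline_four_zero : spline 4 0 = 11 / 20 := by
  rw [spline_eq_truncPowDiff, truncPowDiff_eq_sum]
  norm_num [Finset.sum_range_succ, truncPow, Nat.choose, Nat.factorial]

theorem spline_four_one : spline 4 1 = 13 / 60 := by
  rw [spline_eq_truncPowDiff, truncPowDiff_eq_sum]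
  norm_num [Finset.sum_range_succ, truncPow, Nat.choose, Nat.factorial]

theorem spline_five_half : spline 5 (1 / 2) = 151 / 360 := by
  rw [spline_eq_truncPowDiff, truncPowDiff_eq_sum]
  norm_num [Finset.sum_range_succ, truncPow, Nat.choose, Nat.factorial]

theorem spline_six_zero : spline 6 0 = 151 / 315 := by
  rw [spline_eq_truncPowDiff, truncPowDiff_eq_sum]
  norm_num [Finset.sum_range_succ, truncPow, Nat.choose, Nat.factorial]

theorem tent_sq_eq : (fun y => tent y ^ 2) = fun y => 2 * truncPowDiff 0 2 (y + 1) -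
    4 * truncPowDiff 0 1 y - 2 * truncPowDiff 0 2 (y + -1) := by
  funext y
  simp only [truncPowDiff, truncPow, tent, Nat.factorial]
  rcases abs_cases y with ⟨h, h'⟩ | ⟨h, h'⟩ <;> rw [h] <;>
    simp only [max_def] <;> split_ifs <;> norm_num at * <;> nlinarith

/-- The maximum is at `0`, where the expression of `tent ^ 2` by truncated powers gives exactly `1 /
2`. -/
theorem unitAverage_unitAverage_tent_sq_le (y : ℝ) :
    unitAverage (unitAverage fun y => tent y ^ 2) y ≤ 1 / 2 := by
  have hc : Continuous fun y => tent y ^ 2 := continuous_tent.pow 2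
  have ha : IsAntitoneInAbs fun y => tent y ^ 2 := fun x y h =>
    pow_le_pow_left₀ (tent_nonneg y) (isAntitoneInAbs_tent h) 2
  refine (((ha.unitAverage hc).unitAverage hc.unitAverage).le_zero y).trans (le_of_eq ?_)
  have hav : ∀ (j : ℕ), (unitAverage fun y => 2 * truncPowDiff j (j + 2) (y + 1) -
      4 * truncPowDiff j (j + 1) y - 2 * truncPowDiff j (j + 2) (y + -1)) =
      fun y => 2 * truncPowDiff (j + 1) (j + 3) (y + 1) -
      4 * truncPowDiff (j + 1) (j + 2) y - 2 * truncPowDiff (j + 1) (j + 3) (y + -1) := by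
    intro j
    funext y
    have h1 := continuous_truncPowDiff j (j + 2)
    have h2 := continuous_truncPowDiff j (j + 1)
    rw [unitAverage_sub (by fun_prop) (by fun_prop), unitAverage_sub (by fun_prop) (by fun_prop),
      unitAverage_const_mul, unitAverage_const_mul, unitAverage_const_mul,
      unitAverage_comp_add (truncPowDiff j (j + 2)), unitAverage_comp_add (truncPowDiff j (j + 2)),
      unitAverage_truncPowDiff _ (by omega), unitAverage_truncPowDiff _ (by omega)]
  rw [tent_sq_eq, hav 0, hav 1]
  norm_num [truncPowDiff, truncPow, Nat.factorial]

end

/-! ### Slab probabilities by integrating out variables of the cube. -/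

section

open MeasureTheory
open scoped ENNReal

/-- The uniform distribution on `[0, 1)`. -/
abbrev unitMeasure : Measure ℝ := volume.restrict (Set.Ico 0 1)

instance : IsProbabilityMeasure unitMeasure := ⟨by simp [unitMeasure]⟩

/-- The average of `φ` over the unit interval centred at `y`. -/
def lunitAverage (φ : ℝ → ℝ≥0∞) (y : ℝ) : ℝ≥0∞ := ∫⁻ u, φ (y + (u - 1 / 2)) ∂unitMeasure

theorem Measurable.lunitAverage {φ : ℝ → ℝ≥0∞} (hφ : Measurable φ) :
    Measurable (lunitAverage φ) := by
  unfold _root_.lunitAverage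
  exact Measurable.lintegral_prod_right' (f := fun z : ℝ × ℝ => φ (z.1 + (z.2 - 1 / 2)))
    (hφ.comp (by fun_prop))

/-- The symmetry that makes the sign of a coefficient `±1` irrelevant. The proof passes to the
closed interval, since the reflection does not preserve `[0, 1)`. -/
theorem lintegral_unitMeasure_reflect (f : ℝ → ℝ≥0∞) :
    ∫⁻ u, f (1 - u) ∂unitMeasure = ∫⁻ u, f u ∂unitMeasure := by
  have h1 : ∀ g : ℝ → ℝ≥0∞, ∫⁻ u, g u ∂unitMeasure = ∫⁻ u in Set.Icc 0 1, g u := fun g => by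
    rw [unitMeasure, restrict_Ico_eq_restrict_Icc]
  rw [h1, h1, ← lintegral_indicator measurableSet_Icc, ← lintegral_indicator measurableSet_Icc,
    ← lintegral_sub_left_eq_self _ (1 : ℝ)]
  refine lintegral_congr fun u => ?_
  have h2 : (1 - u ∈ Set.Icc (0 : ℝ) 1) ↔ u ∈ Set.Icc (0 : ℝ) 1 := by
    simp only [Set.mem_Icc]
    constructor <;> rintro ⟨h, h'⟩ <;> constructor <;> linarith
  by_cases h : u ∈ Set.Icc (0 : ℝ) 1
  · rw [Set.indicator_of_mem (h2.2 h), Set.indicator_of_mem h, sub_sub_cancel]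
  · rw [Set.indicator_of_notMem (fun h' => h (h2.1 h')), Set.indicator_of_notMem h]

theorem lintegral_add_mul_eq_lunitAverage (φ : ℝ → ℝ≥0∞) (y : ℝ) {ε : ℝ} (hε : ε = 1 ∨ ε = -1) :
    ∫⁻ u, φ (y + ε * (u - 1 / 2)) ∂unitMeasure = lunitAverage φ y := by
  rcases hε with rfl | rfl
  · simp [lunitAverage]
  · rw [lunitAverage, ← lintegral_unitMeasure_reflect]
    refine lintegral_congr fun u => ?_
    congr 1
    ring

theorem lunitAverage_ofReal {f : ℝ → ℝ} (hf : Continuous f) (h0 : ∀ x, 0 ≤ f x) :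
    lunitAverage (fun y => ENNReal.ofReal (f y)) = fun y => ENNReal.ofReal (unitAverage f y) := by
  funext y
  have hc : Continuous fun u => f (y + (u - 1 / 2)) := by fun_prop
  rw [lunitAverage, unitMeasure, restrict_Ico_eq_restrict_Ioc,
    ← ofReal_integral_eq_lintegral_ofReal]
  · congr 1
    rw [← intervalIntegral.integral_of_le zero_le_one, unitAverage]
    have := intervalIntegral.integral_comp_add_left (a := 0) (b := 1) f (y - 1 / 2)
    rw [show y - 1 / 2 + 0 = y - 1 / 2 by ring, show y - 1 / 2 + 1 = y + 1 / 2 by ring] at this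
    rw [← this]
    congr 1
    funext u
    congr 1
    ring
  · exact (hc.intervalIntegrable 0 1).1
  · exact Eventually.of_forall fun u => h0 _

/-- The indicator function of `[-1 / 2, 1 / 2)`. -/
def unitIndicator : ℝ → ℝ≥0∞ := (Set.Ico (-1 / 2 : ℝ) (1 / 2)).indicator 1

theorem measurable_unitIndicator : Measurable unitIndicator :=
  measurable_one.indicator measurableSet_Ico

theorem lunitAverage_unitIndicator :
    lunitAverage unitIndicator = fun y => ENNReal.ofReal (tent y) := by
  funext y
  have h1 : ∀ u, unitIndicator (y + (u - 1 / 2)) = (Set.Ico (-y) (1 - y)).indicator 1 u := by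
    intro u
    rw [unitIndicator, Set.indicator_apply, Set.indicator_apply]
    have : y + (u - 1 / 2) ∈ Set.Ico (-1 / 2 : ℝ) (1 / 2) ↔ u ∈ Set.Ico (-y) (1 - y) := by
      simp only [Set.mem_Ico]
      constructor <;> rintro ⟨h, h'⟩ <;> constructor <;> linarith
    rw [if_congr this rfl rfl]
    rfl
  simp_rw [lunitAverage, h1]
  rw [lintegral_indicator_one measurableSet_Ico, unitMeasure,
    Measure.restrict_apply measurableSet_Ico, Set.Ico_inter_Ico, Real.volume_Ico]
  rcases le_total 0 y with h | h
  · rw [tent, abs_of_nonneg h, sup_eq_right.2 (by linarith : -y ≤ 0),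
      inf_eq_left.2 (by linarith : 1 - y ≤ 1), sub_zero]
    rcases le_total 0 (1 - y) with h' | h'
    · rw [max_eq_right h']
    · rw [max_eq_left h', ENNReal.ofReal_of_nonpos h', ENNReal.ofReal_zero]
  · rw [tent, abs_of_nonpos h, sup_eq_left.2 (by linarith : 0 ≤ -y),
      inf_eq_right.2 (by linarith : 1 ≤ 1 - y), sub_neg_eq_add]
    rcases le_total 0 (1 + y) with h' | h'
    · rw [max_eq_right h']
    · rw [max_eq_left h', ENNReal.ofReal_of_nonpos h', ENNReal.ofReal_zero]

theorem iterate_lunitAverage_unitIndicator (n : ℕ) :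
    lunitAverage^[n + 1] unitIndicator = fun y => ENNReal.ofReal (spline n y) := by
  induction n with
  | zero => exact lunitAverage_unitIndicator
  | succ n ih =>
    rw [Function.iterate_succ_apply', ih, spline_succ,
      lunitAverage_ofReal (continuous_spline n) (spline_nonneg n)]

section cube

variable {ι : Type*} [DecidableEq ι]

/-- The affine form `κ + ∑ i ∈ A, v i * (x i - 1 / 2)`. -/
def centeredForm (κ : ℝ) (v : ι → ℝ) (A : Finset ι) (x : ι → ℝ) : ℝ :=
  κ + ∑ i ∈ A, v i * (x i - 1 / 2)

omit [DecidableEq ι] in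
theorem measurable_centeredForm (κ : ℝ) (v : ι → ℝ) (A : Finset ι) :
    Measurable (centeredForm κ v A) := by
  unfold centeredForm
  fun_prop

theorem centeredForm_update (κ : ℝ) (v : ι → ℝ) {A : Finset ι} {i : ι} (hi : i ∈ A) (x : ι → ℝ)
    (u : ℝ) : centeredForm κ v A (Function.update x i u) =
      centeredForm κ v (A.erase i) x + v i * (u - 1 / 2) := by
  unfold centeredForm
  rw [← Finset.add_sum_erase _ _ hi, Function.update_self,
    Finset.sum_congr rfl fun j hj => by rw [Function.update_of_ne (Finset.ne_of_mem_erase hj)]]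
  ring

/-- Integrating out a set of variables with coefficients `±1` amounts to iterated averaging. -/
theorem lmarginal_comp_centeredForm (κ : ℝ) (v : ι → ℝ) {φ : ℝ → ℝ≥0∞} (hφ : Measurable φ)
    {t A : Finset ι} (htA : t ⊆ A) (hv : ∀ i ∈ t, v i = 1 ∨ v i = -1) :
    (∫⋯∫⁻_t, (fun x => φ (centeredForm κ v A x)) ∂fun _ => unitMeasure) =
      fun x => (lunitAverage^[t.card] φ) (centeredForm κ v (A \ t) x) := by
  induction t using Finset.induction generalizing φ A with
  | empty => simp
  | insert i t hi ih =>
    have hiA : i ∈ A := htA (Finset.mem_insert_self i t)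
    have hm : Measurable fun x => φ (centeredForm κ v A x) :=
      hφ.comp (measurable_centeredForm κ v A)
    rw [lmarginal_insert' _ hm hi]
    have h1 : (fun x : ι → ℝ => ∫⁻ u, φ (centeredForm κ v A (Function.update x i u))
        ∂unitMeasure) = fun x => lunitAverage φ (centeredForm κ v (A.erase i) x) := by
      funext x
      simp_rw [centeredForm_update κ v hiA x]
      exact lintegral_add_mul_eq_lunitAverage φ _ (hv i (Finset.mem_insert_self i t))
    rw [h1, ih hφ.lunitAverage (fun j hj => Finset.mem_erase.2
      ⟨by rintro rfl; exact hi hj, htA (Finset.mem_insert_of_mem hj)⟩)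
      (fun j hj => hv j (Finset.mem_insert_of_mem hj)), Finset.card_insert_of_notMem hi,
      Function.iterate_succ_apply]
    have h2 : A.erase i \ t = A \ insert i t := by
      ext j
      simp only [Finset.mem_sdiff, Finset.mem_erase, Finset.mem_insert]
      tauto
    rw [h2]

theorem lmarginal_unitIndicator (κ : ℝ) (v : ι → ℝ) {t A : Finset ι} (htA : t ⊆ A)
    (hv : ∀ i ∈ t, v i = 1 ∨ v i = -1) {n : ℕ} (hn : t.card = n + 1) :
    (∫⋯∫⁻_t, (fun x => unitIndicator (centeredForm κ v A x)) ∂fun _ => unitMeasure) =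
      fun x => ENNReal.ofReal (spline n (centeredForm κ v (A \ t) x)) := by
  rw [lmarginal_comp_centeredForm κ v measurable_unitIndicator htA hv, hn,
    iterate_lunitAverage_unitIndicator]

variable [Fintype ι]

/-- The product measure on the unit cube `[0, 1)^ι`. -/
abbrev cubeMeasure (ι : Type*) [Fintype ι] : Measure (ι → ℝ) :=
  Measure.pi fun _ : ι => unitMeasure

/-- The marginal no longer depends on the variables in `t`, and integrating these again over a
probability measure changes nothing. The integral thus stays over the whole cube. -/
theorem lintegral_eq_lintegral_lmarginal {f : (ι → ℝ) → ℝ≥0∞} (hf : Measurable f)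
    (t : Finset ι) : ∫⁻ x, f x ∂cubeMeasure ι =
      ∫⁻ x, (∫⋯∫⁻_t, f ∂fun _ => unitMeasure) x ∂cubeMeasure ι := by
  refine lintegral_eq_of_lmarginal_eq t hf (hf.lmarginal _) ?_
  funext x
  rw [lmarginal.eq_def _ t (∫⋯∫⁻_t, f ∂fun _ => unitMeasure)]
  have : ∀ y, (∫⋯∫⁻_t, f ∂fun _ => unitMeasure) (Function.updateFinset x t y) =
      (∫⋯∫⁻_t, f ∂fun _ => unitMeasure) x := fun y =>
    lmarginal_congr (fun _ => unitMeasure) f fun i hi => by simp [Function.updateFinset, hi]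
  simp [this]

/-- The probability that `κ + ∑ v_i (x_i - 1 / 2)` lies in `[-1 / 2, 1 / 2)`. -/
theorem lintegral_unitIndicator (κ : ℝ) (v : ι → ℝ) {t : Finset ι}
    (hv : ∀ i ∈ t, v i = 1 ∨ v i = -1) {n : ℕ} (hn : t.card = n + 1) :
    ∫⁻ x, unitIndicator (centeredForm κ v t x) ∂cubeMeasure ι = ENNReal.ofReal (spline n κ) := by
  have hm : Measurable fun x => unitIndicator (centeredForm κ v t x) :=
    measurable_unitIndicator.comp (measurable_centeredForm κ v t)
  rw [lintegral_eq_lintegral_lmarginal hm t, lmarginal_unitIndicator κ v subset_rfl hv hn]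
  simp [centeredForm]

end cube

end

/-! ### Upper bounds for intersections of two slabs. -/

section

open MeasureTheory
open scoped ENNReal

section cube

variable {ι : Type*} [DecidableEq ι]

theorem lmarginal_mul_of_forall {t : Finset ι} {f g : (ι → ℝ) → ℝ≥0∞} (hf : Measurable f)
    (hg : ∀ x y, (∀ i ∉ t, x i = y i) → g x = g y) :
    (∫⋯∫⁻_t, (fun x => f x * g x) ∂fun _ => unitMeasure) =
      fun x => (∫⋯∫⁻_t, f ∂fun _ => unitMeasure) x * g x := by
  funext x
  unfold lmarginal
  have hm : Measurable fun y => f (Function.updateFinset x t y) :=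
    hf.comp measurable_updateFinset
  rw [← lintegral_mul_const _ hm]
  refine lintegral_congr fun y => ?_
  change f _ * g _ = _
  rw [hg (Function.updateFinset x t y) x fun i hi => by simp [Function.updateFinset, hi]]

omit [DecidableEq ι] in
theorem centeredForm_congr (κ : ℝ) (v : ι → ℝ) {A : Finset ι} {x y : ι → ℝ}
    (h : ∀ i ∈ A, x i = y i) : centeredForm κ v A x = centeredForm κ v A y := by
  unfold centeredForm
  rw [Finset.sum_congr rfl fun i hi => by rw [h i hi]]

variable [Fintype ι]

theorem lintegral_mul_of_forall {t : Finset ι} {f g : (ι → ℝ) → ℝ≥0∞} (hf : Measurable f)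
    (hgm : Measurable g) (hg : ∀ x y, (∀ i ∉ t, x i = y i) → g x = g y) :
    ∫⁻ x, f x * g x ∂cubeMeasure ι =
      ∫⁻ x, (∫⋯∫⁻_t, f ∂fun _ => unitMeasure) x * g x ∂cubeMeasure ι := by
  have hm : Measurable fun x => f x * g x := hf.mul hgm
  rw [lintegral_eq_lintegral_lmarginal hm t, lmarginal_mul_of_forall hf hg]

/-- Integrating out just two of the variables already gives a bound that is uniform in the others.
-/
theorem lintegral_centeredForm_le (κ : ℝ) (v : ι → ℝ) {A : Finset ι} (hA : 2 ≤ A.card)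
    (hv : ∀ i ∈ A, v i = 1 ∨ v i = -1) {f : ℝ → ℝ} (hf : Continuous f) (h0 : ∀ y, 0 ≤ f y)
    {c : ℝ} (hc : ∀ y, unitAverage (unitAverage f) y ≤ c) :
    ∫⁻ x, ENNReal.ofReal (f (centeredForm κ v A x)) ∂cubeMeasure ι ≤ ENNReal.ofReal c := by
  obtain ⟨t, htA, ht⟩ := Finset.exists_subset_card_eq hA
  have hφ : Measurable fun y => ENNReal.ofReal (f y) := hf.measurable.ennreal_ofReal
  have hm : Measurable fun x => ENNReal.ofReal (f (centeredForm κ v A x)) :=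
    hφ.comp (measurable_centeredForm κ v A)
  rw [lintegral_eq_lintegral_lmarginal hm t, lmarginal_comp_centeredForm κ v hφ htA
    (fun i hi => hv i (htA hi)), ht]
  have h2 : lunitAverage^[2] (fun y => ENNReal.ofReal (f y)) =
      fun y => ENNReal.ofReal (unitAverage (unitAverage f) y) := by
    change lunitAverage (lunitAverage _) = _
    rw [lunitAverage_ofReal hf h0, lunitAverage_ofReal hf.unitAverage (unitAverage_nonneg h0)]
  rw [h2]
  calc _ ≤ ∫⁻ _, ENNReal.ofReal c ∂cubeMeasure ι :=
        lintegral_mono fun x => ENNReal.ofReal_le_ofReal (hc _)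
    _ = _ := by simp

variable (κ κ' : ℝ) (v w : ι → ℝ) {A B : Finset ι}

/-- Two slabs with incomparable supports. -/
theorem lintegral_unitIndicator_mul_le_of_notMem (hA : 3 ≤ A.card) (hB : 3 ≤ B.card)
    (hv : ∀ i ∈ A, v i = 1 ∨ v i = -1) (hw : ∀ i ∈ B, w i = 1 ∨ w i = -1) {a b : ι}
    (ha : a ∈ A) (haB : a ∉ B) (hb : b ∈ B) (hbA : b ∉ A) :
    ∫⁻ x, unitIndicator (centeredForm κ v A x) * unitIndicator (centeredForm κ' w B x)
      ∂cubeMeasure ι ≤ ENNReal.ofReal (1 / 2) := by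
  have hm1 : Measurable fun x => unitIndicator (centeredForm κ v A x) :=
    measurable_unitIndicator.comp (measurable_centeredForm κ v A)
  have hm2 : Measurable fun x => unitIndicator (centeredForm κ' w B x) :=
    measurable_unitIndicator.comp (measurable_centeredForm κ' w B)
  have hm3 : Measurable fun x => ENNReal.ofReal (spline 0 (centeredForm κ v (A \ {a}) x)) :=
    ((continuous_spline 0).measurable.comp (measurable_centeredForm κ v _)).ennreal_ofReal
  -- Only the first slab sees the variable `a`, and only the second sees `b`. Integrating them out
  -- replaces each indicator by a tent function; `2 s t ≤ s² + t²` then decouples the two factors.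
  rw [lintegral_mul_of_forall (t := {a}) hm1 hm2 (fun x y h => by
      rw [centeredForm_congr κ' w fun i hi => h i (by
        rw [Finset.mem_singleton]; rintro rfl; exact haB hi)]),
    lmarginal_unitIndicator κ v (Finset.singleton_subset_iff.2 ha)
      (fun i hi => hv i (by rw [Finset.mem_singleton.1 hi]; exact ha)) (n := 0) (by simp)]
  simp_rw [mul_comm (ENNReal.ofReal _)]
  have h1 : ∀ x y : ι → ℝ, (∀ i ∉ ({b} : Finset ι), x i = y i) →
      ENNReal.ofReal (spline 0 (centeredForm κ v (A \ {a}) x)) =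
      ENNReal.ofReal (spline 0 (centeredForm κ v (A \ {a}) y)) := fun x y h => by
    rw [centeredForm_congr κ v fun i hi => h i (by
      rw [Finset.mem_singleton]; rintro rfl; exact hbA (Finset.mem_sdiff.1 hi).1)]
  rw [lintegral_mul_of_forall hm2 hm3 h1,
    lmarginal_unitIndicator κ' w (Finset.singleton_subset_iff.2 hb)
      (fun i hi => hw i (by rw [Finset.mem_singleton.1 hi]; exact hb)) (n := 0) (by simp)]
  have hsq : Continuous fun y => tent y ^ 2 := continuous_tent.pow 2
  have hbound : ∀ (κ : ℝ) (v : ι → ℝ) {A : Finset ι} (a : ι), 3 ≤ A.card →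
      (∀ i ∈ A, v i = 1 ∨ v i = -1) → a ∈ A →
      ∫⁻ x, ENNReal.ofReal (tent (centeredForm κ v (A \ {a}) x) ^ 2) ∂cubeMeasure ι ≤
        ENNReal.ofReal (1 / 2) := by
    intro κ v A a hA hv ha
    refine lintegral_centeredForm_le κ v ?_ (fun i hi => hv i (Finset.mem_sdiff.1 hi).1) hsq
      (fun y => sq_nonneg _) unitAverage_unitAverage_tent_sq_le
    rw [Finset.card_sdiff_of_subset (Finset.singleton_subset_iff.2 ha), Finset.card_singleton]
    omega
  have hm4 : Measurable fun x => ENNReal.ofReal (tent (centeredForm κ v (A \ {a}) x) ^ 2) :=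
    (hsq.measurable.comp (measurable_centeredForm κ v _)).ennreal_ofReal
  have hm5 : Measurable fun x => ENNReal.ofReal (tent (centeredForm κ' w (B \ {b}) x) ^ 2) :=
    (hsq.measurable.comp (measurable_centeredForm κ' w _)).ennreal_ofReal
  have hm6 : Measurable fun x => ENNReal.ofReal (tent (centeredForm κ v (A \ {a}) x) ^ 2) +
      ENNReal.ofReal (tent (centeredForm κ' w (B \ {b}) x) ^ 2) := hm4.add hm5
  calc ∫⁻ x, ENNReal.ofReal (spline 0 (centeredForm κ' w (B \ {b}) x)) *
        ENNReal.ofReal (spline 0 (centeredForm κ v (A \ {a}) x)) ∂cubeMeasure ι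
      ≤ ∫⁻ x, ENNReal.ofReal (1 / 2) * (ENNReal.ofReal (tent (centeredForm κ v (A \ {a}) x) ^ 2) +
          ENNReal.ofReal (tent (centeredForm κ' w (B \ {b}) x) ^ 2)) ∂cubeMeasure ι := by
        refine lintegral_mono fun x => ?_
        have h2 : spline 0 = tent := rfl
        rw [h2, ← ENNReal.ofReal_mul (tent_nonneg _), ← ENNReal.ofReal_add (sq_nonneg _)
          (sq_nonneg _), ← ENNReal.ofReal_mul (by norm_num)]
        refine ENNReal.ofReal_le_ofReal ?_
        nlinarith [sq_nonneg (tent (centeredForm κ v (A \ {a}) x) -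
          tent (centeredForm κ' w (B \ {b}) x))]
    _ = ENNReal.ofReal (1 / 2) *
          (∫⁻ x, ENNReal.ofReal (tent (centeredForm κ v (A \ {a}) x) ^ 2) ∂cubeMeasure ι +
          ∫⁻ x, ENNReal.ofReal (tent (centeredForm κ' w (B \ {b}) x) ^ 2) ∂cubeMeasure ι) := by
        rw [lintegral_const_mul _ hm6, lintegral_add_left hm4]
    _ ≤ ENNReal.ofReal (1 / 2) * (ENNReal.ofReal (1 / 2) + ENNReal.ofReal (1 / 2)) := by
        gcongr
        · exact hbound κ v a hA hv ha
        · exact hbound κ' w b hB hw hb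
    _ = ENNReal.ofReal (1 / 2) := by
        rw [← ENNReal.ofReal_add (by norm_num) (by norm_num), ← ENNReal.ofReal_mul (by norm_num)]
        norm_num

theorem lintegral_unitIndicator_le_two_thirds (hA : 3 ≤ A.card)
    (hv : ∀ i ∈ A, v i = 1 ∨ v i = -1) :
    ∫⁻ x, unitIndicator (centeredForm κ v A x) ∂cubeMeasure ι ≤ ENNReal.ofReal (2 / 3) := by
  obtain ⟨n, hn⟩ : ∃ n, A.card = n + 1 := ⟨A.card - 1, by omega⟩
  rw [lintegral_unitIndicator κ v hv hn, ← spline_two_zero]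
  exact ENNReal.ofReal_le_ofReal (spline_le_of_le (by omega) _)

/-- Two slabs, one of which involves at least two variables that the other one does not. -/
theorem lintegral_unitIndicator_mul_le_of_card (hA : 3 ≤ A.card) (hB : 2 ≤ (B \ A).card)
    (hv : ∀ i ∈ A, v i = 1 ∨ v i = -1) (hw : ∀ i ∈ B, w i = 1 ∨ w i = -1) :
    ∫⁻ x, unitIndicator (centeredForm κ' w B x) * unitIndicator (centeredForm κ v A x)
      ∂cubeMeasure ι ≤ ENNReal.ofReal (1 / 2) := by
  have hm1 : Measurable fun x => unitIndicator (centeredForm κ v A x) :=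
    measurable_unitIndicator.comp (measurable_centeredForm κ v A)
  have hm2 : Measurable fun x => unitIndicator (centeredForm κ' w B x) :=
    measurable_unitIndicator.comp (measurable_centeredForm κ' w B)
  obtain ⟨n, hn⟩ : ∃ n, (B \ A).card = n + 1 := ⟨(B \ A).card - 1, by omega⟩
  rw [lintegral_mul_of_forall (t := B \ A) hm2 hm1 (fun x y h => by
      rw [centeredForm_congr κ v fun i hi => h i (by simp [hi])]),
    lmarginal_unitIndicator κ' w Finset.sdiff_subset
      (fun i hi => hw i (Finset.mem_sdiff.1 hi).1) hn]
  -- Given the variables in `A`, at least two further ones are averaged, so the conditional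
  -- probability is at most `spline 1 0 = 3 / 4`. The other slab contributes at most `2 / 3`, and
  -- the product is exactly `1 / 2`.
  calc _ ≤ ∫⁻ x, ENNReal.ofReal (3 / 4) * unitIndicator (centeredForm κ v A x) ∂cubeMeasure ι := by
        refine lintegral_mono fun x => ?_
        rw [← spline_one_zero]
        exact mul_le_mul_left (ENNReal.ofReal_le_ofReal (spline_le_of_le (by omega) _)) _
    _ ≤ ENNReal.ofReal (3 / 4) * ENNReal.ofReal (2 / 3) := by
        rw [lintegral_const_mul _ hm1]
        gcongr
        exact lintegral_unitIndicator_le_two_thirds κ v hA hv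
    _ = _ := by
        rw [← ENNReal.ofReal_mul (by norm_num)]
        norm_num

end cube

/-- The slabs `0 ≤ ⟨x, v⟩ < 1`, with `v` of entries `±1`, that fill more than half of the unit
cube: here `n + 1` is the number of entries of `v`, and `s` is their sum. -/
theorem of_half_lt_spline {n : ℕ} {s : ℤ} (hs : (s - (n + 1)) % 2 = 0)
    (h : 1 / 2 < spline n ((s - 1) / 2)) : s = 1 ∧ (n = 0 ∨ n = 2 ∨ n = 4) := by
  have hn : n ≤ 5 := by
    by_contra hn
    have := spline_le_of_le (by omega : 6 ≤ n) (((s : ℝ) - 1) / 2)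
    rw [spline_six_zero] at this
    linarith
  have hle : ∀ c : ℕ, (c : ℤ) ≤ |s - 1| → spline n (((s : ℝ) - 1) / 2) ≤ spline n (c / 2) := by
    intro c hc
    apply isAntitoneInAbs_spline n
    rw [abs_div, abs_div, abs_of_nonneg (Nat.cast_nonneg c : (0 : ℝ) ≤ c)]
    have : (c : ℝ) ≤ |(s : ℝ) - 1| := by exact_mod_cast hc
    gcongr
  have h1 : s ≠ 1 → (1 : ℤ) ≤ |s - 1| := fun hs => Int.one_le_abs (sub_ne_zero.2 hs)
  -- For even `n` the sum `s` is odd, so the shift jumps from `0` to at least `1`. For odd `n` the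
  -- value `s = 1` is impossible.
  have h2 : n % 2 = 0 → s ≠ 1 → (2 : ℤ) ≤ |s - 1| := by
    intro hn hs'
    rw [le_abs]
    omega
  have h0 : spline 0 1 = 0 := by simp [spline, tent]
  interval_cases n
  · refine ⟨by_contra fun hs' => ?_, by simp⟩
    have := hle 2 (h2 (by norm_num) hs')
    norm_num [h0] at this
    linarith
  · have := hle 1 (h1 (by omega))
    norm_num at this
    have := spline_one_half
    linarith
  · refine ⟨by_contra fun hs' => ?_, by simp⟩
    have := hle 2 (h2 (by norm_num) hs')
    norm_num [spline_two_one] at this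
    linarith
  · have := hle 1 (h1 (by omega))
    norm_num at this
    have := spline_three_half
    linarith
  · refine ⟨by_contra fun hs' => ?_, by simp⟩
    have := hle 2 (h2 (by norm_num) hs')
    norm_num [spline_four_one] at this
    linarith
  · have := hle 1 (h1 (by omega))
    norm_num at this
    have := spline_five_half
    linarith

end

/-! ### Slabs given by integer vectors with entries `0, ±1`. -/

section

open MeasureTheory
open scoped ENNReal

section slab

variable {ι : Type*} [Fintype ι]

/-- The region `0 ≤ ⟨y, w⟩ < 1`. -/
def slab (w : ι → ℤ) : Set (ι → ℝ) :=
  {y | 0 ≤ y ⬝ᵥ (fun i => (w i : ℝ)) ∧ y ⬝ᵥ (fun i => (w i : ℝ)) < 1}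

theorem measurableSet_slab (w : ι → ℤ) : MeasurableSet (slab w) := by
  unfold slab dotProduct
  measurability

theorem cubeMeasure_eq_restrict :
    cubeMeasure ι = volume.restrict (Set.univ.pi fun _ => Set.Ico (0 : ℝ) 1) := by
  rw [volume_pi, Measure.restrict_pi_pi]

variable [DecidableEq ι]

/-- The centre of the slab `0 ≤ ⟨y, w⟩ < 1` relative to the one of the unit cube. -/
def slabShift (w : ι → ℤ) : ℝ := (((∑ i, w i : ℤ) : ℝ) - 1) / 2

/-- The support of an integer vector. -/
def slabSupport (w : ι → ℤ) : Finset ι := Finset.univ.filter fun i => w i ≠ 0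

omit [DecidableEq ι] in
theorem mem_slabSupport {w : ι → ℤ} {i : ι} : i ∈ slabSupport w ↔ w i ≠ 0 := by
  simp [slabSupport]

omit [DecidableEq ι] in
theorem centeredForm_slabShift (w : ι → ℤ) (y : ι → ℝ) :
    centeredForm (slabShift w) (fun i => (w i : ℝ)) (slabSupport w) y =
      y ⬝ᵥ (fun i => (w i : ℝ)) - 1 / 2 := by
  have h : ∑ i ∈ slabSupport w, (w i : ℝ) * (y i - 1 / 2) = ∑ i, (w i : ℝ) * (y i - 1 / 2) := by
    refine Finset.sum_subset (Finset.subset_univ _) fun i _ hi => ?_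
    rw [mem_slabSupport, not_not] at hi
    simp [hi]
  rw [centeredForm, h, slabShift, dotProduct]
  simp only [mul_sub, Finset.sum_sub_distrib, ← Finset.sum_mul]
  push_cast
  simp only [mul_comm (y _)]
  ring

omit [DecidableEq ι] in
theorem unitIndicator_centeredForm_slabShift (w : ι → ℤ) (y : ι → ℝ) :
    unitIndicator (centeredForm (slabShift w) (fun i => (w i : ℝ)) (slabSupport w) y) =
      (slab w).indicator 1 y := by
  rw [centeredForm_slabShift, unitIndicator]
  have : y ⬝ᵥ (fun i => (w i : ℝ)) - 1 / 2 ∈ Set.Ico (-1 / 2 : ℝ) (1 / 2) ↔ y ∈ slab w := by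
    simp only [Set.mem_Ico, slab, Set.mem_ofPred_eq]
    constructor <;> rintro ⟨h1, h2⟩ <;> constructor <;> linarith
  by_cases h : y ∈ slab w
  · rw [Set.indicator_of_mem (this.2 h), Set.indicator_of_mem h]; rfl
  · rw [Set.indicator_of_notMem (this.not.2 h), Set.indicator_of_notMem h]

omit [DecidableEq ι] in
theorem cubeMeasure_slab (w : ι → ℤ) : cubeMeasure ι (slab w) =
    ∫⁻ y, unitIndicator (centeredForm (slabShift w) (fun i => (w i : ℝ)) (slabSupport w) y)
      ∂cubeMeasure ι := by
  simp_rw [unitIndicator_centeredForm_slabShift]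
  rw [lintegral_indicator_one (measurableSet_slab w)]

omit [DecidableEq ι] in
theorem cubeMeasure_slab_inter_slab (w w' : ι → ℤ) : cubeMeasure ι (slab w ∩ slab w') =
    ∫⁻ y, unitIndicator (centeredForm (slabShift w) (fun i => (w i : ℝ)) (slabSupport w) y) *
      unitIndicator (centeredForm (slabShift w') (fun i => (w' i : ℝ)) (slabSupport w') y)
      ∂cubeMeasure ι := by
  simp_rw [unitIndicator_centeredForm_slabShift, ← Set.inter_indicator_mul]
  have : (fun x : ι → ℝ => (1 : (ι → ℝ) → ℝ≥0∞) x * (1 : (ι → ℝ) → ℝ≥0∞) x) = 1 := by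
    funext; simp
  rw [this, lintegral_indicator_one ((measurableSet_slab w).inter (measurableSet_slab w'))]

omit [DecidableEq ι] in
theorem cast_eq_one_or {w : ι → ℤ} (hw : ∀ i, |w i| ≤ 1) :
    ∀ i ∈ slabSupport w, (w i : ℝ) = 1 ∨ (w i : ℝ) = -1 := by
  intro i hi
  have h1 := abs_le.1 (hw i)
  have h2 := mem_slabSupport.1 hi
  have : w i = 1 ∨ w i = -1 := by omega
  rcases this with h | h <;> simp [h]

theorem cubeMeasure_slab_eq_spline {w : ι → ℤ} (hw : ∀ i, |w i| ≤ 1) {n : ℕ}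
    (hn : (slabSupport w).card = n + 1) :
    cubeMeasure ι (slab w) = ENNReal.ofReal (spline n (slabShift w)) := by
  rw [cubeMeasure_slab, lintegral_unitIndicator _ _ (cast_eq_one_or hw) hn]

omit [DecidableEq ι] in
theorem sum_emod_two_eq {w : ι → ℤ} (hw : ∀ i, |w i| ≤ 1) :
    (∑ i, w i - ((slabSupport w).card : ℤ)) % 2 = 0 := by
  have h : ∑ i, w i = ∑ i ∈ slabSupport w, w i := by
    symm
    refine Finset.sum_subset (Finset.subset_univ _) fun i _ hi => ?_
    rwa [mem_slabSupport, not_not] at hi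
  rw [h, Finset.card_eq_sum_ones, Nat.cast_sum, ← Finset.sum_sub_distrib]
  refine Int.emod_eq_zero_of_dvd (Finset.dvd_sum fun i hi => ?_)
  have h1 := abs_le.1 (hw i)
  have h2 := mem_slabSupport.1 hi
  push_cast
  omega

/-- The slabs that fill more than half of the unit cube. -/
theorem of_half_lt_cubeMeasure_slab {w : ι → ℤ} (hw : ∀ i, |w i| ≤ 1) (h0 : w ≠ 0)
    (h : ENNReal.ofReal (1 / 2) < cubeMeasure ι (slab w)) :
    ∑ i, w i = 1 ∧ ((slabSupport w).card = 1 ∨ (slabSupport w).card = 3 ∨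
      (slabSupport w).card = 5) := by
  have hc : (slabSupport w).card ≠ 0 := by
    rw [Finset.card_ne_zero]
    obtain ⟨i, hi⟩ := Function.ne_iff.1 h0
    exact ⟨i, mem_slabSupport.2 hi⟩
  obtain ⟨n, hn⟩ := Nat.exists_eq_succ_of_ne_zero hc
  rw [cubeMeasure_slab_eq_spline hw hn] at h
  have h1 := (ENNReal.ofReal_lt_ofReal_iff_of_nonneg (by norm_num)).1 h
  have h2 := sum_emod_two_eq hw
  rw [hn] at h2
  obtain ⟨h3, h4⟩ := of_half_lt_spline (n := n) (by push_cast at h2; exact h2) h1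
  exact ⟨h3, by omega⟩

/-- Two slabs that meet in more than half of the unit cube. -/
theorem exists_of_half_lt_cubeMeasure_slab_inter {w w' : ι → ℤ} (hw : ∀ i, |w i| ≤ 1)
    (hw' : ∀ i, |w' i| ≤ 1) (hs : ∑ i, w i = 1) (hs' : ∑ i, w' i = 1)
    (hc : (slabSupport w).card = 3 ∨ (slabSupport w).card = 5)
    (hc' : (slabSupport w').card = 3 ∨ (slabSupport w').card = 5) (hne : w ≠ w')
    (h : ENNReal.ofReal (1 / 2) < cubeMeasure ι (slab w ∩ slab w')) :
    ∃ a b, a ≠ b ∧ w a ≠ 0 ∧ w' a = w a ∧ w b ≠ 0 ∧ w' b = - w b := by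
  have hcomp : slabSupport w ⊆ slabSupport w' ∨ slabSupport w' ⊆ slabSupport w := by
    by_contra! hcon
    obtain ⟨⟨a, ha, ha'⟩, ⟨b, hb, hb'⟩⟩ :=
      And.intro (Finset.not_subset.1 hcon.1) (Finset.not_subset.1 hcon.2)
    rw [cubeMeasure_slab_inter_slab] at h
    exact h.not_ge (lintegral_unitIndicator_mul_le_of_notMem _ _ _ _ (by omega) (by omega)
      (cast_eq_one_or hw) (cast_eq_one_or hw') ha ha' hb hb')
  -- The sizes are `3` or `5`, so a strict inclusion leaves at least two extra indices, and the
  -- bound by `3 / 4 * 2 / 3` applies.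
  have heq : slabSupport w = slabSupport w' := by
    rcases hcomp with hsub | hsub
    · by_contra hne
      have := Finset.card_lt_card (hsub.ssubset_of_ne hne)
      have h2 := Finset.card_sdiff_of_subset hsub
      rw [Set.inter_comm, cubeMeasure_slab_inter_slab] at h
      exact h.not_ge (lintegral_unitIndicator_mul_le_of_card _ _ _ _ (by omega) (by omega)
        (cast_eq_one_or hw) (cast_eq_one_or hw'))
    · by_contra hne
      have := Finset.card_lt_card (hsub.ssubset_of_ne (Ne.symm hne))
      have h2 := Finset.card_sdiff_of_subset hsub
      rw [cubeMeasure_slab_inter_slab] at h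
      exact h.not_ge (lintegral_unitIndicator_mul_le_of_card _ _ _ _ (by omega) (by omega)
        (cast_eq_one_or hw') (cast_eq_one_or hw))
  have hdich : ∀ i, w i ≠ 0 → w' i = w i ∨ w' i = - w i := by
    intro i hi
    have h1 := abs_le.1 (hw i)
    have h2 := abs_le.1 (hw' i)
    have h3 : w' i ≠ 0 := mem_slabSupport.1 (heq ▸ mem_slabSupport.2 hi)
    omega
  have hzero : ∀ i, w i = 0 → w' i = 0 := by
    intro i hi
    by_contra h3
    exact mem_slabSupport.1 (heq.symm ▸ mem_slabSupport.2 h3) hi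
  obtain ⟨b, hb⟩ := Function.ne_iff.1 hne
  have hb0 : w b ≠ 0 := fun h0 => hb (by rw [h0, hzero b h0])
  -- The vectors cannot be opposite everywhere, since both have sum `1`.
  have ha : ∃ a, w a ≠ 0 ∧ w' a = w a := by
    by_contra! hcon
    have : ∀ i, w' i = - w i := fun i => by
      by_cases hi : w i = 0
      · rw [hi, hzero i hi, neg_zero]
      · exact (hdich i hi).resolve_left (hcon i hi)
    rw [Finset.sum_congr rfl fun i _ => this i, Finset.sum_neg_distrib, hs] at hs'
    norm_num at hs'
  obtain ⟨a, ha0, ha⟩ := ha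
  exact ⟨a, b, fun hab => hb (hab ▸ ha.symm), ha0, ha, hb0,
    (hdich b hb0).resolve_left fun h => hb h.symm⟩

end slab

/-! ### Minors of the generators when the volume exceeds one half. -/

namespace ToricCone

variable {d : ℕ} (σ : ToricCone d)

/-- The square matrix whose rows are a family of minimal generators. -/
def rowMatrix (f : Fin d → Fin σ.n) : Matrix (Fin d) (Fin d) ℤ := Matrix.of fun i => σ.v (f i)

theorem rowMatrix_map_mulVec (f : Fin d → Fin σ.n) (x : Fin d → ℝ) (i : Fin d) :
    ((σ.rowMatrix f).map (Int.cast : ℤ → ℝ)).mulVec x i = x ⬝ᵥ latticeVec (σ.v (f i)) := by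
  rw [dotProduct_comm]
  rfl

/-- The pairings with `d` independent generators serve as linear coordinates: they carry the box
into the unit cube, at the cost of the factor `1 / |det|`. The set `T` records what the remaining
generators impose. -/
theorem volume_box_le (f : Fin d → Fin σ.n) (hf : (σ.rowMatrix f).det ≠ 0)
    {T : Set (Fin d → ℝ)} (hT : ∀ x ∈ σ.box,
      (fun i => x ⬝ᵥ latticeVec (σ.v (f i))) ∈ T) :
    volume σ.box ≤ ENNReal.ofReal |(((σ.rowMatrix f).det : ℝ))⁻¹| * cubeMeasure (Fin d) T := by
  set N := (σ.rowMatrix f).map (Int.cast : ℤ → ℝ) with hN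
  have hdet : LinearMap.det (Matrix.toLin' N) = ((σ.rowMatrix f).det : ℝ) := by
    rw [LinearMap.det_toLin', hN]
    exact ((Int.castRingHom ℝ).map_det (σ.rowMatrix f)).symm
  have h0 : LinearMap.det (Matrix.toLin' N) ≠ 0 := by rw [hdet]; exact_mod_cast hf
  have hsub : σ.box ⊆ Matrix.toLin' N ⁻¹' (T ∩ Set.univ.pi fun _ => Set.Ico (0 : ℝ) 1) := by
    intro x hx
    have : Matrix.toLin' N x = fun i => x ⬝ᵥ latticeVec (σ.v (f i)) :=
      funext fun i => σ.rowMatrix_map_mulVec f x i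
    rw [Set.mem_preimage, this]
    exact ⟨hT x hx, fun i _ => hx (f i)⟩
  refine (measure_mono hsub).trans ?_
  rw [Measure.addHaar_preimage_linearMap _ h0, hdet]
  refine mul_le_mul_right ?_ _
  rw [cubeMeasure_eq_restrict]
  exact Measure.le_restrict_apply _ _

theorem abs_det_rowMatrix_le (h : 1 / 2 < σ.boxVolume) (f : Fin d → Fin σ.n) :
    |(σ.rowMatrix f).det| ≤ 1 := by
  by_cases hf : (σ.rowMatrix f).det = 0
  · simp [hf]
  have h1 := σ.volume_box_le f hf (T := Set.univ) (by simp)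
  rw [measure_univ, mul_one] at h1
  have h2 : σ.boxVolume ≤ |((σ.rowMatrix f).det : ℝ)⁻¹| :=
    ENNReal.toReal_le_of_le_ofReal (abs_nonneg _) h1
  by_contra! hlt
  have h3 : (2 : ℝ) ≤ |((σ.rowMatrix f).det : ℝ)| := by exact_mod_cast hlt
  rw [abs_inv] at h2
  have := inv_anti₀ (by norm_num) h3
  linarith

theorem exists_det_rowMatrix_ne_zero : ∃ f : Fin d → Fin σ.n, (σ.rowMatrix f).det ≠ 0 := by
  obtain ⟨s, hs, hspan, hli⟩ :=
    exists_linearIndependent ℝ (Set.range fun i => latticeVec (σ.v i))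
  rw [σ.span_eq_top] at hspan
  let b : Module.Basis s ℝ (Fin d → ℝ) := Module.Basis.mk hli (by
    rw [Subtype.range_coe]; exact hspan.ge)
  let e : Fin d ≃ s := (Pi.basisFun ℝ (Fin d)).indexEquiv b
  choose f hf using fun i => hs (e i).2
  refine ⟨f, fun h0 => ?_⟩
  have hli' : LinearIndependent ℝ ((σ.rowMatrix f).map (Int.cast : ℤ → ℝ)).row := by
    have : ((σ.rowMatrix f).map (Int.cast : ℤ → ℝ)).row = fun i => ((e i : s) : Fin d → ℝ) :=
      funext fun i => hf i
    rw [this]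
    exact hli.comp e e.injective
  have := (Matrix.isUnit_iff_isUnit_det _).1 (Matrix.linearIndependent_rows_iff_isUnit.1 hli')
  have h1 : ((σ.rowMatrix f).map (Int.cast : ℤ → ℝ)).det = ((σ.rowMatrix f).det : ℝ) :=
    ((Int.castRingHom ℝ).map_det (σ.rowMatrix f)).symm
  rw [h1, h0] at this
  simp at this

theorem v_injective : Function.Injective σ.v := by
  intro i j hij
  by_contra hne
  refine σ.notMem_hull i (PointedCone.subset_hull ⟨j, fun h => hne h.symm, ?_⟩)
  simp only [hij]

/-- The coordinates of a minimal generator with respect to a basis of minimal generators. -/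
def coord (f : Fin d → Fin σ.n) (j : Fin σ.n) : Fin d → ℤ :=
  Matrix.vecMul (σ.v j) (σ.rowMatrix f)⁻¹

variable {σ}

theorem sum_coord_smul {f : Fin d → Fin σ.n} (hf : IsUnit (σ.rowMatrix f).det) (j : Fin σ.n) :
    ∑ i, σ.coord f j i • σ.v (f i) = σ.v j := by
  have : Matrix.vecMul (σ.coord f j) (σ.rowMatrix f) = σ.v j := by
    rw [coord, Matrix.vecMul_vecMul, Matrix.nonsing_inv_mul _ hf, Matrix.vecMul_one]
  rw [← this, Matrix.vecMul_eq_sum]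
  rfl

theorem dotProduct_latticeVec_eq {f : Fin d → Fin σ.n} (hf : IsUnit (σ.rowMatrix f).det)
    (j : Fin σ.n) (x : Fin d → ℝ) : x ⬝ᵥ latticeVec (σ.v j) =
      (fun i => x ⬝ᵥ latticeVec (σ.v (f i))) ⬝ᵥ (fun i => (σ.coord f j i : ℝ)) := by
  have : latticeVec (σ.v j) = ∑ i, (σ.coord f j i : ℝ) • latticeVec (σ.v (f i)) := by
    funext l
    simp only [latticeVec]
    rw [← sum_coord_smul hf j]
    simp [Finset.sum_apply, latticeVec]
  rw [this, dotProduct_sum]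
  simp only [dotProduct_smul, smul_eq_mul]
  exact Finset.sum_congr rfl fun i _ => mul_comm _ _

/-- Cramer's rule. The coefficients are arbitrary rather than `coord`, so that the rule can be
applied again after one exchange. -/
theorem rowMatrix_update_det {f : Fin d → Fin σ.n} (i : Fin d) (j : Fin σ.n) (c : Fin d → ℤ)
    (hc : ∑ i, c i • σ.v (f i) = σ.v j) :
    (σ.rowMatrix (Function.update f i j)).det = c i * (σ.rowMatrix f).det := by
  have h1 : σ.rowMatrix (Function.update f i j) =
      (σ.rowMatrix f).updateRow i (∑ k, c k • σ.rowMatrix f k) := by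
    have h2 : ∑ k, c k • σ.rowMatrix f k = σ.v j := hc
    rw [h2]
    ext a b
    by_cases ha : a = i
    · subst ha; simp [rowMatrix]
    · simp [rowMatrix, ha]
  rw [h1, Matrix.det_updateRow_sum, smul_eq_mul]

/-- Exchanging a basis vector for `v j` multiplies the determinant by the coordinate, and all these
determinants are `0` or `±1`. -/
theorem abs_coord_le (h : 1 / 2 < σ.boxVolume) {f : Fin d → Fin σ.n}
    (hf : IsUnit (σ.rowMatrix f).det) (j : Fin σ.n) (i : Fin d) : |σ.coord f j i| ≤ 1 := by
  have := σ.abs_det_rowMatrix_le h (Function.update f i j)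
  rwa [rowMatrix_update_det i j _ (sum_coord_smul hf j), abs_mul,
    Int.isUnit_iff_abs_eq.1 hf, mul_one] at this

theorem half_lt_cubeMeasure (h : 1 / 2 < σ.boxVolume) {f : Fin d → Fin σ.n}
    (hf : IsUnit (σ.rowMatrix f).det) (j l : Fin σ.n) : ENNReal.ofReal (1 / 2) <
      cubeMeasure (Fin d) (slab (σ.coord f j) ∩ slab (σ.coord f l)) := by
  have h1 := σ.volume_box_le f hf.ne_zero (T := slab (σ.coord f j) ∩ slab (σ.coord f l))
    fun x hx => by
      refine ⟨?_, ?_⟩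
      · rw [slab, Set.mem_ofPred_eq, ← dotProduct_latticeVec_eq hf]
        exact hx j
      · rw [slab, Set.mem_ofPred_eq, ← dotProduct_latticeVec_eq hf]
        exact hx l
  have h2 : |((σ.rowMatrix f).det : ℝ)| = 1 := by exact_mod_cast Int.isUnit_iff_abs_eq.1 hf
  rw [abs_inv, h2, inv_one, ENNReal.ofReal_one, one_mul] at h1
  refine lt_of_lt_of_le ?_ h1
  rw [boxVolume, Measure.real] at h
  exact ENNReal.ofReal_lt_iff_lt_toReal (by norm_num) (fun htop => by simp [htop] at h; linarith) |>.2 h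

theorem coord_ne_zero {f : Fin d → Fin σ.n} (hf : IsUnit (σ.rowMatrix f).det) (j : Fin σ.n) :
    σ.coord f j ≠ 0 := by
  intro h0
  apply σ.v_ne_zero j
  rw [← sum_coord_smul hf j, h0]
  simp

/-- Support of size one would make `v j` equal to a vector of the basis; the other sizes come from
the spline values. -/
theorem sum_coord_eq_one (h : 1 / 2 < σ.boxVolume) {f : Fin d → Fin σ.n}
    (hf : IsUnit (σ.rowMatrix f).det) {j : Fin σ.n} (hj : j ∉ Set.range f) :
    ∑ i, σ.coord f j i = 1 ∧
      ((slabSupport (σ.coord f j)).card = 3 ∨ (slabSupport (σ.coord f j)).card = 5) := by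
  have h1 := half_lt_cubeMeasure h hf j j
  rw [Set.inter_self] at h1
  obtain ⟨h2, h3⟩ := of_half_lt_cubeMeasure_slab (abs_coord_le h hf j) (coord_ne_zero hf j) h1
  refine ⟨h2, h3.resolve_left fun hcard => hj ?_⟩
  obtain ⟨i, hi⟩ := Finset.card_eq_one.1 hcard
  have hz : ∀ l, l ≠ i → σ.coord f j l = 0 := fun l hl => by
    by_contra h0
    have := mem_slabSupport.2 h0
    rw [hi, Finset.mem_singleton] at this
    exact hl this
  have hone : σ.coord f j i = 1 := by
    rwa [Finset.sum_eq_single i (fun l _ hl => hz l hl) (by simp)] at h2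
  refine ⟨i, σ.v_injective ?_⟩
  rw [← sum_coord_smul hf j, Finset.sum_eq_single i (fun l _ hl => by rw [hz l hl, zero_smul])
    (by simp), hone, one_smul]

/-- Two further generators would have coordinates that agree at some `a` and are opposite at some
`b`. Putting them in place of the basis vectors at `a` and `b` gives a determinant of absolute value
`2`. -/
theorem eq_of_notMem_range (h : 1 / 2 < σ.boxVolume) {f : Fin d → Fin σ.n}
    (hf : IsUnit (σ.rowMatrix f).det) {j l : Fin σ.n} (hj : j ∉ Set.range f)
    (hl : l ∉ Set.range f) : j = l := by
  by_contra hne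
  obtain ⟨hs, hc⟩ := sum_coord_eq_one h hf hj
  obtain ⟨hs', hc'⟩ := sum_coord_eq_one h hf hl
  have hcne : σ.coord f j ≠ σ.coord f l := fun heq => hne (σ.v_injective (by
    rw [← sum_coord_smul hf j, heq, sum_coord_smul hf l]))
  obtain ⟨a, b, hab, ha0, ha, hb0, hb⟩ := exists_of_half_lt_cubeMeasure_slab_inter
    (abs_coord_le h hf j) (abs_coord_le h hf l) hs hs' hc hc' hcne (half_lt_cubeMeasure h hf j l)
  set w := σ.coord f j
  set w' := σ.coord f l
  have h1 := rowMatrix_update_det a j w (sum_coord_smul hf j)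
  -- After the first exchange `v l` is `v j` plus the combination with coefficients `w' - w`. This
  -- has no term at `a`, because `w' a = w a`; the coefficient at `b` is `-2 * w b`.
  have h2 := rowMatrix_update_det (f := Function.update f a j) b l
    (Function.update (w' - w) a 1) (by
      rw [← Finset.add_sum_erase _ _ (Finset.mem_univ a)]
      have h3 : ∑ i ∈ Finset.univ.erase a, Function.update (w' - w) a 1 i •
          σ.v (Function.update f a j i) = ∑ i, (w' i - w i) • σ.v (f i) := by
        rw [← Finset.add_sum_erase Finset.univ _ (Finset.mem_univ a), ha, sub_self, zero_smul,
          zero_add]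
        refine Finset.sum_congr rfl fun i hi => ?_
        have := Finset.ne_of_mem_erase hi
        rw [Function.update_of_ne this, Function.update_of_ne this, Pi.sub_apply]
      rw [h3]
      simp only [sub_smul, Finset.sum_sub_distrib, Function.update_self, one_smul]
      rw [sum_coord_smul hf j, sum_coord_smul hf l]
      abel)
  have h4 := σ.abs_det_rowMatrix_le h (Function.update (Function.update f a j) b l)
  rw [h2, h1, Function.update_of_ne hab.symm, Pi.sub_apply, hb, abs_mul, abs_mul,
    Int.isUnit_iff_abs_eq.1 hf, mul_one] at h4
  have h5 := Int.one_le_abs ha0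
  have h6 : |(- w b - w b)| = 2 * |w b| := by
    rw [show - w b - w b = -(2 * w b) by ring, abs_neg, abs_mul]; rfl
  have h7 := Int.one_le_abs hb0
  rw [h6] at h4
  nlinarith

variable (σ) in
theorem exists_isUnit_det_rowMatrix (h : 1 / 2 < σ.boxVolume) :
    ∃ f : Fin d → Fin σ.n, IsUnit (σ.rowMatrix f).det := by
  obtain ⟨f, hf⟩ := σ.exists_det_rowMatrix_ne_zero
  have h1 := σ.abs_det_rowMatrix_le h f
  have h2 := Int.one_le_abs hf
  exact ⟨f, Int.isUnit_iff_abs_eq.2 (le_antisymm h1 h2)⟩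

end ToricCone

end

/-! ### Half-space monoids and Segre rings. -/

/-- The integer vectors with nonnegative entries that have nonnegative pairing with `w`. -/
def halfMonoid {ι : Type*} [Fintype ι] (w : ι → ℤ) : AddSubmonoid (ι → ℤ) where
  carrier := {y | (∀ i, 0 ≤ y i) ∧ 0 ≤ y ⬝ᵥ w}
  zero_mem' := ⟨fun i => le_rfl, by simp⟩
  add_mem' := fun {a b} ha hb => ⟨fun i => add_nonneg (ha.1 i) (hb.1 i), by
    rw [add_dotProduct]; exact add_nonneg ha.2 hb.2⟩

/-- The monoid of exponents of the monomials in the `x_i` and `y_j` that have the same degree in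
the `x_i` as in the `y_j`. -/
def segreMonoid (a b : ℕ) : AddSubmonoid (Fin (a + 1) ⊕ Fin (b + 1) →₀ ℕ) where
  carrier := {m | ∑ i, m (Sum.inl i) = ∑ j, m (Sum.inr j)}
  zero_mem' := by simp
  add_mem' := fun {m m'} h h' => by
    simp only [Set.mem_ofPred_eq, Finsupp.add_apply, Finset.sum_add_distrib] at *
    rw [h, h']

theorem mem_segreMonoid {a b : ℕ} {m : Fin (a + 1) ⊕ Fin (b + 1) →₀ ℕ} :
    m ∈ segreMonoid a b ↔ ∑ i, m (Sum.inl i) = ∑ j, m (Sum.inr j) := Iff.rfl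

section segre

variable (k : Type*) [Field k] (a b : ℕ)

/-- A monomial of equal positive degrees is divisible by some `x_i y_j`, which can be split off;
induction on the common degree. -/
theorem monomial_mem_segreRing (N : ℕ) (m : Fin (a + 1) ⊕ Fin (b + 1) →₀ ℕ)
    (hl : ∑ i, m (Sum.inl i) = N) (hr : ∑ j, m (Sum.inr j) = N) :
    MvPolynomial.monomial m (1 : k) ∈ segreRing k a b := by
  induction N generalizing m with
  | zero =>
    have : m = 0 := by
      ext s
      rcases s with i | j
      · exact Finset.sum_eq_zero_iff.1 hl i (Finset.mem_univ _)
      · exact Finset.sum_eq_zero_iff.1 hr j (Finset.mem_univ _)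
    rw [this]
    exact one_mem _
  | succ N ih =>
    obtain ⟨i, -, hi⟩ := Finset.exists_ne_zero_of_sum_ne_zero (hl.trans_ne N.succ_ne_zero)
    obtain ⟨j, -, hj⟩ := Finset.exists_ne_zero_of_sum_ne_zero (hr.trans_ne N.succ_ne_zero)
    have hle : Finsupp.single (Sum.inl i) 1 + Finsupp.single (Sum.inr j) 1 ≤ m := by
      intro s
      rcases s with i' | j'
      · by_cases h : i = i'
        · subst h; simpa [Nat.one_le_iff_ne_zero] using hi
        · simp [h]
      · by_cases h : j = j'
        · subst h; simpa [Nat.one_le_iff_ne_zero] using hj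
        · simp [h]
    obtain ⟨m', rfl⟩ := exists_add_of_le hle
    have h1 : MvPolynomial.monomial (Finsupp.single (Sum.inl i) 1 + Finsupp.single (Sum.inr j) 1 +
        m') (1 : k) = MvPolynomial.X (Sum.inl i) * MvPolynomial.X (Sum.inr j) *
          MvPolynomial.monomial m' (1 : k) := by
      simp [MvPolynomial.X, MvPolynomial.monomial_mul]
    rw [h1]
    refine mul_mem (Algebra.subset_adjoin ⟨i, j, rfl⟩) (ih m' ?_ ?_)
    · simp [Finset.sum_add_distrib, Finsupp.single_apply] at hl
      omega
    · simp [Finset.sum_add_distrib, Finsupp.single_apply] at hr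
      omega

/-- The monomial algebra of `segreMonoid a b` as a subalgebra of the polynomial ring. -/
def segreMonoidHom : AddMonoidAlgebra k (segreMonoid a b) →ₐ[k]
    MvPolynomial (Fin (a + 1) ⊕ Fin (b + 1)) k :=
  AddMonoidAlgebra.mapDomainAlgHom k k (segreMonoid a b).subtype

theorem segreMonoidHom_single (m : segreMonoid a b) (c : k) :
    segreMonoidHom k a b (AddMonoidAlgebra.single m c) = MvPolynomial.monomial m.1 c := by
  simp [segreMonoidHom, MvPolynomial.single_eq_monomial]

theorem segreMonoidHom_injective : Function.Injective (segreMonoidHom k a b) :=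
  AddMonoidAlgebra.mapDomain_injective Subtype.val_injective

theorem range_segreMonoidHom : (segreMonoidHom k a b).range = segreRing k a b := by
  apply le_antisymm
  · rintro _ ⟨f, rfl⟩
    change segreMonoidHom k a b f ∈ _
    induction f using AddMonoidAlgebra.induction_linear with
    | zero => simp
    | add f g hf hg => rw [map_add]; exact add_mem hf hg
    | single m c =>
      rw [segreMonoidHom_single, ← mul_one c, ← smul_eq_mul, ← MvPolynomial.smul_monomial]
      exact Subalgebra.smul_mem _ (monomial_mem_segreRing k a b _ m.1 m.2 rfl) c
  · refine Algebra.adjoin_le ?_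
    rintro _ ⟨i, j, rfl⟩
    refine ⟨AddMonoidAlgebra.single ⟨Finsupp.single (Sum.inl i) 1 + Finsupp.single (Sum.inr j) 1,
      ?_⟩ 1, ?_⟩
    · simp [mem_segreMonoid, Finsupp.single_apply]
    · change segreMonoidHom k a b _ = _
      rw [segreMonoidHom_single]
      simp [MvPolynomial.X, MvPolynomial.monomial_mul]

/-- The ring `k[x_i y_j]` is the algebra of the monoid `segreMonoid a b`. -/
def segreRingEquiv : AddMonoidAlgebra k (segreMonoid a b) ≃ₐ[k] segreRing k a b :=
  (AlgEquiv.ofInjective _ (segreMonoidHom_injective k a b)).trans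
    (Subalgebra.equivOfEq _ _ (range_segreMonoidHom k a b))

end segre

section half

variable {ι : Type*} [Fintype ι]

theorem exists_equiv_of_card {a r : ℕ} {w : ι → ℤ} (hw : ∀ i, |w i| ≤ 1)
    (hpos : (Finset.univ.filter fun i => w i = 1).card = a + 1)
    (hneg : (Finset.univ.filter fun i => w i = -1).card = a)
    (hzero : (Finset.univ.filter fun i => w i = 0).card = r) :
    ∃ g : Fin (a + 1) ⊕ Fin a ⊕ Fin r ≃ ι, ∀ s,
      w (g s) = Sum.elim (fun _ => 1) (Sum.elim (fun _ => -1) fun _ => 0) s := by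
  have hcard : ∀ c : ℤ, Fintype.card {s : Fin (a + 1) ⊕ Fin a ⊕ Fin r //
      Sum.elim (fun _ => (1 : ℤ)) (Sum.elim (fun _ => -1) fun _ => 0) s = c} =
        Fintype.card {i // w i = c} := by
    intro c
    rw [Fintype.card_subtype, Fintype.card_subtype, Finset.card_filter, Fintype.sum_sum_type,
      Fintype.sum_sum_type]
    by_cases h1 : c = 1
    · subst h1; rw [hpos]; simp
    by_cases h2 : c = -1
    · subst h2; rw [hneg]; simp
    by_cases h3 : c = 0
    · subst h3; rw [hzero]; simp
    have : (Finset.univ.filter fun i => w i = c) = ∅ := by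
      rw [Finset.filter_eq_empty_iff]
      intro i _ hi
      have := abs_le.1 (hw i)
      omega
    rw [this]
    simp [Ne.symm h1, Ne.symm h2, Ne.symm h3]
  refine ⟨Equiv.ofFiberEquiv fun c => Fintype.equivOfCardEq (hcard c), fun s => ?_⟩
  exact Equiv.ofFiberEquiv_map _ s

variable {a r : ℕ} {w : ι → ℤ} (g : Fin (a + 1) ⊕ Fin a ⊕ Fin r ≃ ι)

theorem dotProduct_eq_of_equiv (hg : ∀ s, w (g s) =
    Sum.elim (fun _ => 1) (Sum.elim (fun _ => -1) fun _ => 0) s) (y : ι → ℤ) :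
    y ⬝ᵥ w = ∑ i, y (g (Sum.inl i)) - ∑ j, y (g (Sum.inr (Sum.inl j))) := by
  rw [dotProduct, ← Equiv.sum_comp g, Fintype.sum_sum_type, Fintype.sum_sum_type]
  simp [hg, sub_eq_add_neg]

/-- The vector of the half space monoid with given exponents. -/
def halfVector (z : (Fin r →₀ ℕ) × segreMonoid a a) (i : ι) : ℤ :=
  Sum.elim (fun i => (z.2.1 (Sum.inl i) : ℤ))
    (Sum.elim (fun j => (z.2.1 (Sum.inr j.succ) : ℤ)) fun l => (z.1 l : ℤ)) (g.symm i)

omit [Fintype ι] in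
theorem halfVector_add (z z' : (Fin r →₀ ℕ) × segreMonoid a a) :
    halfVector g (z + z') = halfVector g z + halfVector g z' := by
  funext i
  rw [Pi.add_apply, halfVector, halfVector, halfVector]
  rcases g.symm i with i | j | l <;> simp

/-- The exponent of `y_0`, which the vector omits, is the slack of the inequality `⟨y, w⟩ ≥ 0`. It
turns the half-space condition into equality of the two degrees. -/
theorem halfVector_dotProduct (hg : ∀ s, w (g s) =
    Sum.elim (fun _ => 1) (Sum.elim (fun _ => -1) fun _ => 0) s)
    (z : (Fin r →₀ ℕ) × segreMonoid a a) :
    halfVector g z ⬝ᵥ w = z.2.1 (Sum.inr 0) := by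
  have h : ∑ i, z.2.1 (Sum.inl i) = ∑ j, z.2.1 (Sum.inr j) := z.2.2
  rw [Fin.sum_univ_succ (fun j => z.2.1 (Sum.inr j))] at h
  rw [dotProduct_eq_of_equiv g hg]
  simp only [halfVector, Equiv.symm_apply_apply, Sum.elim_inl, Sum.elim_inr]
  have h' := congrArg (Nat.cast : ℕ → ℤ) h
  push_cast at h'
  rw [h', add_sub_cancel_right]

theorem halfVector_mem (hg : ∀ s, w (g s) =
    Sum.elim (fun _ => 1) (Sum.elim (fun _ => -1) fun _ => 0) s)
    (z : (Fin r →₀ ℕ) × segreMonoid a a) : halfVector g z ∈ halfMonoid w := by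
  refine ⟨fun i => ?_, ?_⟩
  · rw [halfVector]
    rcases g.symm i with i | j | l <;> simp
  · rw [halfVector_dotProduct g hg]
    positivity

/-- The half space monoid of a vector with `a + 1` entries `1`, `a` entries `-1` and `r` entries
`0`. -/
def halfMonoidEquiv (hg : ∀ s, w (g s) =
    Sum.elim (fun _ => 1) (Sum.elim (fun _ => -1) fun _ => 0) s) :
    (Fin r →₀ ℕ) × segreMonoid a a ≃+ halfMonoid w :=
  AddEquiv.ofBijective
    ({ toFun := fun z => ⟨halfVector g z, halfVector_mem g hg z⟩
       map_zero' := by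
        apply Subtype.ext
        funext i
        change halfVector g _ i = 0
        rw [halfVector]
        rcases g.symm i with i | j | l <;> simp
       map_add' := fun z z' => Subtype.ext (halfVector_add g z z') } :
      (Fin r →₀ ℕ) × segreMonoid a a →+ halfMonoid w) (by
    constructor
    · intro z z' h
      have h1 : halfVector g z = halfVector g z' := congrArg Subtype.val h
      have h2 : ∀ s, halfVector g z (g s) = halfVector g z' (g s) := fun s => by rw [h1]
      simp only [halfVector, Equiv.symm_apply_apply] at h2
      refine Prod.ext (Finsupp.ext fun l => ?_) (Subtype.ext (Finsupp.ext fun s => ?_))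
      · simpa using h2 (Sum.inr (Sum.inr l))
      · rcases s with i | j
        · simpa using h2 (Sum.inl i)
        · induction j using Fin.cases with
          | zero =>
            have h3 := halfVector_dotProduct g hg z
            rw [h1, halfVector_dotProduct g hg] at h3
            exact_mod_cast h3.symm
          | succ j => simpa using h2 (Sum.inr (Sum.inl j))
    · rintro ⟨y, hy, hyw⟩
      have hdot := dotProduct_eq_of_equiv g hg y
      refine ⟨(Finsupp.equivFunOnFinite.symm fun l => (y (g (Sum.inr (Sum.inr l)))).toNat,
        ⟨Finsupp.equivFunOnFinite.symm (Sum.elim (fun i => (y (g (Sum.inl i))).toNat)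
          (Fin.cons (y ⬝ᵥ w).toNat fun j => (y (g (Sum.inr (Sum.inl j)))).toNat)), ?_⟩), ?_⟩
      · rw [mem_segreMonoid]
        simp only [Finsupp.equivFunOnFinite_symm_apply_apply, Sum.elim_inl, Sum.elim_inr]
        rw [Fin.sum_univ_succ (Fin.cons _ _)]
        zify
        simp only [Fin.cons_zero, Fin.cons_succ, Int.toNat_of_nonneg (hy _),
          Int.toNat_of_nonneg hyw]
        rw [hdot]
        ring
      · apply Subtype.ext
        funext i
        obtain ⟨s, rfl⟩ := g.surjective i
        change halfVector g _ (g s) = y (g s)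
        rw [halfVector, Equiv.symm_apply_apply]
        rcases s with i | j | l <;> simp [hy])

variable (k : Type*) [Field k]

theorem nonempty_algEquiv_mvPolynomial_segreRing (hg : ∀ s, w (g s) =
    Sum.elim (fun _ => 1) (Sum.elim (fun _ => -1) fun _ => 0) s) :
    Nonempty (AddMonoidAlgebra k (halfMonoid w) ≃ₐ[k]
      MvPolynomial (Fin r) (segreRing k a a)) := by
  let e1 : AddMonoidAlgebra k (halfMonoid w) ≃ₐ[k]
      AddMonoidAlgebra k ((Fin r →₀ ℕ) × segreMonoid a a) :=
    AddMonoidAlgebra.domCongr k k (halfMonoidEquiv g hg).symm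
  let e2 : AddMonoidAlgebra k ((Fin r →₀ ℕ) × segreMonoid a a) ≃ₐ[k]
      MvPolynomial (Fin r) (AddMonoidAlgebra k (segreMonoid a a)) :=
    AddMonoidAlgebra.curryAlgEquiv k
  exact ⟨(e1.trans e2).trans (MvPolynomial.mapAlgEquiv (Fin r) (segreRingEquiv k a a))⟩

theorem nonempty_algEquiv_mvPolynomial (d : ℕ) :
    Nonempty (AddMonoidAlgebra k (halfMonoid (0 : Fin d → ℤ)) ≃ₐ[k]
      MvPolynomial (Fin d) k) := by
  let e : (Fin d →₀ ℕ) ≃+ halfMonoid (0 : Fin d → ℤ) := AddEquiv.ofBijective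
    ({ toFun := fun m => ⟨fun i => (m i : ℤ), fun i => by positivity, by simp⟩
       map_zero' := Subtype.ext (by funext i; simp)
       map_add' := fun m m' => Subtype.ext (by funext i; simp) } :
      (Fin d →₀ ℕ) →+ halfMonoid (0 : Fin d → ℤ)) (by
    constructor
    · intro m m' h
      ext i
      simpa using congrFun (congrArg Subtype.val h) i
    · rintro ⟨y, hy, -⟩
      refine ⟨Finsupp.equivFunOnFinite.symm fun i => (y i).toNat, Subtype.ext ?_⟩
      funext i
      simp [hy])
  exact ⟨AddMonoidAlgebra.domCongr k k e.symm⟩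

end half

/-! ### The toric ring in the coordinates of a lattice basis of generators. -/

namespace ToricCone

variable {d : ℕ} {σ : ToricCone d}

theorem dotProduct_v_eq {f : Fin d → Fin σ.n} (hf : IsUnit (σ.rowMatrix f).det) (j : Fin σ.n)
    (m : Fin d → ℤ) : m ⬝ᵥ σ.v j = (σ.rowMatrix f).mulVec m ⬝ᵥ σ.coord f j := by
  rw [← sum_coord_smul hf j, dotProduct_sum, dotProduct]
  refine Finset.sum_congr rfl fun i _ => ?_
  rw [dotProduct_smul, smul_eq_mul, mul_comm, dotProduct_comm]
  rfl

/-- The dual monoid in the coordinates given by a basis of minimal generators. -/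
def dualMonoidEquiv {f : Fin d → Fin σ.n} (hf : IsUnit (σ.rowMatrix f).det) {w : Fin d → ℤ}
    (hw : ∀ y : Fin d → ℤ, (∀ i, 0 ≤ y i) → (0 ≤ y ⬝ᵥ w ↔
      ∀ j, j ∉ Set.range f → 0 ≤ y ⬝ᵥ σ.coord f j)) :
    σ.dualMonoid ≃+ halfMonoid w where
  toFun m := ⟨(σ.rowMatrix f).mulVec m, by
    have h1 : ∀ i, 0 ≤ (σ.rowMatrix f).mulVec m i := fun i => by
      change 0 ≤ σ.v (f i) ⬝ᵥ m.1
      rw [dotProduct_comm]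
      exact m.2 (f i)
    refine ⟨h1, (hw _ h1).2 fun j _ => ?_⟩
    rw [← dotProduct_v_eq hf]
    exact m.2 j⟩
  invFun y := ⟨(σ.rowMatrix f)⁻¹.mulVec y, fun j => by
    have h0 : (σ.rowMatrix f).mulVec ((σ.rowMatrix f)⁻¹.mulVec y) = y := by
      rw [Matrix.mulVec_mulVec, Matrix.mul_nonsing_inv _ hf, Matrix.one_mulVec]
    by_cases hj : j ∈ Set.range f
    · obtain ⟨i, rfl⟩ := hj
      have : (σ.rowMatrix f).mulVec ((σ.rowMatrix f)⁻¹.mulVec y) i = y.1 i := by rw [h0]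
      rw [dotProduct_comm]
      exact (y.2.1 i).trans_eq this.symm
    · rw [dotProduct_v_eq hf, h0]
      exact (hw _ y.2.1).1 y.2.2 j hj⟩
  left_inv m := Subtype.ext (by
    change (σ.rowMatrix f)⁻¹.mulVec ((σ.rowMatrix f).mulVec m) = m
    rw [Matrix.mulVec_mulVec, Matrix.nonsing_inv_mul _ hf, Matrix.one_mulVec])
  right_inv y := Subtype.ext (by
    change (σ.rowMatrix f).mulVec ((σ.rowMatrix f)⁻¹.mulVec y) = y
    rw [Matrix.mulVec_mulVec, Matrix.mul_nonsing_inv _ hf, Matrix.one_mulVec])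
  map_add' m m' := Subtype.ext (Matrix.mulVec_add (σ.rowMatrix f) m.1 m'.1)

/-- The condition on `w` is stated so as to cover both outcomes: `w = 0` when the basis exhausts the
generators, and the coordinate vector of the single remaining generator otherwise. -/
theorem nonempty_algEquiv_halfMonoid (k : Type*) [Field k] {f : Fin d → Fin σ.n}
    (hf : IsUnit (σ.rowMatrix f).det) {w : Fin d → ℤ}
    (hw : ∀ y : Fin d → ℤ, (∀ i, 0 ≤ y i) → (0 ≤ y ⬝ᵥ w ↔
      ∀ j, j ∉ Set.range f → 0 ≤ y ⬝ᵥ σ.coord f j)) :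
    Nonempty (σ.Ring k ≃ₐ[k] AddMonoidAlgebra k (halfMonoid w)) :=
  ⟨AddMonoidAlgebra.domCongr k k (dualMonoidEquiv hf hw)⟩

/-- The monomial prime of a generator in a basis of minimal generators is principal if the
generator does not occur in the other minimal generators. -/
theorem isPrincipal_facetPrime (k : Type*) [Field k] {f : Fin d → Fin σ.n}
    (hf : IsUnit (σ.rowMatrix f).det) {i : Fin d}
    (hi : ∀ j, j ∉ Set.range f → σ.coord f j i = 0) :
    (σ.facetPrime k (f i)).IsPrincipal := by
  -- The dual basis vector: it pairs to `1` with `v (f i)` and to `0` with every other generator, so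
  -- `t^u` divides every monomial generating the prime.
  set u := (σ.rowMatrix f)⁻¹.mulVec (Pi.single i 1) with hu
  have hfu : (σ.rowMatrix f).mulVec u = Pi.single i 1 := by
    rw [hu, Matrix.mulVec_mulVec, Matrix.mul_nonsing_inv _ hf, Matrix.one_mulVec]
  have hdotf : ∀ l, u ⬝ᵥ σ.v (f l) = (Pi.single i 1 : Fin d → ℤ) l := fun l => by
    rw [← hfu, dotProduct_comm]; rfl
  have hdot : ∀ j, j ∉ Set.range f → u ⬝ᵥ σ.v j = 0 := fun j hj => by
    rw [dotProduct_v_eq hf, hfu, single_one_dotProduct, hi j hj]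
  have huv : ∀ j, u ⬝ᵥ σ.v j = if j = f i then 1 else 0 := by
    have hinj : Function.Injective f := fun l l' hll => by
      by_contra hne
      refine hf.ne_zero (Matrix.det_zero_of_row_eq hne ?_)
      change σ.v (f l) = σ.v (f l')
      rw [hll]
    intro j
    by_cases hj : j ∈ Set.range f
    · obtain ⟨l, rfl⟩ := hj
      rw [hdotf, Pi.single_apply]
      simp [hinj.eq_iff]
    · rw [hdot j hj, if_neg]
      rintro rfl
      exact hj ⟨i, rfl⟩
  have hmem : u ∈ σ.dualMonoid := fun j => by
    rw [huv]; split_ifs <;> simp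
  refine ⟨⟨AddMonoidAlgebra.single ⟨u, hmem⟩ 1, ?_⟩⟩
  apply le_antisymm
  · refine Submodule.span_le.2 ?_
    rintro _ ⟨m, hm, rfl⟩
    have hsub : m.1 - u ∈ σ.dualMonoid := fun j => by
      rw [sub_dotProduct, huv]
      split_ifs with h
      · subst h; linarith
      · have := m.2 j; linarith
    have h1 : m = ⟨u, hmem⟩ + ⟨m.1 - u, hsub⟩ := Subtype.ext (by simp)
    refine Ideal.mem_span_singleton.2 ⟨AddMonoidAlgebra.single ⟨m.1 - u, hsub⟩ 1, ?_⟩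
    rw [AddMonoidAlgebra.single_mul_single, ← h1, one_mul]
  · refine Submodule.span_le.2 ?_
    rintro _ rfl
    refine Ideal.subset_span ⟨⟨u, hmem⟩, ?_, rfl⟩
    change 1 ≤ u ⬝ᵥ _
    rw [huv, if_pos rfl]

end ToricCone

/-! ### A criterion for monomial primes not to be principal. -/

namespace ToricCone

section nonprincipal

variable {d : ℕ} (σ : ToricCone d) (k : Type*) [Field k]

theorem coeff_zero_of_mem_facetPrime {i : Fin σ.n} {f : σ.Ring k} (hf : f ∈ σ.facetPrime k i) :
    f.coeff 0 = 0 := by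
  have hle : σ.facetPrime k i ≤ σ.irrelevantIdeal k := by
    rw [irrelevantIdeal_eq_span]
    refine Ideal.span_mono ?_
    rintro _ ⟨m, hm, rfl⟩
    refine ⟨m, ?_, rfl⟩
    rintro rfl
    simp at hm
  rw [← constantTerm_apply]
  exact hle hf

/-- The Leibniz rule at the irrelevant ideal `𝔪`: the coefficient of an irreducible monomial
vanishes on `𝔪 ^ 2`. -/
theorem coeff_mul_of_indecomposable {u : σ.dualMonoid} (h0 : u ≠ 0)
    (hu : ∀ x y, x + y = u → x = 0 ∨ y = 0) (f g : σ.Ring k) :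
    (f * g).coeff u = f.coeff u * g.coeff 0 + f.coeff 0 * g.coeff u := by
  classical
  induction f using AddMonoidAlgebra.induction_linear with
  | zero => simp
  | add f f' hf hf' => rw [add_mul, AddMonoidAlgebra.coeff_add, Finsupp.add_apply, hf, hf',
      AddMonoidAlgebra.coeff_add, Finsupp.add_apply, Finsupp.add_apply]; ring
  | single x a =>
    induction g using AddMonoidAlgebra.induction_linear with
    | zero => simp
    | add f f' hf hf' => rw [mul_add, AddMonoidAlgebra.coeff_add, Finsupp.add_apply, hf, hf',
        AddMonoidAlgebra.coeff_add, Finsupp.add_apply, Finsupp.add_apply]; ring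
    | single y b =>
      rw [AddMonoidAlgebra.single_mul_single]
      simp only [AddMonoidAlgebra.coeff_single, Finsupp.single_apply]
      by_cases hxy : x + y = u
      · rcases hu x y hxy with rfl | rfl
        · rw [zero_add] at hxy
          subst hxy
          simp [h0, Ne.symm h0]
        · rw [add_zero] at hxy
          subst hxy
          simp [h0, Ne.symm h0]
      · rw [if_neg hxy]
        have h1 : ¬ (x = u ∧ y = 0) := by rintro ⟨rfl, rfl⟩; simp at hxy
        have h2 : ¬ (x = 0 ∧ y = u) := by rintro ⟨rfl, rfl⟩; simp at hxy
        by_cases hx : x = u <;> by_cases hy : y = 0 <;> by_cases hx' : x = 0 <;>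
          by_cases hy' : y = u <;> simp_all

/-- A monomial prime that contains two irreducible monomials is not principal. -/
theorem not_isPrincipal_facetPrime {i : Fin σ.n} {u u' : σ.dualMonoid} (hne : u ≠ u')
    (hu : ∀ x y, x + y = u → x = 0 ∨ y = 0) (hu' : ∀ x y, x + y = u' → x = 0 ∨ y = 0)
    (hi : 1 ≤ u.1 ⬝ᵥ σ.v i) (hi' : 1 ≤ u'.1 ⬝ᵥ σ.v i) : ¬ (σ.facetPrime k i).IsPrincipal := by
  rintro ⟨⟨f, hf⟩⟩
  have h0 : ∀ u : σ.dualMonoid, 1 ≤ u.1 ⬝ᵥ σ.v i → u ≠ 0 := by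
    rintro u h rfl
    simp at h
  have hf0 : f.coeff 0 = 0 := σ.coeff_zero_of_mem_facetPrime k (i := i) (by
    rw [hf]; exact Submodule.mem_span_singleton_self f)
  have hex : ∀ u : σ.dualMonoid, 1 ≤ u.1 ⬝ᵥ σ.v i →
      ∃ g, f * g = AddMonoidAlgebra.single u 1 := fun u h => by
    have h1 : AddMonoidAlgebra.single u 1 ∈ σ.facetPrime k i := Ideal.subset_span ⟨u, h, rfl⟩
    rw [hf] at h1
    obtain ⟨g, hg⟩ := Ideal.mem_span_singleton.1 h1
    exact ⟨g, hg.symm⟩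
  obtain ⟨g, hg⟩ := hex u hi
  obtain ⟨g', hg'⟩ := hex u' hi'
  -- A generator `f` has no constant term. Comparing coefficients in `f g = t^u` and `f g' = t^{u'}`
  -- gives `f_u g_0 = 1`, `f_{u'} g_0 = 0` and `f_{u'} g'_0 = 1`, which is absurd.
  have h1 := σ.coeff_mul_of_indecomposable k (h0 u hi) hu f g
  have h2 := σ.coeff_mul_of_indecomposable k (h0 u' hi') hu' f g
  have h3 := σ.coeff_mul_of_indecomposable k (h0 u' hi') hu' f g'
  rw [hg, hf0, zero_mul, add_zero, AddMonoidAlgebra.coeff_single, Finsupp.single_eq_same] at h1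
  rw [hg, hf0, zero_mul, add_zero, AddMonoidAlgebra.coeff_single,
    Finsupp.single_eq_of_ne hne.symm] at h2
  rw [hg', hf0, zero_mul, add_zero, AddMonoidAlgebra.coeff_single, Finsupp.single_eq_same] at h3
  rcases mul_eq_zero.1 h2.symm with h | h
  · rw [h, zero_mul] at h3
    exact one_ne_zero h3
  · rw [h, mul_zero] at h1
    exact one_ne_zero h1

end nonprincipal

/-! ### Explicit cones realizing the rings of the list. -/

/-- The cone over a family of primitive vectors in strictly convex position. -/
def ofVectors {d n : ℕ} (v : Fin n → Fin d → ℤ)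
    (hspan : Submodule.span ℝ (Set.range fun i => latticeVec (v i)) = ⊤)
    (y : Fin d → ℤ) (hy : ∀ i, 0 < y ⬝ᵥ v i)
    (hfacet : ∀ i, ∃ z : Fin d → ℤ, z ⬝ᵥ v i < 0 ∧ ∀ j, j ≠ i → 0 ≤ z ⬝ᵥ v j)
    (hprim : ∀ i, ∃ l, v i l = 1) : ToricCone d where
  n := n
  v := v
  span_eq_top := hspan
  stronglyConvex := by
    have key : ∀ x ∈ PointedCone.hull ℝ (Set.range fun i => latticeVec (v i)),
        0 ≤ latticeVec y ⬝ᵥ x ∧ (latticeVec y ⬝ᵥ x = 0 → x = 0) := by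
      intro x hx
      induction hx using Submodule.span_induction with
      | mem x hx =>
        obtain ⟨i, rfl⟩ := hx
        have : 0 < latticeVec y ⬝ᵥ latticeVec (v i) := by
          rw [latticeVec_dotProduct]; exact_mod_cast hy i
        exact ⟨this.le, fun h => absurd h this.ne'⟩
      | zero => simp
      | add x x' _ _ hx hx' =>
        rw [dotProduct_add]
        refine ⟨add_nonneg hx.1 hx'.1, fun h => ?_⟩
        rw [hx.2 (by linarith [hx.1, hx'.1]), hx'.2 (by linarith [hx.1, hx'.1]), add_zero]
      | smul c x _ hx =>
        have h1 : latticeVec y ⬝ᵥ (c • x) = (c : ℝ) * (latticeVec y ⬝ᵥ x) := dotProduct_smul _ _ _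
        rw [h1]
        refine ⟨mul_nonneg c.2 hx.1, fun h => ?_⟩
        rcases mul_eq_zero.1 h with h | h
        · have : c = 0 := Subtype.ext h
          rw [this, zero_smul]
        · rw [hx.2 h, smul_zero]
    intro x hx hx'
    have h1 := key x hx
    have h2 := key (-x) hx'
    rw [dotProduct_neg] at h2
    exact h1.2 (by linarith [h1.1, h2.1])
  minimal := by
    intro S hS heq
    obtain ⟨i, hi⟩ := (Set.ne_univ_iff_exists_notMem S).1 hS
    obtain ⟨z, hz, hz'⟩ := hfacet i
    have h1 : latticeVec (v i) ∈ PointedCone.hull ℝ ((fun i => latticeVec (v i)) '' S) := by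
      rw [heq]
      exact PointedCone.subset_hull ⟨i, rfl⟩
    have key : ∀ x ∈ PointedCone.hull ℝ ((fun i => latticeVec (v i)) '' S),
        0 ≤ latticeVec z ⬝ᵥ x := by
      intro x hx
      induction hx using Submodule.span_induction with
      | mem x hx =>
        obtain ⟨j, hj, rfl⟩ := hx
        change 0 ≤ latticeVec z ⬝ᵥ latticeVec (v j)
        rw [latticeVec_dotProduct]
        exact_mod_cast hz' j fun h => hi (h ▸ hj)
      | zero => simp
      | add x x' _ _ hx hx' => rw [dotProduct_add]; exact add_nonneg hx hx'
      | smul c x _ hx =>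
        have h1 : latticeVec z ⬝ᵥ (c • x) = (c : ℝ) * (latticeVec z ⬝ᵥ x) := dotProduct_smul _ _ _
        rw [h1]
        exact mul_nonneg c.2 hx
    have h2 := key _ h1
    rw [latticeVec_dotProduct] at h2
    have : (0 : ℤ) ≤ z ⬝ᵥ v i := by exact_mod_cast h2
    linarith
  primitive := by
    intro i w c hc h
    obtain ⟨l, hl⟩ := hprim i
    have h1 := congrFun h l
    simp only [latticeVec, Pi.smul_apply, hl, Int.cast_one, smul_eq_mul, mul_one] at h1
    rw [← h1] at hc ⊢
    have : (0 : ℤ) < w l := by exact_mod_cast hc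
    exact_mod_cast this

theorem latticeVec_single {d : ℕ} (i : Fin d) :
    latticeVec (Pi.single i 1) = Pi.basisFun ℝ (Fin d) i := by
  funext j
  rw [Pi.basisFun_apply, latticeVec, Pi.single_apply, Pi.single_apply]
  split_ifs <;> simp

theorem span_eq_top_of_single {d n : ℕ} {v : Fin n → Fin d → ℤ}
    (h : ∀ i, Pi.single i 1 ∈ Set.range v) :
    Submodule.span ℝ (Set.range fun i => latticeVec (v i)) = ⊤ := by
  rw [eq_top_iff, ← (Pi.basisFun ℝ (Fin d)).span_eq]
  refine Submodule.span_mono ?_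
  rintro _ ⟨i, rfl⟩
  obtain ⟨j, hj⟩ := h i
  exact ⟨j, by simp only [hj, latticeVec_single]⟩

/-- The nonnegative orthant. -/
def orthant (d : ℕ) : ToricCone d :=
  ofVectors (fun i : Fin d => Pi.single i 1) (span_eq_top_of_single fun i => ⟨i, rfl⟩) 1
    (fun i => by simp)
    (fun i => ⟨Pi.single i (-1), by simp, fun j hj => by simp [hj]⟩)
    (fun i => ⟨i, by simp⟩)

theorem dotProduct_orthant {d : ℕ} (x : Fin d → ℝ) (i : Fin d) :
    x ⬝ᵥ latticeVec ((orthant d).v i) = x i := by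
  change x ⬝ᵥ latticeVec (Pi.single i 1) = x i
  rw [latticeVec_single, Pi.basisFun_apply, dotProduct_single_one]

theorem rowMatrix_orthant (d : ℕ) : (orthant d).rowMatrix (fun i : Fin d => i) = 1 := by
  ext i j
  change (Pi.single i 1 : Fin d → ℤ) j = _
  rw [Matrix.one_apply, Pi.single_apply]
  simp [eq_comm]

theorem nonempty_orthant_algEquiv (k : Type*) [Field k] (d : ℕ) :
    Nonempty ((orthant d).Ring k ≃ₐ[k] MvPolynomial (Fin d) k) := by
  obtain ⟨e⟩ := nonempty_algEquiv_halfMonoid (σ := orthant d) k (f := fun i : Fin d => i)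
    (by rw [rowMatrix_orthant, Matrix.det_one]; exact isUnit_one) (w := 0)
    (fun y hy => by
      rw [dotProduct_zero]
      exact ⟨fun _ j hj => absurd ⟨j, rfl⟩ hj, fun _ => le_rfl⟩)
  obtain ⟨e'⟩ := nonempty_algEquiv_mvPolynomial k d
  exact ⟨e.trans e'⟩

theorem boxVolume_orthant (d : ℕ) : (orthant d).boxVolume = 1 := by
  have : (orthant d).box = Set.univ.pi fun _ => Set.Ico (0 : ℝ) 1 := by
    ext x
    rw [Set.mem_univ_pi]
    refine forall_congr' fun (i : Fin d) => ?_
    exact (dotProduct_orthant x i).symm ▸ Iff.rfl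
  rw [boxVolume, this, MeasureTheory.Measure.real, MeasureTheory.volume_pi,
    MeasureTheory.Measure.pi_pi]
  simp

end ToricCone

section

open MeasureTheory

namespace ToricCone

section halfCone

variable {d : ℕ} {w : Fin d → ℤ} (hw : ∀ i, |w i| ≤ 1) (hs : 0 < ∑ i, w i) {p p' q : Fin d}
  (hpp' : p ≠ p') (hp : w p = 1) (hp' : w p' = 1) (hq : w q = -1)

/-- The cone over the standard basis vectors and one more vector. -/
def halfCone : ToricCone d :=
  ofVectors (Fin.cons w fun i : Fin d => Pi.single i 1)
    (span_eq_top_of_single fun i => ⟨i.succ, rfl⟩) 1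
    (fun i => by
      induction i using Fin.cases with
      | zero => simpa [dotProduct] using hs
      | succ i => simp)
    (fun i => by
      induction i using Fin.cases with
      | zero =>
        -- The entry `-1` at `q` keeps `w` out of the orthant, so `w` is not redundant.
        refine ⟨Pi.single q 1, by simp [hq], fun j hj => ?_⟩
        obtain ⟨j, rfl⟩ := Fin.exists_succ_eq.2 hj
        rw [Fin.cons_succ, single_one_dotProduct, Pi.single_apply]
        split_ifs <;> simp
      | succ i =>
        obtain ⟨l, hl, hli⟩ : ∃ l, w l = 1 ∧ l ≠ i := by
          by_cases h : p = i
          · exact ⟨p', hp', fun h' => hpp' (h.trans h'.symm)⟩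
          · exact ⟨p, hp, h⟩
        -- This functional is negative on `e_i` and nonnegative on the other basis vectors. On `w`
        -- it is `1 - w i ≥ 0`. Two entries equal to `1` are required so that `l ≠ i` can always be
        -- found.
        refine ⟨Pi.single l 1 - Pi.single i 1, by
          simp [hli], fun j hj => ?_⟩
        rw [sub_dotProduct, single_one_dotProduct, single_one_dotProduct]
        induction j using Fin.cases with
        | zero =>
          have := (abs_le.1 (hw i)).2
          simp only [Fin.cons_zero, hl]
          linarith
        | succ j =>
          have hij : i ≠ j := fun h => hj (by rw [h])
          simp only [Fin.cons_succ, Pi.single_apply, if_neg hij]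
          split_ifs <;> simp)
    (fun i => by
      induction i using Fin.cases with
      | zero => exact ⟨p, hp⟩
      | succ i => exact ⟨i, by simp⟩)

local notation "τ" => halfCone hw hs hpp' hp hp' hq

theorem rowMatrix_halfCone : (τ).rowMatrix (fun i : Fin d => i.succ) = 1 := by
  ext i j
  change (Pi.single i 1 : Fin d → ℤ) j = _
  rw [Matrix.one_apply, Pi.single_apply]
  simp [eq_comm]

theorem coord_halfCone : (τ).coord (fun i : Fin d => i.succ) (0 : Fin (d + 1)) = w := by
  have h : (τ).coord (fun i : Fin d => i.succ) (0 : Fin (d + 1)) =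
      Matrix.vecMul w ((τ).rowMatrix fun i : Fin d => i.succ)⁻¹ := rfl
  rw [h, rowMatrix_halfCone, inv_one, Matrix.vecMul_one]

theorem nonempty_halfCone_algEquiv (k : Type*) [Field k] :
    Nonempty ((τ).Ring k ≃ₐ[k] AddMonoidAlgebra k (halfMonoid w)) := by
  refine nonempty_algEquiv_halfMonoid (σ := τ) k (f := fun i : Fin d => i.succ)
    (by rw [rowMatrix_halfCone, Matrix.det_one]; exact isUnit_one) (w := w) fun y _ => ?_
  constructor
  · intro h (j : Fin (d + 1)) hj
    induction j using Fin.cases with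
    | zero => exact h.trans_eq (congrArg _ (coord_halfCone hw hs hpp' hp hp' hq).symm)
    | succ j => exact absurd ⟨j, rfl⟩ hj
  · intro h
    refine (h (0 : Fin (d + 1)) ?_).trans_eq
      (congrArg _ (coord_halfCone hw hs hpp' hp hp' hq))
    rintro ⟨j, hj⟩
    exact Fin.succ_ne_zero j hj

theorem boxVolume_halfCone {n : ℕ} (hn : (slabSupport w).card = n + 1) :
    (τ).boxVolume = spline n (slabShift w) := by
  have h : (τ).box = slab w ∩ Set.univ.pi fun _ => Set.Ico (0 : ℝ) 1 := by
    ext x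
    have h1 : ∀ i : Fin d, x ⬝ᵥ latticeVec ((τ).v i.succ) = x i := fun i => by
      change x ⬝ᵥ latticeVec (Pi.single i 1) = x i
      rw [latticeVec_single, Pi.basisFun_apply, dotProduct_single_one]
    constructor
    · intro hx
      exact ⟨hx (0 : Fin (d + 1)), fun i _ => h1 i ▸ hx i.succ⟩
    · rintro ⟨hx, hx'⟩ (i : Fin (d + 1))
      induction i using Fin.cases with
      | zero => exact hx
      | succ i => exact (h1 i).symm ▸ hx' i trivial
  rw [boxVolume, h, measureReal_def, ← Measure.restrict_apply (measurableSet_slab w),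
    ← cubeMeasure_eq_restrict, cubeMeasure_slab_eq_spline hw hn,
    ENNReal.toReal_ofReal (spline_nonneg _ _)]

theorem mem_dualMonoid_halfCone {y : Fin d → ℤ} :
    y ∈ (τ).dualMonoid ↔ (∀ i, 0 ≤ y i) ∧ 0 ≤ y ⬝ᵥ w := by
  constructor
  · intro h
    refine ⟨fun i => ?_, h (0 : Fin (d + 1))⟩
    have : 0 ≤ y ⬝ᵥ Pi.single i 1 := h i.succ
    rwa [dotProduct_single_one] at this
  · rintro ⟨h, h'⟩ (i : Fin (d + 1))
    induction i using Fin.cases with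
    | zero => exact h'
    | succ i =>
      change 0 ≤ y ⬝ᵥ Pi.single i 1
      rw [dotProduct_single_one]
      exact h i

/-- The sum of the entries where `w` is `1` is an additive degree, nonnegative on the monoid. In
degree `0` the condition `⟨z, w⟩ ≥ 0` forces the entries where `w = -1` to vanish as well, so
elements of degree `1` do not decompose. -/
theorem halfCone_indecomposable (hw0 : ∀ i, w i ≠ 0) {u : (τ).dualMonoid}
    (hu : ∑ i, (if w i = 1 then u.1 i else 0) = 1) (x y : (τ).dualMonoid) (hxy : x + y = u) :
    x = 0 ∨ y = 0 := by
  have hpos : ∀ z : (τ).dualMonoid, 0 ≤ ∑ i, (if w i = 1 then z.1 i else 0) := fun z =>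
    Finset.sum_nonneg fun i _ => by
      split_ifs
      · exact ((mem_dualMonoid_halfCone hw hs hpp' hp hp' hq).1 z.2).1 i
      · exact le_rfl
  have hzero : ∀ z : (τ).dualMonoid, ∑ i, (if w i = 1 then z.1 i else 0) = 0 → z = 0 := by
    intro z hz
    obtain ⟨hz1, hz2⟩ := (mem_dualMonoid_halfCone hw hs hpp' hp hp' hq).1 z.2
    have h1 : ∀ i, w i = 1 → z.1 i = 0 := fun i hi => by
      have := (Finset.sum_eq_zero_iff_of_nonneg fun i _ => by
        split_ifs
        · exact hz1 i
        · exact le_rfl).1 hz i (Finset.mem_univ i)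
      rwa [if_pos hi] at this
    have h2 : ∀ i ∈ Finset.univ, z.1 i * w i ≤ 0 := fun i _ => by
      by_cases hi : w i = 1
      · rw [h1 i hi, zero_mul]
      · have h3 := abs_le.1 (hw i)
        have h4 := hw0 i
        exact mul_nonpos_of_nonneg_of_nonpos (hz1 i) (by omega)
    have h3 := (Finset.sum_eq_zero_iff_of_nonpos h2).1 (le_antisymm (Finset.sum_nonpos h2) hz2)
    apply Subtype.ext
    funext i
    exact (mul_eq_zero.1 (h3 i (Finset.mem_univ i))).resolve_right (hw0 i)
  have hsum : ∑ i, (if w i = 1 then x.1 i else 0) + ∑ i, (if w i = 1 then y.1 i else 0) = 1 := by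
    refine Eq.trans ?_ hu
    rw [← hxy, ← Finset.sum_add_distrib]
    refine Finset.sum_congr rfl fun i _ => ?_
    split_ifs
    · rfl
    · exact add_zero 0
  have hx := hpos x
  have hy := hpos y
  have : ∑ i, (if w i = 1 then x.1 i else 0) = 0 ∨ ∑ i, (if w i = 1 then y.1 i else 0) = 0 := by
    omega
  exact this.imp (hzero x) (hzero y)

/-- Each facet prime contains two monomials of degree one. The exponents are `e_p, e_{p'}` for the
generator `w`, `e_i, e_i + e_q` for `e_i` with `w i = 1`, and `e_p + e_i, e_{p'} + e_i` for `e_i`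
with `w i = -1`. -/
theorem not_isPrincipal_facetPrime_halfCone (k : Type*) [Field k] (hw0 : ∀ i, w i ≠ 0)
    (i : Fin (τ).n) : ¬ ((τ).facetPrime k i).IsPrincipal := by
  have hind := fun u => halfCone_indecomposable hw hs hpp' hp hp' hq hw0 (u := u)
  have hmem1 : ∀ l, w l = 1 → Pi.single l 1 ∈ (τ).dualMonoid := fun l hl => by
    rw [mem_dualMonoid_halfCone]
    refine ⟨fun i => ?_, by rw [single_one_dotProduct, hl]; norm_num⟩
    rw [Pi.single_apply]
    split_ifs <;> simp
  have hmem2 : ∀ l m, w l = 1 → w m = -1 →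
      Pi.single l 1 + Pi.single m 1 ∈ (τ).dualMonoid := fun l m hl hm => by
    rw [mem_dualMonoid_halfCone]
    refine ⟨fun i => ?_, by
      rw [add_dotProduct, single_one_dotProduct, single_one_dotProduct, hl, hm]; norm_num⟩
    rw [Pi.add_apply, Pi.single_apply, Pi.single_apply]
    split_ifs <;> simp
  have hdeg1 : ∀ l, w l = 1 →
      ∑ i, (if w i = 1 then (Pi.single l 1 : Fin d → ℤ) i else 0) = 1 := fun l hl => by
    rw [Finset.sum_eq_single l]
    · simp [hl]
    · intro b _ hb; simp [hb]
    · simp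
  have hdeg2 : ∀ l m, w l = 1 → w m = -1 →
      ∑ i, (if w i = 1 then (Pi.single l 1 + Pi.single m 1 : Fin d → ℤ) i else 0) = 1 :=
    fun l m hl hm => by
    refine Eq.trans ?_ (hdeg1 l hl)
    refine Finset.sum_congr rfl fun i _ => ?_
    split_ifs with hi
    · have : i ≠ m := by rintro rfl; omega
      simp [this]
    · rfl
  change Fin (d + 1) at i
  induction i using Fin.cases with
  | zero =>
    refine not_isPrincipal_facetPrime τ k (u := ⟨_, hmem1 p hp⟩) (u' := ⟨_, hmem1 p' hp'⟩) ?_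
      (hind _ (hdeg1 p hp)) (hind _ (hdeg1 p' hp')) ?_ ?_
    · intro h
      have := congrFun (congrArg Subtype.val h) p
      simp [hpp'] at this
    · change 1 ≤ Pi.single p 1 ⬝ᵥ w
      rw [single_one_dotProduct, hp]
    · change 1 ≤ Pi.single p' 1 ⬝ᵥ w
      rw [single_one_dotProduct, hp']
  | succ i =>
    have hi1 := abs_le.1 (hw i)
    have hi0 := hw0 i
    by_cases hi : w i = 1
    · refine not_isPrincipal_facetPrime τ k (u := ⟨_, hmem1 i hi⟩) (u' := ⟨_, hmem2 i q hi hq⟩) ?_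
        (hind _ (hdeg1 i hi)) (hind _ (hdeg2 i q hi hq)) ?_ ?_
      · intro h
        have := congrFun (congrArg Subtype.val h) q
        simp at this
      · change 1 ≤ Pi.single i 1 ⬝ᵥ Pi.single i 1
        simp
      · change 1 ≤ (Pi.single i 1 + Pi.single q 1) ⬝ᵥ Pi.single i 1
        have : i ≠ q := by rintro rfl; omega
        simp [this]
    · have hi' : w i = -1 := by omega
      refine not_isPrincipal_facetPrime τ k (u := ⟨_, hmem2 p i hp hi'⟩)
        (u' := ⟨_, hmem2 p' i hp' hi'⟩) ?_
        (hind _ (hdeg2 p i hp hi')) (hind _ (hdeg2 p' i hp' hi')) ?_ ?_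
      · intro h
        have := congrFun (congrArg Subtype.val h) p
        simp [hpp'] at this
      · change 1 ≤ (Pi.single p 1 + Pi.single i 1) ⬝ᵥ Pi.single i 1
        have : p ≠ i := by rintro rfl; omega
        simp [this]
      · change 1 ≤ (Pi.single p' 1 + Pi.single i 1) ⬝ᵥ Pi.single i 1
        have : p' ≠ i := by rintro rfl; omega
        simp [this]

end halfCone

/-- The polynomial rings over `k[x_i y_j | 0 ≤ i, j ≤ a]` are toric rings. -/
theorem exists_segre {a r d : ℕ} (ha : 1 ≤ a) (hd : d = 2 * a + 1 + r) :
    ∃ σ : ToricCone d, σ.boxVolume = spline (2 * a) 0 ∧ ∀ (k : Type u) [Field k],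
      Nonempty (σ.Ring k ≃ₐ[k] MvPolynomial (Fin r) (segreRing k a a)) ∧
      (r = 0 → ∀ i, ¬ (σ.facetPrime k i).IsPrincipal) := by
  obtain ⟨g⟩ : Nonempty (Fin (a + 1) ⊕ Fin a ⊕ Fin r ≃ Fin d) :=
    Fintype.card_eq.1 (by simp; omega)
  obtain ⟨w, hg⟩ : ∃ w : Fin d → ℤ, ∀ s, w (g s) =
      Sum.elim (fun _ => 1) (Sum.elim (fun _ => -1) fun _ => 0) s :=
    ⟨fun i => Sum.elim (fun _ => 1) (Sum.elim (fun _ => -1) fun _ => 0) (g.symm i), by simp⟩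
  have hw : ∀ i, |w i| ≤ 1 := fun i => by
    obtain ⟨s, rfl⟩ := g.surjective i
    rw [hg]
    rcases s with s | s | s <;> simp
  have hs : ∑ i, w i = 1 := by
    have := dotProduct_eq_of_equiv g hg 1
    rw [one_dotProduct] at this
    simpa using this
  have hcard : (slabSupport w).card = 2 * a + 1 := by
    rw [slabSupport, Finset.card_filter, ← Equiv.sum_comp g, Fintype.sum_sum_type,
      Fintype.sum_sum_type]
    simp [hg]
    omega
  have hp : w (g (Sum.inl 0)) = 1 := hg _
  have hp' : w (g (Sum.inl (Fin.last a))) = 1 := hg _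
  have hq : w (g (Sum.inr (Sum.inl ⟨0, ha⟩))) = -1 := hg _
  have hpp' : g (Sum.inl 0) ≠ g (Sum.inl (Fin.last a)) := fun h => by
    have := congrArg Fin.val (Sum.inl_injective (g.injective h))
    simp at this
    omega
  have hs0 : 0 < ∑ i, w i := by rw [hs]; norm_num
  refine ⟨halfCone hw hs0 hpp' hp hp' hq, ?_, fun k _ => ⟨?_, ?_⟩⟩
  · rw [boxVolume_halfCone hw hs0 hpp' hp hp' hq hcard, slabShift, hs]
    simp
  · obtain ⟨e⟩ := nonempty_halfCone_algEquiv hw hs0 hpp' hp hp' hq k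
    obtain ⟨e'⟩ := nonempty_algEquiv_mvPolynomial_segreRing g k hg
    exact ⟨e.trans e'⟩
  · rintro rfl
    refine not_isPrincipal_facetPrime_halfCone hw hs0 hpp' hp hp' hq k fun i => ?_
    obtain ⟨s, rfl⟩ := g.surjective i
    rw [hg]
    rcases s with s | s | s
    · simp
    · simp
    · exact s.elim0

/-- A toric ring of F-signature greater than `1 / 2` is a polynomial ring over `k` or over the
coordinate ring of `ℙ^1 # ℙ^1` or `ℙ^2 # ℙ^2`. -/
theorem classification {d : ℕ} (σ : ToricCone d) (h : 1 / 2 < σ.boxVolume) (k : Type u)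
    [Field k] :
    Nonempty (σ.Ring k ≃ₐ[k] MvPolynomial (Fin d) k) ∨
    ∃ a r, (a = 1 ∨ a = 2) ∧ Nonempty (σ.Ring k ≃ₐ[k] MvPolynomial (Fin r) (segreRing k a a)) ∧
      ((∀ i, ¬ (σ.facetPrime k i).IsPrincipal) → r = 0) := by
  obtain ⟨f, hf⟩ := σ.exists_isUnit_det_rowMatrix h
  by_cases hall : ∀ j, j ∈ Set.range f
  · left
    obtain ⟨e⟩ := nonempty_algEquiv_halfMonoid k hf (w := 0) fun y _ => by
      rw [dotProduct_zero]
      exact ⟨fun _ j hj => absurd (hall j) hj, fun _ => le_rfl⟩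
    obtain ⟨e'⟩ := nonempty_algEquiv_mvPolynomial k d
    exact ⟨e.trans e'⟩
  right
  push Not at hall
  obtain ⟨j, hj⟩ := hall
  obtain ⟨hs, hc⟩ := sum_coord_eq_one h hf hj
  have hw := abs_coord_le h hf j
  have huniq : ∀ l, l ∉ Set.range f → l = j := fun l hl => eq_of_notMem_range h hf hl hj
  set w := σ.coord f j with hwdef
  obtain ⟨a, ha, hcard⟩ : ∃ a, (a = 1 ∨ a = 2) ∧ (slabSupport w).card = 2 * a + 1 := by
    rcases hc with hc | hc
    · exact ⟨1, Or.inl rfl, hc⟩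
    · exact ⟨2, Or.inr rfl, hc⟩
  have htri : ∀ i, w i = 1 ∨ w i = -1 ∨ w i = 0 := fun i => by
    have := abs_le.1 (hw i)
    omega
  have hsum : ∑ i, w i = ((Finset.univ.filter fun i => w i = 1).card : ℤ) -
      (Finset.univ.filter fun i => w i = -1).card := by
    rw [Finset.card_filter, Finset.card_filter]
    push_cast
    rw [← Finset.sum_sub_distrib]
    refine Finset.sum_congr rfl fun i _ => ?_
    rcases htri i with h | h | h <;> simp [h]
  have hsupp : (slabSupport w).card = (Finset.univ.filter fun i => w i = 1).card +
      (Finset.univ.filter fun i => w i = -1).card := by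
    rw [slabSupport, Finset.card_filter, Finset.card_filter, Finset.card_filter,
      ← Finset.sum_add_distrib]
    refine Finset.sum_congr rfl fun i _ => ?_
    rcases htri i with h | h | h <;> simp [h]
  -- Sum `1` and support of size `2 * a + 1` leave `a + 1` entries `1` and `a` entries `-1`.
  obtain ⟨g, hg⟩ := exists_equiv_of_card (a := a) hw (by omega) (by omega) rfl
  refine ⟨a, (Finset.univ.filter fun i => w i = 0).card, ha, ?_, fun hprinc => ?_⟩
  · obtain ⟨e⟩ := nonempty_algEquiv_halfMonoid k hf (w := w) fun y _ =>
      ⟨fun hy l hl => by rw [huniq l hl]; exact hy, fun hy => hy j hj⟩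
    obtain ⟨e'⟩ := nonempty_algEquiv_mvPolynomial_segreRing g k hg
    exact ⟨e.trans e'⟩
  -- A zero entry of `w` is a basis generator absent from the only other generator; its facet prime
  -- would be principal.
  · rw [Finset.card_eq_zero, Finset.filter_eq_empty_iff]
    intro i _ hi
    exact hprinc (f i) (isPrincipal_facetPrime k hf fun l hl => by rw [huniq l hl]; exact hi)

end ToricCone

end

end

/-! ### The main theorem. -/

theorem mainTheorem4 (p : ℕ) [Fact p.Prime] (k : Type*) [Field k] [IsAlgClosed k] [CharP k p] :
    -- every toric ring has an F-signature, and those with F-signature `> 1/2` are the following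
    (∀ (d : ℕ) (σ : ToricCone d), ∃ s : ℝ, HasFSignature p (σ.LocalRing k) s ∧
      -- if no polynomial variable splits off, or if the ring is a polynomial ring
      (((∀ i, ¬ (σ.facetPrime k i).IsPrincipal) ∨
          Nonempty (σ.Ring k ≃ₐ[k] MvPolynomial (Fin d) k)) →
        (1 / 2 < s ↔
          Nonempty (σ.Ring k ≃ₐ[k] MvPolynomial (Fin d) k) ∨
          Nonempty (σ.Ring k ≃ₐ[k] segreRing k 1 1) ∨
          Nonempty (σ.Ring k ≃ₐ[k] segreRing k 2 2))) ∧
      -- in general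
      (1 / 2 < s ↔
        Nonempty (σ.Ring k ≃ₐ[k] MvPolynomial (Fin d) k) ∨
        (∃ r, Nonempty (σ.Ring k ≃ₐ[k] MvPolynomial (Fin r) (segreRing k 1 1))) ∨
        (∃ r, Nonempty (σ.Ring k ≃ₐ[k] MvPolynomial (Fin r) (segreRing k 2 2)))) ∧
      -- the values
      (Nonempty (σ.Ring k ≃ₐ[k] MvPolynomial (Fin d) k) → s = 1) ∧
      (Nonempty (σ.Ring k ≃ₐ[k] segreRing k 1 1) → s = 2 / 3) ∧
      (Nonempty (σ.Ring k ≃ₐ[k] segreRing k 2 2) → s = 11 / 20) ∧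
      (∀ r, Nonempty (σ.Ring k ≃ₐ[k] MvPolynomial (Fin r) (segreRing k 1 1)) → s = 2 / 3) ∧
      (∀ r, Nonempty (σ.Ring k ≃ₐ[k] MvPolynomial (Fin r) (segreRing k 2 2)) → s = 11 / 20)) ∧
    -- all the rings in the lists are toric rings
    (∀ d, ∃ σ : ToricCone d, Nonempty (σ.Ring k ≃ₐ[k] MvPolynomial (Fin d) k)) ∧
    (∃ σ : ToricCone 3, (∀ i, ¬ (σ.facetPrime k i).IsPrincipal) ∧
      Nonempty (σ.Ring k ≃ₐ[k] segreRing k 1 1)) ∧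
    (∃ σ : ToricCone 5, (∀ i, ¬ (σ.facetPrime k i).IsPrincipal) ∧
      Nonempty (σ.Ring k ≃ₐ[k] segreRing k 2 2)) ∧
    (∀ r, ∃ σ : ToricCone (3 + r),
      Nonempty (σ.Ring k ≃ₐ[k] MvPolynomial (Fin r) (segreRing k 1 1))) ∧
    (∀ r, ∃ σ : ToricCone (5 + r),
      Nonempty (σ.Ring k ≃ₐ[k] MvPolynomial (Fin r) (segreRing k 2 2))) := by
  have hp : 1 < p := (Fact.out : p.Prime).one_lt
  -- The value is computed on the explicit model cone and carried over by the invariance of the box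
  -- volume, which does not require the two cones to have the same dimension beforehand.
  have hval : ∀ (d : ℕ) (σ : ToricCone d) (a r : ℕ), 1 ≤ a →
      Nonempty (σ.Ring k ≃ₐ[k] MvPolynomial (Fin r) (segreRing k a a)) →
        σ.boxVolume = spline (2 * a) 0 := by
    rintro d σ a r ha ⟨e⟩
    obtain ⟨τ, hτ, hτ'⟩ := ToricCone.exists_segre (r := r) ha rfl
    obtain ⟨⟨e'⟩, -⟩ := hτ' k
    rw [← hτ]
    exact σ.boxVolume_eq_of_ringEquiv p hp (e.trans e'.symm).toRingEquiv
  have hval0 : ∀ (d : ℕ) (σ : ToricCone d) (a : ℕ), 1 ≤ a →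
      Nonempty (σ.Ring k ≃ₐ[k] segreRing k a a) → σ.boxVolume = spline (2 * a) 0 := by
    rintro d σ a ha ⟨e⟩
    exact hval d σ a 0 ha
      ⟨e.trans ((MvPolynomial.isEmptyAlgEquiv (segreRing k a a) (Fin 0)).symm.restrictScalars k)⟩
  have hpoly : ∀ (d : ℕ) (σ : ToricCone d),
      Nonempty (σ.Ring k ≃ₐ[k] MvPolynomial (Fin d) k) → σ.boxVolume = 1 := by
    rintro d σ ⟨e⟩
    obtain ⟨e'⟩ := ToricCone.nonempty_orthant_algEquiv k d
    rw [← ToricCone.boxVolume_orthant d]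
    exact σ.boxVolume_eq_of_ringEquiv p hp (e.trans e'.symm).toRingEquiv
  have h1 : spline (2 * 1) 0 = 2 / 3 := spline_two_zero
  have h2 : spline (2 * 2) 0 = 11 / 20 := spline_four_zero
  have hdim : ∀ a r d : ℕ, 1 ≤ a → d = 2 * a + 1 + r → ∃ σ : ToricCone d,
      (r = 0 → ∀ i, ¬ (σ.facetPrime k i).IsPrincipal) ∧
      Nonempty (σ.Ring k ≃ₐ[k] MvPolynomial (Fin r) (segreRing k a a)) := by
    intro a r d ha hd
    obtain ⟨σ, -, hσ⟩ := ToricCone.exists_segre (r := r) ha hd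
    exact ⟨σ, (hσ k).2, (hσ k).1⟩
  have hdim0 : ∀ a d : ℕ, 1 ≤ a → d = 2 * a + 1 → ∃ σ : ToricCone d,
      (∀ i, ¬ (σ.facetPrime k i).IsPrincipal) ∧
      Nonempty (σ.Ring k ≃ₐ[k] segreRing k a a) := by
    intro a d ha hd
    obtain ⟨σ, hσ, ⟨e⟩⟩ := hdim a 0 d ha hd
    exact ⟨σ, hσ rfl,
      ⟨e.trans ((MvPolynomial.isEmptyAlgEquiv (segreRing k a a) (Fin 0)).restrictScalars k)⟩⟩
  refine ⟨fun d σ => ⟨σ.boxVolume, σ.hasFSignature_boxVolume k p hp, fun hprinc => ⟨fun h => ?_, ?_⟩,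
    ⟨fun h => ?_, ?_⟩, hpoly d σ, fun h => (hval0 d σ 1 le_rfl h).trans h1,
    fun h => (hval0 d σ 2 one_le_two h).trans h2, fun r h => (hval d σ 1 r le_rfl h).trans h1,
    fun r h => (hval d σ 2 r one_le_two h).trans h2⟩,
    fun d => ⟨ToricCone.orthant d, ToricCone.nonempty_orthant_algEquiv k d⟩,
    hdim0 1 3 le_rfl rfl, hdim0 2 5 one_le_two rfl, fun r => ?_, fun r => ?_⟩
  · rcases σ.classification h k with h | ⟨a, r, ha, ⟨e⟩, hr⟩
    · exact Or.inl h
    rcases hprinc with hprinc | hprinc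
    · obtain rfl := hr hprinc
      let e' := e.trans
        ((MvPolynomial.isEmptyAlgEquiv (segreRing k a a) (Fin 0)).restrictScalars k)
      rcases ha with rfl | rfl
      · exact Or.inr (Or.inl ⟨e'⟩)
      · exact Or.inr (Or.inr ⟨e'⟩)
    · exact Or.inl hprinc
  · rintro (h | h | h)
    · rw [hpoly d σ h]; norm_num
    · rw [hval0 d σ 1 le_rfl h, h1]; norm_num
    · rw [hval0 d σ 2 one_le_two h, h2]; norm_num
  · rcases σ.classification h k with h | ⟨a, r, ha, he, -⟩
    · exact Or.inl h
    · rcases ha with rfl | rfl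
      · exact Or.inr (Or.inl ⟨r, he⟩)
      · exact Or.inr (Or.inr ⟨r, he⟩)
  · rintro (h | ⟨r, h⟩ | ⟨r, h⟩)
    · rw [hpoly d σ h]; norm_num
    · rw [hval d σ 1 r le_rfl h, h1]; norm_num
    · rw [hval d σ 2 r one_le_two h, h2]; norm_num
  · obtain ⟨σ, -, hσ⟩ := hdim 1 r (3 + r) le_rfl rfl
    exact ⟨σ, hσ⟩
  · obtain ⟨σ, -, hσ⟩ := hdim 2 r (5 + r) one_le_two rfl
    exact ⟨σ, hσ⟩
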